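/- **Setting.** Let $d\in\{2,3\}$ and let $\Omega\subset\mathbb R^d$ be a nonempty open bounded polytopal set with a matching mesh $\mathbb T_h$ of finitely many closed simplices $T$ ($\Omega$ is the interior of $\bigcup T$, and any two elements meet in a common face or not at all) that is shape regular with parameter $\sigma>0$: each $T$ contains a ball of radius $h_T/\sigma$, $h_T=\operatorname{diam}T$. Let $\nu>0$ be constant on each element, $f\in L^2(\Omega)$, $\gamma_0>0$, and let $V_h$ be the space of discontinuous, piecewise affine functions. On an interior face $F=\partial T_1\cap\partial T_2$ with outward unit normals $n_1,n_2$ put $[v]=v_1n_1+v_2n_2$, $\{\!\{\nu\nabla_h u\}\!\}_w=\frac{2\nu_2}{\nu_1+\nu_2}\nu_1\nabla u_1+\frac{2\nu_1}{\nu_1+\nu_2}\nu_2\nabla u_2$ and $\gamma_h^2=\frac{\gamma_0^2}{h_F}\frac{2\nu_1\nu_2}{\nu_1+\nu_2}$, $h_F=\operatorname{diam}F$; on a boundary face put $[v]=vn$ and $\gamma_h^2=\gamma_0^2\nu/h_F$. For an open $D\subset\Omega$ let $\langle\cdot,\cdot\rangle_{i,D}$ and $\langle\cdot,\cdot\rangle_{\partial,D}$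 be the $L^2$ inner products over $F\cap D$ for all interior faces $F$, and over $F\cap\partial D$ for all boundary faces $F$, respectively, and set $$B_D(u,v)=(\nu\nabla_hu,\nabla_hv)_D+\langle\gamma_h^2[u],[v]\rangle_{i,D}-\tfrac12\langle\{\!\{\nu\nabla_hu\}\!\}_w,[v]\rangle_{i,D}-\tfrac12\langle\{\!\{\nu\nabla_hv\}\!\}_w,[u]\rangle_{i,D}+2\langle\gamma_h^2[u],[v]\rangle_{\partial,D}-\langle\nu\nabla_hu,vn\rangle_{\partial,D}-\langle\nu\nabla_hv,un\rangle_{\partial,D},$$ $$B_D^+(u,v)=(\nu\nabla_hu,\nabla_hv)_D+\langle\gamma_h^2[u],[v]\rangle_{i,D}+\langle\gamma_h^2[u],[v]\rangle_{\partial,D},\qquad \|v\|_{B^+,D}=B_D^+(v,v)^{1/2},$$ and $B=B_\Omega$. Let $D^-$ be the union of the closed elements that do not meet $\Omega\setminus D$, $\mathcal H(D)=\{v|_D:v\in V_h\}$, $\mathcal H_0(D)=\{v|_D:v\in V_h,\ v=0\text{ on }D\setminus D^-\}$ (extended by zero to $\Omega$), and $\mathcal H_B(D)=\{u\in\mathcal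 H(D):B_D(u,v)=0\ \forall v\in\mathcal H_0(D)\}$. Let $C_B(D)$ be the smallest $C\ge 0$ with $|B_D(u,v)|\le C\|u\|_{B^+,D}\|v\|_{B^+,D}$ and $\alpha_B(D)$ the largest $\alpha\in\mathbb R$ with $B_D(v,v)\ge\alpha\|v\|_{B^+,D}^2$, for all $u,v\in\mathcal H(D)$. Let $\omega_1,\dots,\omega_M$ be nonempty, each the interior of a union of elements, with $\bigcup_j\omega_j=\Omega$, and let $\omega_j^*$ be open with $\omega_j\subset\omega_j^*\subset\Omega$ such that almost every point of $\partial\omega_j^*\cap\partial\Omega$ (surface measure) has a neighbourhood $U$ with $U\cap\Omega\subset\omega_j^*$ (as is the case for unions of elements). Let $\chi_j$ be continuous on $\overline\Omega$, affine on each element, $0\le\chi_j\le1$, $\sum_j\chi_j=1$, $\operatorname{supp}\chi_j\subset\overline{\omega_j^-}$, and let $P_j(u)=I_h(\chi_ju)$ with the elementwise affine Lagrange interpolation $I_h$. Let $(\lambda^j_k,\varphi^j_k)_{k=1}^{K_j}$ be eigenpairs, $\lambda_1^j\ge\lambda_2^j\ge\cdots$ in $[0,\infty]$ and $(\varphi_k^j)_k$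 a basis of $\mathcal H_B(\omega_j^*)$, of $$B^+_{\omega_j}(P_j(\varphi|_{\omega_j}),P_j(v|_{\omega_j}))=\lambda B^+_{\omega_j^*}(\varphi,v)\quad\forall v\in\mathcal H_B(\omega_j^*),$$ where $\lambda=\infty$ means $B^+_{\omega_j^*}(\varphi,\cdot)=0$ on $\mathcal H_B(\omega_j^*)$; put $\lambda^j_{K_j+1}=0$. For $0\le n_j\le K_j$ let $S_{n_j}(\omega_j)=\operatorname{span}\{\varphi^j_k|_{\omega_j}:k\le n_j\}$ and $S_n(\Omega)=\{\sum_jP_j\phi_j:\phi_j\in S_{n_j}(\omega_j)\}$. Let $u^e\in V_h$ solve $B(u^e,v)=\int_\Omega fv$ for all $v\in V_h$, let $\psi_j\in\mathcal H_0(\omega_j^*)$ solve $B_{\omega_j^*}(\psi_j,v)=\int_{\omega_j^*}fv$ for all $v\in\mathcal H_0(\omega_j^*)$, and put $u^p=\sum_jP_j(\psi_j|_{\omega_j})$ and $u^G=u^p+u^s$, where $u^s\in S_n(\Omega)$ satisfies $B(u^s,v)=\int_\Omega fv-B(u^p,v)$ for all $v\in S_n(\Omega)$. Let $\kappa$ and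 $\kappa^*$ be the coloring constants of $\{\omega_j\}$ and $\{\omega_j^*\}$, i.e. the least numbers of colors such that different sets of equal color are disjoint. **Theorem.** (a) There is $\gamma_{\min}>0$, depending only on $d$ and $\sigma$, such that if $\gamma_0\ge\gamma_{\min}$, then $\alpha_B(\Omega)>0$, and $\alpha_B(\omega_j^*)>0$ for every $j$ for which $\omega_j^*$ is the interior of a union of elements. (b) Whenever $\alpha_B(\Omega)>0$ and $\alpha_B(\omega_j^*)>0$ for all $j$, the functions $u^e$ and $u^G$ exist and are unique, and $$\|u^e-u^G\|_{B^+,\Omega}\le\frac{C_B(\Omega)}{\alpha_B(\Omega)}\sqrt{\kappa\kappa^*}\,\max_{j=1,\dots,M}\Big(\sqrt{\lambda^j_{n_j+1}}\,\frac{C_B(\omega_j^*)}{\alpha_B(\omega_j^*)}\Big)\|u^e\|_{B^+,\Omega}$$ (an inequality in $[0,\infty]$ with $\infty\cdot0=0$). -/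

import Mathlib

open MeasureTheory Set Topology
open scoped ENNReal InnerProductSpace

noncomputable section

namespace MSGFEM

/-- `ℝ^d` with the Euclidean norm. -/
abbrev Space (d : ℕ) : Type := EuclideanSpace ℝ (Fin d)

/-! ### Simplicial meshes -/

/-- A finite matching mesh of nondegenerate closed `d`-simplices. Two elements meet exactly in the
convex hull of their common vertices, i.e. in a common face of both, or not at all. -/
structure SimplicialMesh (d : ℕ) where
  /-- number of elements -/
  N : ℕ
  N_pos : 0 < N
  /-- the elements -/
  simplex : Fin N → Affine.Simplex ℝ (Space d) d
  /-- different elements have different vertex sets -/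
  vertices_injective : ∀ T T' : Fin N,
    range (simplex T).points = range (simplex T').points → T = T'
  /-- the mesh is matching -/
  matching : ∀ T T' : Fin N,
    convexHull ℝ (range (simplex T).points) ∩ convexHull ℝ (range (simplex T').points) =
      convexHull ℝ (range (simplex T).points ∩ range (simplex T').points)

variable {d : ℕ}

namespace SimplicialMesh

variable (𝒯 : SimplicialMesh d)

/-- The index type of the elements. -/
abbrev Elem : Type := Fin 𝒯.N

/-- The closed simplex `T`. -/
def elem (T : 𝒯.Elem) : Set (Space d) := convexHull ℝ (range (𝒯.simplex T).points)

/-- The union of all closed elements. -/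
def closedDomain : Set (Space d) := ⋃ T, 𝒯.elem T

/-- The open polytopal domain `Ω` that is triangulated by the mesh. -/
def Ω : Set (Space d) := interior 𝒯.closedDomain

/-- Shape regularity with parameter `σ`: every element `T` contains a ball of radius `h_T / σ`. -/
def ShapeRegular (σ : ℝ) : Prop :=
  ∀ T, ∃ x, Metric.ball x (Metric.diam (𝒯.elem T) / σ) ⊆ 𝒯.elem T

/-! ### Faces -/

/-- A side of the mesh: an element together with one of its facets, the facet being named by the
opposite vertex. -/
abbrev Side : Type := 𝒯.Elem × Fin (d + 1)

variable {𝒯} in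
/-- The vertex set of a facet. -/
def sideVertices (s : 𝒯.Side) : Set (Space d) := (𝒯.simplex s.1).points '' {s.2}ᶜ

variable {𝒯} in
/-- The closed facet. -/
def side (s : 𝒯.Side) : Set (Space d) := convexHull ℝ (sideVertices s)

variable {𝒯} in
/-- The unit normal of a facet, outward for the element: the direction from the opposite vertex to
its orthogonal projection on the hyperplane of the facet. -/
def normal [NeZero d] (s : 𝒯.Side) : Space d :=
  ‖(𝒯.simplex s.1).altitudeFoot s.2 - (𝒯.simplex s.1).points s.2‖⁻¹ •
    ((𝒯.simplex s.1).altitudeFoot s.2 - (𝒯.simplex s.1).points s.2)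

open Classical in
/-- The interior faces `F = ∂T₁ ∩ ∂T₂`, each listed once, as the pair of its two sides. -/
def interiorFaces : Finset (𝒯.Side × 𝒯.Side) :=
  Finset.univ.filter fun F => F.1.1 < F.2.1 ∧ sideVertices F.1 = sideVertices F.2

open Classical in
/-- The boundary faces: the facets that belong to one element only. -/
def boundaryFaces : Finset 𝒯.Side :=
  Finset.univ.filter fun s => ∀ s' : 𝒯.Side, sideVertices s' = sideVertices s → s' = s

/-! ### Elements and subdomains -/

/-- The elements in `D⁺`, i.e. those that meet `D`. -/
def outerElems (D : Set (Space d)) : Set 𝒯.Elem := {T | (𝒯.elem T ∩ D).Nonempty}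

/-- The elements in `D⁻`, i.e. the closed elements that do not meet `Ω \ D`. -/
def innerElems (D : Set (Space d)) : Set 𝒯.Elem := {T | 𝒯.elem T ∩ (𝒯.Ω \ D) = ∅}

/-- `D⁻`. -/
def inner (D : Set (Space d)) : Set (Space d) := ⋃ T ∈ 𝒯.innerElems D, 𝒯.elem T

/-- `D` is resolved by the mesh: it is the interior of a union of closed elements. -/
def MeshResolved (D : Set (Space d)) : Prop :=
  ∃ S : Set 𝒯.Elem, D = interior (⋃ T ∈ S, 𝒯.elem T)

/-- At almost every point of `∂D ∩ ∂Ω` (for the surface measure) the set `D` fills `Ω`, i.e. it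
contains all points of `Ω` in a neighbourhood. Mesh-resolved sets and polytopes in `Ω` are such. -/
def RegularAtBoundary (D : Set (Space d)) : Prop :=
  ∀ s ∈ 𝒯.boundaryFaces,
    ∀ᵐ x ∂((μHE[d - 1] : Measure (Space d)).restrict (side s ∩ frontier D)), D ∈ 𝓝[𝒯.Ω] x

/-! ### The discontinuous finite element space -/

/-- The space `V_h` of discontinuous, piecewise affine functions, given by their affine restrictions
to the elements. -/
abbrev Vh : Type := 𝒯.Elem → (Space d →ᵃ[ℝ] ℝ)

open Classical in
/-- Restriction `v ↦ v|_D`. A function on `D` is represented by its extension by zero to the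
elements that do not meet `D`. -/
def restrict (D : Set (Space d)) (v : 𝒯.Vh) : 𝒯.Vh :=
  fun T => if T ∈ 𝒯.outerElems D then v T else 0

/-- `ℋ(D) = {v|_D : v ∈ V_h}`. -/
def H (D : Set (Space d)) : Set 𝒯.Vh := range (𝒯.restrict D)

/-- `ℋ₀(D) = {v|_D : v ∈ V_h, v = 0 on D \ D⁻}`. The extension by zero `E_{D,D*}` is the inclusion
in this representation. -/
def H₀ (D : Set (Space d)) : Set 𝒯.Vh := {v | ∀ T ∉ 𝒯.innerElems D, v T = 0}

/-- The (constant) gradient of an affine function. -/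
def grad (a : Space d →ᵃ[ℝ] ℝ) : Space d :=
  (InnerProductSpace.toDual ℝ (Space d)).symm (LinearMap.toContinuousLinearMap a.linear)

/-- The vertices of an element form an affine basis. -/
def vertexBasis (T : 𝒯.Elem) : AffineBasis (Fin (d + 1)) ℝ (Space d) where
  toFun := (𝒯.simplex T).points
  ind' := (𝒯.simplex T).independent
  tot' := by
    rw [(𝒯.simplex T).independent.affineSpan_eq_top_iff_card_eq_finrank_add_one]
    simp

/-- The elementwise Lagrange interpolation operator `I_h`: the affine function on `T` with the
values of `g T` at the vertices of `T`. -/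
def interp (g : 𝒯.Elem → Space d → ℝ) : 𝒯.Vh :=
  fun T => ∑ k, g T ((𝒯.simplex T).points k) • (𝒯.vertexBasis T).coord k

/-- The partition of unity operator `P(u) = I_h(χ u)`. -/
def puOp (χ : Space d → ℝ) (u : 𝒯.Vh) : 𝒯.Vh := 𝒯.interp fun T x => χ x * u T x

/-! ### The weighted symmetric interior penalty forms -/

section Forms

variable [NeZero d]
variable (ν : 𝒯.Elem → ℝ) (γ₀ : ℝ) (D : Set (Space d)) (u v : 𝒯.Vh)

/-- `γ_h²` on an interior face. -/
def penaltyI (F : 𝒯.Side × 𝒯.Side) : ℝ :=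
  γ₀ ^ 2 / Metric.diam (side F.1) * (2 * ν F.1.1 * ν F.2.1 / (ν F.1.1 + ν F.2.1))

/-- `γ_h²` on a boundary face, where `ν₁ = ν₂ = ν`. -/
def penaltyB (s : 𝒯.Side) : ℝ :=
  γ₀ ^ 2 / Metric.diam (side s) * (2 * ν s.1 * ν s.1 / (ν s.1 + ν s.1))

/-- The jump `u₁ n₁ + u₂ n₂` on an interior face. -/
def jump (F : 𝒯.Side × 𝒯.Side) (x : Space d) : Space d :=
  u F.1.1 x • normal F.1 + u F.2.1 x • normal F.2

/-- The weighted sum of `ν ∇_h u` on an interior face. -/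
def wsum (F : 𝒯.Side × 𝒯.Side) : Space d :=
  (2 * ν F.2.1 / (ν F.1.1 + ν F.2.1)) • (ν F.1.1 • grad (u F.1.1)) +
    (2 * ν F.1.1 / (ν F.1.1 + ν F.2.1)) • (ν F.2.1 • grad (u F.2.1))

/-- `(ν ∇_h u, ∇_h v)_D`. -/
def volForm : ℝ :=
  ∑ T, ∫ _ in 𝒯.elem T ∩ D, ν T * ⟪grad (u T), grad (v T)⟫_ℝ

/-- `B^i_{c,D}`. -/
def BcI : ℝ :=
  1 / 2 * ∑ F ∈ 𝒯.interiorFaces,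
    ∫ x in side F.1 ∩ D, ⟪𝒯.wsum ν u F, 𝒯.jump v F x⟫_ℝ ∂(μHE[d - 1] : Measure (Space d))

/-- `B^i_{p,D}`. -/
def BpI : ℝ :=
  ∑ F ∈ 𝒯.interiorFaces,
    ∫ x in side F.1 ∩ D, 𝒯.penaltyI ν γ₀ F * ⟪𝒯.jump u F x, 𝒯.jump v F x⟫_ℝ
      ∂(μHE[d - 1] : Measure (Space d))

/-- `B^∂_{c,D}`. -/
def BcB : ℝ :=
  ∑ s ∈ 𝒯.boundaryFaces,
    ∫ x in side s ∩ frontier D, ⟪ν s.1 • grad (u s.1), v s.1 x • normal s⟫_ℝ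
      ∂(μHE[d - 1] : Measure (Space d))

/-- `⟨γ_h² u n, v n⟩` on the boundary faces. -/
def penB : ℝ :=
  ∑ s ∈ 𝒯.boundaryFaces,
    ∫ x in side s ∩ frontier D, 𝒯.penaltyB ν γ₀ s * ⟪u s.1 x • normal s, v s.1 x • normal s⟫_ℝ
      ∂(μHE[d - 1] : Measure (Space d))

/-- `B^i_D`. -/
def BI : ℝ := 𝒯.BpI ν γ₀ D u v - 𝒯.BcI ν D u v - 𝒯.BcI ν D v u

/-- `B^∂_D`, whose penalty part is `B^∂_{p,D} = 2 ⟨γ_h² u n, v n⟩`. -/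
def BB : ℝ := 2 * 𝒯.penB ν γ₀ D u v - 𝒯.BcB ν D u v - 𝒯.BcB ν D v u

/-- The DG bilinear form `B_D`. -/
def B : ℝ := 𝒯.volForm ν D u v + 𝒯.BI ν γ₀ D u v + 𝒯.BB ν γ₀ D u v

/-- The form `B_D^+`. -/
def Bplus : ℝ := 𝒯.volForm ν D u v + 𝒯.BpI ν γ₀ D u v + 𝒯.penB ν γ₀ D u v

/-- The (semi-)norm `‖v‖_{B^+,D}`. -/
def normPlus : ℝ := √(𝒯.Bplus ν γ₀ D v v)

/-- The continuity constant `C_B(D)` of `B_D` on `ℋ(D)` with respect to `‖·‖_{B^+,D}`. -/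
def contConst : ℝ :=
  sInf {C : ℝ | 0 ≤ C ∧ ∀ u ∈ 𝒯.H D, ∀ v ∈ 𝒯.H D,
    |𝒯.B ν γ₀ D u v| ≤ C * 𝒯.normPlus ν γ₀ D u * 𝒯.normPlus ν γ₀ D v}

/-- The coercivity constant `α_B(D)` of `B_D` on `ℋ(D)` with respect to `‖·‖_{B^+,D}`: the largest
admissible constant. The form is coercive iff it is positive. -/
def coerConst : ℝ :=
  sSup {α : ℝ | ∀ v ∈ 𝒯.H D, α * 𝒯.normPlus ν γ₀ D v ^ 2 ≤ 𝒯.B ν γ₀ D v v}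

/-- The functional `ℱ_D(v) = ∫_D f v`. -/
def load (f : Space d → ℝ) : ℝ := ∑ T, ∫ x in 𝒯.elem T ∩ D, f x * v T x

/-- The DG solution `u^e`. -/
def IsDGSolution (f : Space d → ℝ) : Prop :=
  ∀ v : 𝒯.Vh, 𝒯.B ν γ₀ 𝒯.Ω u v = 𝒯.load 𝒯.Ω v f

/-- The discretely harmonic functions `ℋ_B(D)`. -/
def HB : Set 𝒯.Vh := {u | u ∈ 𝒯.H D ∧ ∀ v ∈ 𝒯.H₀ D, 𝒯.B ν γ₀ D u v = 0}

/-! ### The local eigenproblems -/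

/-- `(lam, φ)` solves the local generalized eigenproblem on `D ⊆ Ds` with cut-off `χ`. The
eigenvalue `∞` means that `φ` is in the kernel of the form on the right-hand side. -/
def IsEigenpair (D Ds : Set (Space d)) (χ : Space d → ℝ) (lam : ℝ≥0∞) (φ : 𝒯.Vh) : Prop :=
  φ ∈ 𝒯.HB ν γ₀ Ds ∧
  (lam = ⊤ → ∀ v ∈ 𝒯.HB ν γ₀ Ds, 𝒯.Bplus ν γ₀ Ds φ v = 0) ∧
  (lam ≠ ⊤ → ∀ v ∈ 𝒯.HB ν γ₀ Ds,
    𝒯.Bplus ν γ₀ D (𝒯.puOp χ (𝒯.restrict D φ)) (𝒯.puOp χ (𝒯.restrict D v)) =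
      lam.toReal * 𝒯.Bplus ν γ₀ Ds φ v)

/-- A full system of eigenpairs, i.e. a basis of `ℋ_B(Ds)` of eigenfunctions, ordered by
nonincreasing eigenvalues. -/
structure IsEigensystem (D Ds : Set (Space d)) (χ : Space d → ℝ) {K : ℕ}
    (lam : Fin K → ℝ≥0∞) (φ : Fin K → 𝒯.Vh) : Prop where
  eigenpair : ∀ k, 𝒯.IsEigenpair ν γ₀ D Ds χ (lam k) (φ k)
  antitone : Antitone lam
  linearIndependent : LinearIndependent ℝ φ
  span_eq : (Submodule.span ℝ (range φ) : Set 𝒯.Vh) = 𝒯.HB ν γ₀ Ds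

end Forms

/-! ### Domain decomposition and the MS-GFEM approximation -/

/-- A mesh-resolved cover `ω_j` of `Ω` with oversampling domains `ω_j ⊆ ω_j* ⊆ Ω` and a continuous
piecewise affine partition of unity `χ_j` with support in the closure of `ω_j⁻`. -/
structure IsDecomposition {M : ℕ} (ω ωs : Fin M → Set (Space d))
    (χ : Fin M → Space d → ℝ) : Prop where
  resolved : ∀ j, 𝒯.MeshResolved (ω j)
  nonempty : ∀ j, (ω j).Nonempty
  cover : ⋃ j, ω j = 𝒯.Ω
  subset_over : ∀ j, ω j ⊆ ωs j
  over_subset : ∀ j, ωs j ⊆ 𝒯.Ω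
  over_open : ∀ j, IsOpen (ωs j)
  over_regular : ∀ j, 𝒯.RegularAtBoundary (ωs j)
  pu_continuous : ∀ j, ContinuousOn (χ j) 𝒯.closedDomain
  pu_affine : ∀ j T, ∃ a : Space d →ᵃ[ℝ] ℝ, EqOn (χ j) a (𝒯.elem T)
  pu_support : ∀ j, closure {x | x ∈ 𝒯.Ω ∧ χ j x ≠ 0} ⊆ closure (𝒯.inner (ω j))
  pu_mem : ∀ j, ∀ x ∈ 𝒯.closedDomain, χ j x ∈ Icc (0 : ℝ) 1
  pu_sum : ∀ x ∈ 𝒯.closedDomain, ∑ j, χ j x = 1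

/-- The local approximation space `S_n(ω_j)`, spanned by the restrictions to `ω_j` of the first `n`
eigenfunctions. -/
def localSpace (D : Set (Space d)) {K : ℕ} (φ : Fin K → 𝒯.Vh) (n : ℕ) : Submodule ℝ 𝒯.Vh :=
  Submodule.span ℝ {w | ∃ k : Fin K, (k : ℕ) < n ∧ w = 𝒯.restrict D (φ k)}

/-- The global coarse space `{∑_j P_j φ_j : φ_j ∈ S_j}`. -/
def coarseSpace {M : ℕ} (χ : Fin M → Space d → ℝ) (S : Fin M → Submodule ℝ 𝒯.Vh) : Set 𝒯.Vh :=
  {w | ∃ φ : Fin M → 𝒯.Vh, (∀ j, φ j ∈ S j) ∧ w = ∑ j, 𝒯.puOp (χ j) (φ j)}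

/-- `uG` is the MS-GFEM approximation built from the local approximation spaces `S_j`:
`ψ_j ∈ ℋ₀(ω_j*)` solve the local source problems, `u_j^p = ψ_j|_{ω_j}`, `u^p = ∑_j P_j u_j^p`, and
`uG = u^p + u^s` with the Galerkin correction `u^s` in the coarse space. -/
def IsMSGFEM [NeZero d] (ν : 𝒯.Elem → ℝ) (γ₀ : ℝ) (f : Space d → ℝ) {M : ℕ}
    (ω ωs : Fin M → Set (Space d)) (χ : Fin M → Space d → ℝ) (S : Fin M → Submodule ℝ 𝒯.Vh)
    (uG : 𝒯.Vh) : Prop :=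
  ∃ (ψ : Fin M → 𝒯.Vh) (up us : 𝒯.Vh),
    (∀ j, ψ j ∈ 𝒯.H₀ (ωs j) ∧
      ∀ v ∈ 𝒯.H₀ (ωs j), 𝒯.B ν γ₀ (ωs j) (ψ j) v = 𝒯.load (ωs j) v f) ∧
    up = ∑ j, 𝒯.puOp (χ j) (𝒯.restrict (ω j) (ψ j)) ∧
    us ∈ 𝒯.coarseSpace χ S ∧
    (∀ v ∈ 𝒯.coarseSpace χ S,
      𝒯.B ν γ₀ 𝒯.Ω us v = 𝒯.load 𝒯.Ω v f - 𝒯.B ν γ₀ 𝒯.Ω up v) ∧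
    uG = up + us

end SimplicialMesh

/-- The coloring constant of a family of sets: the least number of colors such that different
members of the same color are disjoint. -/
def coloringConst {d M : ℕ} (ω : Fin M → Set (Space d)) : ℕ :=
  sInf {k : ℕ | ∃ c : Fin M → Fin k, ∀ i j, i ≠ j → c i = c j → Disjoint (ω i) (ω j)}

/-- The eigenvalue of index `n + 1` (counted from `1`) of a finite sequence `λ₁ ≥ ... ≥ λ_K`, and
`0` if there are only `n` of them. -/
def nextEigenvalue {K : ℕ} (lam : Fin K → ℝ≥0∞) (n : ℕ) : ℝ≥0∞ :=
  if h : n < K then lam ⟨n, h⟩ else 0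

end MSGFEM

end

/-! Coercivity. Gradients of functions in `V_h` are constant on elements, so Young's inequality
bounds a consistency integral on a face by a fraction of the penalty plus a multiple of `h_F |F| ν
|∇v|² / γ₀²`. Shape regularity gives `h_F |F| ≤ c |T|` with `c` depending only on `d` and `σ`
(`exists_trace_const`), so for large `γ₀` the second part is absorbed by the volume term
(`B_self_ge`). The harmonic weights make this independent of the contrast of `ν`.

Well-posedness. In finite dimension definiteness suffices. If the `B^+` energy on `Ω` vanishes, the
function is constant on each element, has no jumps and vanishes on boundary faces. It is zero
because a set of elements closed under passing to neighbours has a boundary face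
(`exists_boundaryFace_of_closed`).

Error bound. A test function in `ℋ₀(D)` does not distinguish `B_D` from `B_Ω` (`B_eq_Ω`). Hence `w_j
= u^e - ψ_j` is discretely harmonic on `ω_j*`. It is `B`-orthogonal to `ψ_j`, so its energy norm is
at most `C_B/α_B` times that of `u^e` on `ω_j*` (`normPlus_harmonic_le`). Truncating its
eigenfunction expansion gives `g_j` with `‖P_j(w_j - g_j)‖² ≤ λ_{n_j+1} ‖w_j‖²`
(`exists_eigen_approx`). Since the `P_j` sum to the identity, `u^e - u^p - ∑ P_j g_j = ∑ P_j(w_j -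
g_j)`, and Céa's argument compares the Galerkin error with this sum (`normPlus_error_le_quasiopt`).
The range of `P_j` lies in `ℋ₀(ω_j)`, so summands of equal color are `B^+`-orthogonal, which costs
the factor `κ` (`sum_sq_le_colors`). Finite overlap of the `ω_j*` costs `κ*`
(`sum_Bplus_le_coloringConst_mul`). -/

noncomputable section

namespace MSGFEM

/-! ### Combinatorics of matching simplicial meshes in barycentric coordinates. -/

namespace SimplicialMesh

variable {d : ℕ} (𝒯 : SimplicialMesh d)

/-! ### Barycentric coordinates -/

/-- The barycentric coordinates of an element. -/
def bary (T : 𝒯.Elem) (i : Fin (d + 1)) : Space d →ᵃ[ℝ] ℝ := (𝒯.vertexBasis T).coord i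

/-- The vertices of an element. -/
def vert (T : 𝒯.Elem) (i : Fin (d + 1)) : Space d := (𝒯.simplex T).points i

theorem bary_vert_self (T : 𝒯.Elem) (i : Fin (d + 1)) : 𝒯.bary T i (𝒯.vert T i) = 1 :=
  (𝒯.vertexBasis T).coord_apply_eq i

theorem bary_vert_ne (T : 𝒯.Elem) {i j : Fin (d + 1)} (h : i ≠ j) :
    𝒯.bary T i (𝒯.vert T j) = 0 :=
  (𝒯.vertexBasis T).coord_apply_ne h

theorem sum_bary (T : 𝒯.Elem) (x : Space d) : ∑ i, 𝒯.bary T i x = 1 :=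
  (𝒯.vertexBasis T).sum_coord_apply_eq_one x

theorem sum_bary_smul_vert (T : 𝒯.Elem) (x : Space d) :
    ∑ i, 𝒯.bary T i x • 𝒯.vert T i = x :=
  (𝒯.vertexBasis T).linear_combination_coord_eq_self x

/-- An affine function in terms of its values at the vertices. -/
theorem affine_apply_eq_sum (T : 𝒯.Elem) (a : Space d →ᵃ[ℝ] ℝ) (x : Space d) :
    a x = ∑ k, 𝒯.bary T k x * a (𝒯.vert T k) := by
  have h := Finset.univ.map_affineCombination (𝒯.vert T) (fun k => 𝒯.bary T k x)
    (𝒯.sum_bary T x) a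
  rw [Finset.affineCombination_eq_linear_combination _ _ _ (𝒯.sum_bary T x),
    Finset.affineCombination_eq_linear_combination _ _ _ (𝒯.sum_bary T x),
    𝒯.sum_bary_smul_vert] at h
  simpa using h

theorem continuous_affine (a : Space d →ᵃ[ℝ] ℝ) : Continuous a :=
  a.continuous_of_finiteDimensional

theorem vert_injective (T : 𝒯.Elem) : Function.Injective (𝒯.vert T) :=
  (𝒯.simplex T).independent.injective

theorem mem_elem_iff {T : 𝒯.Elem} {x : Space d} : x ∈ 𝒯.elem T ↔ ∀ i, 0 ≤ 𝒯.bary T i x := by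
  have h := (𝒯.vertexBasis T).convexHull_eq_nonneg_coord
  change x ∈ convexHull ℝ (range (𝒯.vertexBasis T)) ↔ _
  rw [h]; rfl

theorem mem_interior_elem_iff {T : 𝒯.Elem} {x : Space d} :
    x ∈ interior (𝒯.elem T) ↔ ∀ i, 0 < 𝒯.bary T i x := by
  have h := (𝒯.vertexBasis T).interior_convexHull
  change x ∈ interior (convexHull ℝ (range (𝒯.vertexBasis T))) ↔ _
  rw [h]; rfl

theorem isCompact_elem (T : 𝒯.Elem) : IsCompact (𝒯.elem T) :=
  (finite_range _).isCompact_convexHull (𝕜 := ℝ)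

theorem convex_elem (T : 𝒯.Elem) : Convex ℝ (𝒯.elem T) := convex_convexHull _ _

theorem interior_elem_nonempty (T : 𝒯.Elem) : (interior (𝒯.elem T)).Nonempty :=
  ⟨_, (𝒯.vertexBasis T).centroid_mem_interior_convexHull⟩

theorem closure_interior_elem (T : 𝒯.Elem) : closure (interior (𝒯.elem T)) = 𝒯.elem T := by
  rw [(𝒯.convex_elem T).closure_interior_eq_closure_of_nonempty_interior
    (𝒯.interior_elem_nonempty T), (𝒯.isCompact_elem T).isClosed.closure_eq]

theorem vert_mem_elem (T : 𝒯.Elem) (i : Fin (d + 1)) : 𝒯.vert T i ∈ 𝒯.elem T :=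
  subset_convexHull _ _ (mem_range_self i)

theorem elem_subset_closedDomain (T : 𝒯.Elem) : 𝒯.elem T ⊆ 𝒯.closedDomain :=
  subset_iUnion 𝒯.elem T

theorem interior_elem_subset_Ω (T : 𝒯.Elem) : interior (𝒯.elem T) ⊆ 𝒯.Ω :=
  interior_mono (𝒯.elem_subset_closedDomain T)

theorem isOpen_Ω : IsOpen 𝒯.Ω := isOpen_interior

theorem elem_subset_closure_Ω (T : 𝒯.Elem) : 𝒯.elem T ⊆ closure 𝒯.Ω := by
  rw [← 𝒯.closure_interior_elem T]
  exact closure_mono (𝒯.interior_elem_subset_Ω T)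

theorem isCompact_closedDomain : IsCompact 𝒯.closedDomain :=
  isCompact_iUnion fun T => 𝒯.isCompact_elem T

/-- A barycentric coordinate vanishes on the convex hull of the other vertices. -/
theorem bary_eq_zero_of_mem_convexHull {T : 𝒯.Elem} {A : Set (Space d)} {x : Space d}
    (hx : x ∈ convexHull ℝ A) (hA : A ⊆ range (𝒯.vert T)) {i : Fin (d + 1)}
    (hi : 𝒯.vert T i ∉ A) : 𝒯.bary T i x = 0 := by
  have hconv : Convex ℝ {y : Space d | 𝒯.bary T i y = 0} :=
    (convex_singleton (0 : ℝ)).affine_preimage (𝒯.bary T i)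
  refine convexHull_min (fun y hy => ?_) hconv hx
  obtain ⟨j, rfl⟩ := hA hy
  exact 𝒯.bary_vert_ne T (fun h => hi (h ▸ hy))

theorem elem_inter_elem (T T' : 𝒯.Elem) :
    𝒯.elem T ∩ 𝒯.elem T' = convexHull ℝ (range (𝒯.vert T) ∩ range (𝒯.vert T')) :=
  𝒯.matching T T'

/-- A vertex with positive coordinate at a common point of two elements is a common vertex. -/
theorem vert_mem_range_of_bary_pos {T T' : 𝒯.Elem} {x : Space d} (hx : x ∈ 𝒯.elem T)
    (hx' : x ∈ 𝒯.elem T') {i : Fin (d + 1)} (hi : 0 < 𝒯.bary T i x) :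
    𝒯.vert T i ∈ range (𝒯.vert T') := by
  by_contra h
  have hmem : x ∈ convexHull ℝ (range (𝒯.vert T) ∩ range (𝒯.vert T')) := by
    rw [← 𝒯.elem_inter_elem]; exact ⟨hx, hx'⟩
  exact hi.ne' (𝒯.bary_eq_zero_of_mem_convexHull hmem inter_subset_left (fun h' => h h'.2))

theorem eq_of_range_vert_subset {T T' : 𝒯.Elem} (h : range (𝒯.vert T) ⊆ range (𝒯.vert T')) :
    T = T' := by
  apply 𝒯.vertices_injective
  change range (𝒯.vert T) = range (𝒯.vert T')
  refine Set.eq_of_subset_of_ncard_le h ?_ (finite_range _)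
  rw [← image_univ, ← image_univ, Set.ncard_image_of_injective _ (𝒯.vert_injective T),
    Set.ncard_image_of_injective _ (𝒯.vert_injective T')]

/-- All barycentric coordinates are positive at an interior point, so every vertex of `T` is a
vertex of `T'`. This turns the vertex condition of a matching mesh into disjointness of interiors.
-/
theorem eq_of_mem_interior_of_mem {T T' : 𝒯.Elem} {x : Space d} (hx : x ∈ interior (𝒯.elem T))
    (hx' : x ∈ 𝒯.elem T') : T = T' := by
  refine 𝒯.eq_of_range_vert_subset ?_
  rintro _ ⟨i, rfl⟩
  exact 𝒯.vert_mem_range_of_bary_pos (interior_subset hx) hx' (𝒯.mem_interior_elem_iff.1 hx i)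

/-- An open set meeting an element meets its interior. -/
theorem inter_interior_nonempty {T : 𝒯.Elem} {D : Set (Space d)} (hD : IsOpen D)
    (h : (𝒯.elem T ∩ D).Nonempty) : (interior (𝒯.elem T) ∩ D).Nonempty := by
  obtain ⟨x, hx, hxD⟩ := h
  rw [← 𝒯.closure_interior_elem T] at hx
  obtain ⟨y, hy, hy'⟩ := mem_closure_iff.1 hx D hD hxD
  exact ⟨y, hy', hy⟩

/-- An element whose interior meets a union of elements in a nonempty open set is one of them. -/
theorem mem_of_open_subset_iUnion {T : 𝒯.Elem} {S : Set 𝒯.Elem} {x : Space d}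
    (hx : x ∈ interior (𝒯.elem T)) (hS : x ∈ ⋃ T' ∈ S, 𝒯.elem T') : T ∈ S := by
  simp only [mem_iUnion, exists_prop] at hS
  obtain ⟨T', hT', hx'⟩ := hS
  rwa [𝒯.eq_of_mem_interior_of_mem hx hx']

theorem volume_elem_lt_top (T : 𝒯.Elem) (D : Set (Space d)) :
    volume (𝒯.elem T ∩ D) < ∞ :=
  (measure_mono inter_subset_left).trans_lt (𝒯.isCompact_elem T).measure_lt_top

theorem volume_elem_inter_pos {T : 𝒯.Elem} {D : Set (Space d)} (hD : IsOpen D)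
    (h : (𝒯.elem T ∩ D).Nonempty) : 0 < volume.real (𝒯.elem T ∩ D) := by
  refine ENNReal.toReal_pos ?_ (𝒯.volume_elem_lt_top T D).ne
  have h1 := (isOpen_interior.inter hD).measure_pos volume (𝒯.inter_interior_nonempty hD h)
  exact (h1.trans_le (measure_mono (inter_subset_inter_left _ interior_subset))).ne'

theorem volume_interior_elem (T : 𝒯.Elem) :
    volume (interior (𝒯.elem T)) = volume (𝒯.elem T) :=
  measure_congr (interior_ae_eq_of_null_frontier ((𝒯.convex_elem T).addHaar_frontier volume))

/-! ### Facets -/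

variable {𝒯}

theorem sideVertices_eq (s : 𝒯.Side) : sideVertices s = 𝒯.vert s.1 '' {s.2}ᶜ := rfl

theorem sideVertices_subset (s : 𝒯.Side) : sideVertices s ⊆ range (𝒯.vert s.1) :=
  image_subset_range _ _

theorem vert_mem_sideVertices {s : 𝒯.Side} {i : Fin (d + 1)} :
    𝒯.vert s.1 i ∈ sideVertices s ↔ i ≠ s.2 := by
  rw [sideVertices_eq, (𝒯.vert_injective s.1).mem_set_image]; simp

theorem side_subset_elem (s : 𝒯.Side) : side s ⊆ 𝒯.elem s.1 :=
  convexHull_mono (image_subset_range _ _)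

theorem isCompact_side (s : 𝒯.Side) : IsCompact (side s) :=
  ((toFinite _).image _).isCompact_convexHull (𝕜 := ℝ)

theorem bary_eq_zero_of_mem_side {s : 𝒯.Side} {x : Space d} (hx : x ∈ side s) :
    𝒯.bary s.1 s.2 x = 0 :=
  𝒯.bary_eq_zero_of_mem_convexHull hx (sideVertices_subset s)
    (fun h => vert_mem_sideVertices.1 h rfl)

theorem mem_side_iff {s : 𝒯.Side} {x : Space d} :
    x ∈ side s ↔ x ∈ 𝒯.elem s.1 ∧ 𝒯.bary s.1 s.2 x = 0 := by
  refine ⟨fun h => ⟨side_subset_elem s h, bary_eq_zero_of_mem_side h⟩, fun ⟨h, h0⟩ => ?_⟩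
  rw [mem_elem_iff] at h
  rw [← 𝒯.sum_bary_smul_vert s.1 x]
  have hsum : ∑ i ∈ Finset.univ.erase s.2, 𝒯.bary s.1 i x = 1 := by
    rw [← 𝒯.sum_bary s.1 x, ← Finset.add_sum_erase _ _ (Finset.mem_univ s.2), h0, zero_add]
  rw [← Finset.add_sum_erase _ _ (Finset.mem_univ s.2), h0, zero_smul, zero_add]
  refine (convex_convexHull ℝ (sideVertices s)).sum_mem (fun i _ => h i) hsum fun i hi => ?_
  exact subset_convexHull _ _ (vert_mem_sideVertices.2 (Finset.ne_of_mem_erase hi))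

/-- The relative interior of a facet. -/
def relint (s : 𝒯.Side) : Set (Space d) :=
  {x | 𝒯.bary s.1 s.2 x = 0 ∧ ∀ i, i ≠ s.2 → 0 < 𝒯.bary s.1 i x}

theorem relint_subset_side (s : 𝒯.Side) : relint s ⊆ side s := by
  intro x hx
  rw [mem_side_iff, mem_elem_iff]
  refine ⟨fun i => ?_, hx.1⟩
  by_cases h : i = s.2
  · rw [h, hx.1]
  · exact (hx.2 i h).le

/-- Elements containing a relative interior point of a facet contain its vertices. -/
theorem sideVertices_subset_of_mem_relint {s : 𝒯.Side} {T : 𝒯.Elem} {x : Space d}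
    (hx : x ∈ relint s) (hT : x ∈ 𝒯.elem T) : sideVertices s ⊆ range (𝒯.vert T) := by
  rintro _ ⟨i, hi, rfl⟩
  exact 𝒯.vert_mem_range_of_bary_pos (side_subset_elem s (relint_subset_side s hx)) hT (hx.2 i hi)

/-- `d` vertices of an element span one of its facets. -/
theorem exists_side_of_subset {s : 𝒯.Side} {T : 𝒯.Elem}
    (h : sideVertices s ⊆ range (𝒯.vert T)) :
    ∃ i, sideVertices ((T, i) : 𝒯.Side) = sideVertices s := by
  set A : Set (Fin (d + 1)) := 𝒯.vert T ⁻¹' sideVertices s with hA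
  have himg : 𝒯.vert T '' A = sideVertices s := image_preimage_eq_of_subset h
  have hcard : A.ncard = d := by
    rw [← Set.ncard_image_of_injective A (𝒯.vert_injective T), himg, sideVertices_eq,
      Set.ncard_image_of_injective _ (𝒯.vert_injective s.1), Set.ncard_compl]
    simp
  have hc : Aᶜ.ncard = 1 := by
    rw [Set.ncard_compl, hcard]; simp
  obtain ⟨i, hi⟩ := Set.ncard_eq_one.1 hc
  refine ⟨i, ?_⟩
  rw [sideVertices_eq, ← himg, ← hi, compl_compl]

theorem mem_boundaryFaces {s : 𝒯.Side} :
    s ∈ 𝒯.boundaryFaces ↔ ∀ s' : 𝒯.Side, sideVertices s' = sideVertices s → s' = s := by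
  simp [boundaryFaces]

theorem mem_interiorFaces {F : 𝒯.Side × 𝒯.Side} :
    F ∈ 𝒯.interiorFaces ↔ F.1.1 < F.2.1 ∧ sideVertices F.1 = sideVertices F.2 := by
  simp [interiorFaces]

theorem side_eq_of_sideVertices_eq {s s' : 𝒯.Side} (h : sideVertices s = sideVertices s')
    (h1 : s.1 = s'.1) : s = s' := by
  obtain ⟨T, i⟩ := s
  obtain ⟨T', i'⟩ := s'
  obtain rfl : T = T' := h1
  by_contra hne
  have hi : i' ≠ i := fun h => hne (by rw [h])
  have hmem : 𝒯.vert T i' ∈ sideVertices ((T, i) : 𝒯.Side) := vert_mem_sideVertices.2 hi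
  rw [h] at hmem
  exact vert_mem_sideVertices.1 hmem rfl

/-- No other element contains a relative interior point of a boundary face. -/
theorem eq_of_mem_relint_boundary {s : 𝒯.Side} (hs : s ∈ 𝒯.boundaryFaces) {x : Space d}
    (hx : x ∈ relint s) {T : 𝒯.Elem} (hT : x ∈ 𝒯.elem T) : T = s.1 := by
  obtain ⟨i, hi⟩ := exists_side_of_subset (sideVertices_subset_of_mem_relint hx hT)
  rw [← mem_boundaryFaces.1 hs _ hi]

theorem relint_not_mem_interior {s : 𝒯.Side} {x : Space d} (hx : x ∈ relint s) :
    x ∉ interior (𝒯.elem s.1) := fun h =>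
  (𝒯.mem_interior_elem_iff.1 h s.2).ne' hx.1

/-- The relative interior of a boundary face does not meet `Ω`. -/
theorem not_mem_Ω_of_mem_relint_boundary {s : 𝒯.Side} (hs : s ∈ 𝒯.boundaryFaces) {x : Space d}
    (hx : x ∈ relint s) : x ∉ 𝒯.Ω := by
  intro hΩ
  apply relint_not_mem_interior hx
  have hcl : IsClosed (⋃ T ∈ {T : 𝒯.Elem | T ≠ s.1}, 𝒯.elem T) :=
    (toFinite _).isClosed_biUnion fun T _ => (𝒯.isCompact_elem T).isClosed
  -- The other elements form a closed set that misses `x`, so near `x` the domain is covered by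
  -- `s.1` alone.
  have hx' : x ∉ ⋃ T ∈ {T : 𝒯.Elem | T ≠ s.1}, 𝒯.elem T := by
    simp only [mem_iUnion, not_exists]
    intro T hT hxT
    exact hT (eq_of_mem_relint_boundary hs hx hxT)
  rw [mem_interior_iff_mem_nhds]
  filter_upwards [mem_interior_iff_mem_nhds.1 hΩ, hcl.isOpen_compl.mem_nhds hx'] with y hy hy'
  obtain ⟨T, hT⟩ := mem_iUnion.1 hy
  by_cases h : T = s.1
  · rwa [← h]
  · exact absurd (mem_biUnion (show T ∈ {T : 𝒯.Elem | T ≠ s.1} from h) hT) hy'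

theorem relint_boundary_subset_frontier {s : 𝒯.Side} (hs : s ∈ 𝒯.boundaryFaces) :
    relint s ⊆ frontier 𝒯.Ω := by
  intro x hx
  rw [frontier, 𝒯.isOpen_Ω.interior_eq]
  exact ⟨𝒯.elem_subset_closure_Ω s.1 (side_subset_elem s (relint_subset_side s hx)),
    not_mem_Ω_of_mem_relint_boundary hs hx⟩

/-- On the two sides of a shared facet the barycentric coordinates of its vertices agree at its
points. -/
theorem bary_eq_of_bary_eq_zero {s s' : 𝒯.Side} (h : sideVertices s = sideVertices s')
    {x : Space d} (hx : 𝒯.bary s.1 s.2 x = 0) {i j : Fin (d + 1)}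
    (hij : 𝒯.vert s.1 j = 𝒯.vert s'.1 i) : 𝒯.bary s'.1 i x = 𝒯.bary s.1 j x := by
  rw [𝒯.affine_apply_eq_sum s.1 (𝒯.bary s'.1 i), Finset.sum_eq_single j]
  · rw [hij, 𝒯.bary_vert_self, mul_one]
  · intro k _ hk
    by_cases hks : k = s.2
    · rw [hks, hx, zero_mul]
    · have hmem : 𝒯.vert s.1 k ∈ sideVertices s' := h ▸ vert_mem_sideVertices.2 hks
      obtain ⟨l, hl, hl'⟩ := hmem
      change 𝒯.vert s'.1 l = _ at hl'
      rw [← hl', 𝒯.bary_vert_ne, mul_zero]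
      rintro rfl
      exact hk (𝒯.vert_injective s.1 (by rw [hij, hl']))
  · simp

theorem mem_relint_of_sideVertices_eq {s s' : 𝒯.Side} (h : sideVertices s = sideVertices s')
    {x : Space d} (hx : x ∈ relint s) : x ∈ relint s' := by
  refine ⟨bary_eq_zero_of_mem_side ?_, fun i hi => ?_⟩
  · have := relint_subset_side s hx
    rwa [side, h] at this
  · have hmem : 𝒯.vert s'.1 i ∈ sideVertices s := h ▸ vert_mem_sideVertices.2 hi
    obtain ⟨j, hj, hj'⟩ := hmem
    rw [bary_eq_of_bary_eq_zero h hx.1 hj']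
    exact hx.2 j hj

/-- The coordinates of the vertices opposite to a shared facet are proportional. -/
theorem bary_proportional {s s' : 𝒯.Side} (h : sideVertices s = sideVertices s') (x : Space d) :
    𝒯.bary s'.1 s'.2 x = 𝒯.bary s'.1 s'.2 (𝒯.vert s.1 s.2) * 𝒯.bary s.1 s.2 x := by
  rw [𝒯.affine_apply_eq_sum s.1 (𝒯.bary s'.1 s'.2), Finset.sum_eq_single s.2, mul_comm]
  · intro k _ hk
    have hmem : 𝒯.vert s.1 k ∈ sideVertices s' := h ▸ vert_mem_sideVertices.2 hk
    rw [bary_eq_zero_of_mem_side (subset_convexHull _ _ hmem), mul_zero]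
  · simp

/-- The barycentre of the facet is a witness: weight `1/d` on its `d` vertices. -/
theorem relint_nonempty [NeZero d] (s : 𝒯.Side) : (relint s).Nonempty := by
  have hd : (0 : ℝ) < d := by exact_mod_cast NeZero.pos d
  set w : Fin (d + 1) → ℝ := fun i => if i = s.2 then 0 else (d : ℝ)⁻¹ with hw
  have hsum : ∑ i, w i = 1 := by
    rw [← Finset.add_sum_erase _ _ (Finset.mem_univ s.2)]
    rw [Finset.sum_congr rfl (g := fun _ => (d : ℝ)⁻¹)
      (fun i hi => by simp [hw, Finset.ne_of_mem_erase hi])]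
    simp [hw, hd.ne']
  have hco : ∀ i, 𝒯.bary s.1 i (Finset.univ.affineCombination ℝ (𝒯.vertexBasis s.1) w) = w i :=
    fun i => (𝒯.vertexBasis s.1).coord_apply_combination_of_mem (Finset.mem_univ i) hsum
  refine ⟨_, (hco s.2).trans (by simp [hw]), fun i hi => ?_⟩
  rw [hco i]
  simp [hw, hi, NeZero.pos d]

/-- Two different elements with a common facet lie on opposite sides of it. -/
theorem bary_opposite_neg [NeZero d] {s s' : 𝒯.Side} (h : sideVertices s = sideVertices s')
    (hne : s.1 ≠ s'.1) : 𝒯.bary s'.1 s'.2 (𝒯.vert s.1 s.2) < 0 := by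
  -- With a nonnegative proportionality factor, the interior points of the first element near `x`
  -- would also lie in the second one.
  by_contra! hc
  obtain ⟨x, hx⟩ := relint_nonempty s
  have hx' := mem_relint_of_sideVertices_eq h hx
  have hxc : x ∈ closure (interior (𝒯.elem s.1)) := by
    rw [𝒯.closure_interior_elem]; exact side_subset_elem s (relint_subset_side s hx)
  have hop : IsOpen {y : Space d | ∀ i, i ≠ s'.2 → 0 < 𝒯.bary s'.1 i y} := by
    simp only [ofPred_forall]
    exact isOpen_iInter_of_finite fun i => isOpen_iInter_of_finite fun _ =>
      isOpen_lt continuous_const (continuous_affine _)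
  obtain ⟨y, hy, hy'⟩ := mem_closure_iff.1 hxc _ hop hx'.2
  refine hne (𝒯.eq_of_mem_interior_of_mem hy' (𝒯.mem_elem_iff.2 fun i => ?_))
  by_cases hi : i = s'.2
  · rw [hi, bary_proportional h]
    exact mul_nonneg hc (𝒯.mem_interior_elem_iff.1 hy' s.2).le
  · exact (hy i hi).le

/-- A facet is shared with at most one other element. -/
theorem partner_unique [NeZero d] {s s' s'' : 𝒯.Side} (h' : sideVertices s = sideVertices s')
    (h'' : sideVertices s = sideVertices s'') (hne' : s.1 ≠ s'.1) (hne'' : s.1 ≠ s''.1) :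
    s' = s'' := by
  refine side_eq_of_sideVertices_eq (h'.symm.trans h'') ?_
  by_contra hne
  -- Three elements on one facet would lie pairwise on opposite sides of its hyperplane. By
  -- proportionality the quantity in `h3` is a product of the two negative factors in `h1` and `h2`.
  have h1 := bary_opposite_neg h'.symm hne'.symm
  have h2 := bary_opposite_neg h'' hne''
  have h3 := bary_opposite_neg (h'.symm.trans h'') hne
  rw [bary_proportional h''] at h3
  nlinarith

/-- Two elements sharing a facet form a neighbourhood of its relative interior points. -/
theorem union_mem_nhds_of_mem_relint [NeZero d] {s s' : 𝒯.Side}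
    (h : sideVertices s = sideVertices s') (hne : s.1 ≠ s'.1) {x : Space d} (hx : x ∈ relint s) :
    𝒯.elem s.1 ∪ 𝒯.elem s'.1 ∈ 𝓝 x := by
  have hx' := mem_relint_of_sideVertices_eq h hx
  have hop : ∀ t : 𝒯.Side, IsOpen {y : Space d | ∀ i, i ≠ t.2 → 0 < 𝒯.bary t.1 i y} := by
    intro t
    simp only [ofPred_forall]
    exact isOpen_iInter_of_finite fun i => isOpen_iInter_of_finite fun _ =>
      isOpen_lt continuous_const (continuous_affine _)
  -- Only the coordinates of the two opposite vertices can change sign near `x`, and they do so in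
  -- opposite directions, so one of the two elements contains `y`.
  filter_upwards [(hop s).mem_nhds hx.2, (hop s').mem_nhds hx'.2] with y hy hy'
  rcases le_total 0 (𝒯.bary s.1 s.2 y) with h0 | h0
  · left
    refine 𝒯.mem_elem_iff.2 fun i => ?_
    by_cases hi : i = s.2
    · rwa [hi]
    · exact (hy i hi).le
  · right
    refine 𝒯.mem_elem_iff.2 fun i => ?_
    by_cases hi : i = s'.2
    · rw [hi, bary_proportional h]
      exact mul_nonneg_of_nonpos_of_nonpos (bary_opposite_neg h hne).le h0
    · exact (hy' i hi).le

theorem relint_interior_subset_Ω [NeZero d] {F : 𝒯.Side × 𝒯.Side} (hF : F ∈ 𝒯.interiorFaces) :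
    relint F.1 ⊆ 𝒯.Ω := by
  intro x hx
  rw [mem_interiorFaces] at hF
  refine mem_interior_iff_mem_nhds.2 (Filter.mem_of_superset
    (union_mem_nhds_of_mem_relint hF.2 hF.1.ne hx) ?_)
  exact union_subset (𝒯.elem_subset_closedDomain _) (𝒯.elem_subset_closedDomain _)

/-- A facet that is not on the boundary is shared with another element. -/
theorem exists_partner {s : 𝒯.Side} (hs : s ∉ 𝒯.boundaryFaces) :
    ∃ s' : 𝒯.Side, sideVertices s = sideVertices s' ∧ s.1 ≠ s'.1 := by
  simp only [mem_boundaryFaces, not_forall] at hs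
  obtain ⟨s', h, hne⟩ := hs
  exact ⟨s', h.symm, fun h1 => hne (side_eq_of_sideVertices_eq h h1.symm)⟩

/-- Of each facet at most one side is listed first. -/
theorem interiorFaces_injOn_fst [NeZero d] :
    Set.InjOn Prod.fst (𝒯.interiorFaces : Set (𝒯.Side × 𝒯.Side)) := by
  intro F hF G hG h
  rw [Finset.mem_coe, mem_interiorFaces] at hF hG
  refine Prod.ext h ?_
  rw [← h] at hG
  exact partner_unique hF.2 hG.2 hF.1.ne hG.1.ne

theorem interiorFaces_injOn_snd [NeZero d] :
    Set.InjOn Prod.snd (𝒯.interiorFaces : Set (𝒯.Side × 𝒯.Side)) := by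
  intro F hF G hG h
  rw [Finset.mem_coe, mem_interiorFaces] at hF hG
  refine Prod.ext ?_ h
  rw [← h] at hG
  exact partner_unique hF.2.symm hG.2.symm hF.1.ne' hG.1.ne'

end SimplicialMesh

end MSGFEM

end

/-! ### Surface measure of facets, the scaled trace constant, and boundary faces of sets of
elements. -/

noncomputable section

namespace MSGFEM

/-- The zero set of a nonzero affine function is a null set. -/
theorem volume_affine_zero {m : ℕ} (a : Space m →ᵃ[ℝ] ℝ) {p : Space m} (hp : a p ≠ 0) :
    volume {x | a x = 0} = 0 := by
  have h := Measure.addHaar_affineSubspace (volume : Measure (Space m))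
    ((AffineSubspace.mk' (0 : ℝ) ⊥).comap a) ?_
  · convert h using 2
    ext x
    simp
  · intro htop
    have : p ∈ (AffineSubspace.mk' (0 : ℝ) ⊥).comap a := htop ▸ AffineSubspace.mem_top ℝ _ p
    simp at this
    exact hp this

namespace SimplicialMesh

variable {d : ℕ} {𝒯 : SimplicialMesh d}

/-! ### The surface measure of facets -/

/-- The hyperplane of a facet is an isometric image of `ℝ^(d-1)`. -/
theorem exists_isometry_hyperplane [NeZero d] (s : 𝒯.Side) :
    ∃ g : Space (d - 1) →ᵃ[ℝ] Space d, Isometry g ∧ range g = {x | 𝒯.bary s.1 s.2 x = 0} := by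
  set a := 𝒯.bary s.1 s.2 with ha
  obtain ⟨p, hp⟩ := relint_nonempty s
  have hp0 : a p = 0 := hp.1
  have hax : ∀ x, a x = a.linear (x - p) := by
    intro x
    have := a.linearMap_vsub x p
    rw [vsub_eq_sub, vsub_eq_sub, hp0, sub_zero] at this
    exact this.symm
  have hne : a.linear ≠ 0 := by
    intro h
    have h1 := hax (𝒯.vert s.1 s.2)
    rw [h, ha, 𝒯.bary_vert_self] at h1
    simp at h1
  have hrank : Module.finrank ℝ (LinearMap.ker a.linear) = d - 1 := by
    have h1 := LinearMap.finrank_range_add_finrank_ker a.linear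
    rw [LinearMap.range_eq_top.2 (LinearMap.surjective hne), finrank_top] at h1
    simp at h1
    omega
  let ob := (stdOrthonormalBasis ℝ (LinearMap.ker a.linear)).reindex (finCongr hrank)
  let L : Space (d - 1) →ₗᵢ[ℝ] Space d :=
    (LinearMap.ker a.linear).subtypeₗᵢ.comp ob.repr.symm.toLinearIsometry
  refine ⟨L.toLinearMap.toAffineMap + AffineMap.const ℝ _ p, ?_, ?_⟩
  · refine Isometry.of_dist_eq fun x y => ?_
    simp [dist_add_right, L.dist_map]
  · ext x
    constructor
    · rintro ⟨y, rfl⟩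
      change a _ = 0
      rw [hax]
      have : (L y : Space d) ∈ LinearMap.ker a.linear := (ob.repr.symm y).2
      simpa using this
    · intro hx
      have hx' : x - p ∈ LinearMap.ker a.linear := by
        rw [LinearMap.mem_ker, ← hax]; exact hx
      refine ⟨ob.repr ⟨x - p, hx'⟩, ?_⟩
      simp [L]

theorem side_subset_hyperplane (s : 𝒯.Side) : side s ⊆ {x | 𝒯.bary s.1 s.2 x = 0} :=
  fun _ hx => bary_eq_zero_of_mem_side hx

/-- Transports the surface measure on a hyperplane to Lebesgue measure on `ℝ^(d-1)`, where volumes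
of balls, positivity on open sets and nullity of hyperplanes are available. -/
theorem isometry_measure_preimage {m n : ℕ} {g : Space m → Space n} (hg : Isometry g)
    {A : Set (Space n)} (hA : A ⊆ range g) :
    (μHE[m] : Measure (Space n)) A = volume (g ⁻¹' A) := by
  rw [← EuclideanSpace.euclideanHausdorffMeasure_eq_volume, hg.euclideanHausdorffMeasure_preimage,
    inter_eq_self_of_subset_left hA]

theorem diam_side_le (s : 𝒯.Side) : Metric.diam (side s) ≤ Metric.diam (𝒯.elem s.1) :=
  Metric.diam_mono (side_subset_elem s) (𝒯.isCompact_elem s.1).isBounded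

/-- In its hyperplane the facet lies in a ball about one of its points. The radius is `h_T` and not
`h_F`, to match shape regularity. -/
theorem measure_side_le [NeZero d] (s : 𝒯.Side) :
    (μHE[d - 1] : Measure (Space d)) (side s) ≤
      ENNReal.ofReal (Metric.diam (𝒯.elem s.1) ^ (d - 1)) *
        volume (Metric.ball (0 : Space (d - 1)) 1) := by
  obtain ⟨g, hg, hr⟩ := exists_isometry_hyperplane s
  obtain ⟨p, hp⟩ := relint_nonempty s
  have hps := relint_subset_side s hp
  obtain ⟨y, rfl⟩ : p ∈ range g := hr ▸ hp.1
  rw [isometry_measure_preimage hg (hr ▸ side_subset_hyperplane s)]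
  have h1 := Measure.addHaar_closedBall (volume : Measure (Space (d - 1))) y
    (Metric.diam_nonneg (s := 𝒯.elem s.1))
  rw [finrank_euclideanSpace_fin] at h1
  rw [← h1]
  refine measure_mono fun z hz => ?_
  rw [Metric.mem_closedBall, ← hg.dist_eq]
  exact Metric.dist_le_diam_of_mem (𝒯.isCompact_elem s.1).isBounded (side_subset_elem s hz)
    (side_subset_elem s hps)

theorem measure_side_lt_top [NeZero d] (s : 𝒯.Side) (D : Set (Space d)) :
    (μHE[d - 1] : Measure (Space d)) (side s ∩ D) < ∞ :=
  (measure_mono inter_subset_left).trans_lt ((measure_side_le s).trans_lt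
    (ENNReal.mul_lt_top ENNReal.ofReal_lt_top Metric.isBounded_ball.measure_lt_top))

theorem measure_relint_pos [NeZero d] (s : 𝒯.Side) :
    0 < (μHE[d - 1] : Measure (Space d)) (relint s) := by
  obtain ⟨g, hg, hr⟩ := exists_isometry_hyperplane s
  obtain ⟨p, hp⟩ := relint_nonempty s
  obtain ⟨y, rfl⟩ : p ∈ range g := hr ▸ hp.1
  rw [isometry_measure_preimage hg (hr ▸ fun x hx => hx.1)]
  have hset : g ⁻¹' relint s = ⋂ i, ⋂ (_ : i ≠ s.2), {z | 0 < 𝒯.bary s.1 i (g z)} := by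
    ext z
    have : g z ∈ {x | 𝒯.bary s.1 s.2 x = 0} := hr ▸ mem_range_self z
    simp only [relint, mem_preimage, mem_ofPred_eq, mem_iInter]
    exact ⟨fun h => h.2, fun h => ⟨this, h⟩⟩
  refine IsOpen.measure_pos _ ?_ ⟨y, hp⟩
  rw [hset]
  exact isOpen_iInter_of_finite fun i => isOpen_iInter_of_finite fun _ =>
    isOpen_lt continuous_const ((continuous_affine _).comp hg.continuous)

/-- Outside the relative interior a second barycentric coordinate vanishes. It is a nonzero affine
function on the hyperplane of the facet, being `1` at a vertex. -/
theorem measure_side_diff_relint [NeZero d] (s : 𝒯.Side) :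
    (μHE[d - 1] : Measure (Space d)) (side s \ relint s) = 0 := by
  obtain ⟨g, hg, hr⟩ := exists_isometry_hyperplane s
  have hsub : side s \ relint s ⊆
      ⋃ i ∈ {i | i ≠ s.2}, {x | 𝒯.bary s.1 s.2 x = 0 ∧ 𝒯.bary s.1 i x = 0} := by
    rintro x ⟨hx, hx'⟩
    have h0 := bary_eq_zero_of_mem_side hx
    have h1 := 𝒯.mem_elem_iff.1 (side_subset_elem s hx)
    by_contra hcon
    refine hx' ⟨h0, fun i hi => lt_of_le_of_ne (h1 i) fun he => hcon ?_⟩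
    exact mem_biUnion (show i ∈ {i | i ≠ s.2} from hi) ⟨h0, he.symm⟩
  refine measure_mono_null hsub ?_
  refine (measure_biUnion_null_iff (to_countable _)).2 fun i hi => ?_
  rw [isometry_measure_preimage hg (hr ▸ fun x hx => hx.1)]
  have hv : 𝒯.vert s.1 i ∈ range g := hr ▸ 𝒯.bary_vert_ne s.1 (Ne.symm hi)
  obtain ⟨z, hz⟩ := hv
  refine measure_mono_null ?_ (volume_affine_zero ((𝒯.bary s.1 i).comp g) (p := z) ?_)
  · exact fun x hx => hx.2
  · simp [hz, 𝒯.bary_vert_self]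

/-- Almost every point of a facet is in its relative interior. -/
theorem ae_mem_relint [NeZero d] (s : 𝒯.Side) (A : Set (Space d)) :
    ∀ᵐ x ∂((μHE[d - 1] : Measure (Space d))), x ∈ side s ∩ A → x ∈ relint s := by
  refine measure_mono_null (fun x hx => ?_) (measure_side_diff_relint s)
  simp only [mem_compl_iff, mem_ofPred_eq, Classical.not_imp] at hx
  exact ⟨hx.1.1, hx.2⟩

/-- For `d = 1` a facet is a point. A positive diameter keeps `γ₀² / h_F` from collapsing to the
default value `0` of division by zero. -/
theorem diam_side_pos (hd : 2 ≤ d) (s : 𝒯.Side) : 0 < Metric.diam (side s) := by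
  have hex : ∃ i j : Fin (d + 1), i ≠ s.2 ∧ j ≠ s.2 ∧ i ≠ j := by
    have hcard : 1 < (Finset.univ.erase s.2).card := by
      rw [Finset.card_erase_of_mem (Finset.mem_univ _)]; simp; omega
    obtain ⟨i, hi, j, hj, hij⟩ := Finset.one_lt_card.1 hcard
    exact ⟨i, j, Finset.ne_of_mem_erase hi, Finset.ne_of_mem_erase hj, hij⟩
  obtain ⟨i, j, hi, hj, hij⟩ := hex
  have h1 : ∀ k, k ≠ s.2 → 𝒯.vert s.1 k ∈ side s := fun k hk =>
    subset_convexHull _ _ (vert_mem_sideVertices.2 hk)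
  exact (dist_pos.2 fun h => hij (𝒯.vert_injective s.1 h)).trans_le
    (Metric.dist_le_diam_of_mem (isCompact_side s).isBounded (h1 i hi) (h1 j hj))

/-- The scaled trace inequality for the measures of facets and elements. -/
theorem exists_trace_const (d : ℕ) [NeZero d] {σ : ℝ} (hσ : 0 < σ) :
    ∃ c : ℝ, 0 < c ∧ ∀ 𝒯 : SimplicialMesh d, 𝒯.ShapeRegular σ → ∀ s : 𝒯.Side,
      Metric.diam (side s) * (μHE[d - 1] : Measure (Space d)).real (side s) ≤
        c * volume.real (𝒯.elem s.1) := by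
  set b₁ := volume.real (Metric.ball (0 : Space (d - 1)) 1) with hb₁
  set b := volume.real (Metric.ball (0 : Space d) 1) with hb
  have hb₁0 : 0 < b₁ := ENNReal.toReal_pos (Metric.measure_ball_pos _ _ one_pos).ne'
    Metric.isBounded_ball.measure_lt_top.ne
  have hb0 : 0 < b := ENNReal.toReal_pos (Metric.measure_ball_pos _ _ one_pos).ne'
    Metric.isBounded_ball.measure_lt_top.ne
  -- The ratio of the upper bound `h * h^(d-1) * b₁` for `h_F |F|` to the volume `(h/σ)^d * b` of
  -- the inscribed ball; the mesh size cancels.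
  refine ⟨b₁ * σ ^ d / b, by positivity, fun 𝒯 hreg s => ?_⟩
  set h := Metric.diam (𝒯.elem s.1) with hh
  have hh0 : 0 < h := by
    refine Metric.diam_pos ?_ (𝒯.isCompact_elem s.1).isBounded
    have : (0 : Fin (d + 1)) ≠ Fin.last d := by
      have := NeZero.ne d
      simp [Fin.ext_iff]; omega
    exact ⟨_, 𝒯.vert_mem_elem s.1 0, _, 𝒯.vert_mem_elem s.1 (Fin.last d),
      fun he => this (𝒯.vert_injective s.1 he)⟩
  obtain ⟨x, hx⟩ := hreg s.1
  have h1 : (μHE[d - 1] : Measure (Space d)).real (side s) ≤ h ^ (d - 1) * b₁ := by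
    have := ENNReal.toReal_mono (ENNReal.mul_ne_top ENNReal.ofReal_ne_top
      Metric.isBounded_ball.measure_lt_top.ne) (measure_side_le s)
    rwa [ENNReal.toReal_mul, ENNReal.toReal_ofReal (by positivity)] at this
  have h2 : (h / σ) ^ d * b ≤ volume.real (𝒯.elem s.1) := by
    have h3 := Measure.addHaar_ball_of_pos (volume : Measure (Space d)) x (div_pos hh0 hσ)
    have h4 := ENNReal.toReal_mono (𝒯.isCompact_elem s.1).measure_lt_top.ne
      (measure_mono hx : volume _ ≤ volume _)
    rw [h3, ENNReal.toReal_mul, ENNReal.toReal_ofReal (by positivity),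
      finrank_euclideanSpace_fin] at h4
    exact h4
  calc Metric.diam (side s) * (μHE[d - 1] : Measure (Space d)).real (side s)
      ≤ h * (h ^ (d - 1) * b₁) := by gcongr; exact diam_side_le s
    _ = h ^ d * b₁ := by rw [← mul_assoc, mul_pow_sub_one (NeZero.ne d)]
    _ = b₁ * σ ^ d / b * ((h / σ) ^ d * b) := by rw [div_pow]; field_simp
    _ ≤ b₁ * σ ^ d / b * volume.real (𝒯.elem s.1) := by gcongr

/-! ### Every set of elements has a facet on its boundary -/

/-- A nonempty set of elements that contains with an element all its neighbours has a boundary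
face. A generic segment from one of its elements to infinity leaves the union through a
facet. -/
theorem exists_boundaryFace_of_closed [NeZero d] {S : Set 𝒯.Elem} (hS : S.Nonempty)
    (hclosed : ∀ s s' : 𝒯.Side, s.1 ∈ S → sideVertices s = sideVertices s' → s'.1 ∈ S) :
    ∃ s ∈ 𝒯.boundaryFaces, s.1 ∈ S := by
  by_contra! hno
  obtain ⟨T₀, hT₀⟩ := hS
  set U := ⋃ T ∈ S, 𝒯.elem T with hU
  have hUc : IsCompact U := (toFinite S).isCompact_biUnion fun T _ => 𝒯.isCompact_elem T
  -- A starting point off all facet hyperplanes.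
  obtain ⟨p, hp, hpne⟩ : ∃ p ∈ interior (𝒯.elem T₀), ∀ T i, 𝒯.bary T i p ≠ 0 := by
    have hnull : volume (⋃ T, ⋃ i, {x | 𝒯.bary T i x = 0}) = 0 := by
      refine measure_iUnion_null fun T => measure_iUnion_null fun i => ?_
      exact volume_affine_zero _ (p := 𝒯.vert T i) (by simp [𝒯.bary_vert_self])
    have hpos := isOpen_interior.measure_pos volume (𝒯.interior_elem_nonempty T₀)
    by_contra! hcon
    refine hpos.ne' (measure_mono_null (fun x hx => ?_) hnull)
    obtain ⟨T, i, h⟩ := hcon x hx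
    exact mem_iUnion.2 ⟨T, mem_iUnion.2 ⟨i, h⟩⟩
  -- The zero set of `ℓ T i j` is the hyperplane through `p` and the codimension-two flat on which
  -- coordinates `i` and `j` of `T` both vanish. An endpoint `q` off all of these makes the segment
  -- from `p` avoid every such flat.
  let ℓ : 𝒯.Elem → Fin (d + 1) → Fin (d + 1) → Space d →ᵃ[ℝ] ℝ := fun T i j =>
    𝒯.bary T j p • 𝒯.bary T i - 𝒯.bary T i p • 𝒯.bary T j
  have hℓ : ∀ T i j x, ℓ T i j x =
      𝒯.bary T j p * 𝒯.bary T i x - 𝒯.bary T i p * 𝒯.bary T j x := fun T i j x => by simp [ℓ]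
  obtain ⟨q, hqU, hq⟩ : ∃ q ∉ U, ∀ T i j, i ≠ j → ℓ T i j q ≠ 0 := by
    have hnull : volume (⋃ T, ⋃ i, ⋃ j, ⋃ (_ : i ≠ j), {x | ℓ T i j x = 0}) = 0 := by
      refine measure_iUnion_null fun T => measure_iUnion_null fun i => measure_iUnion_null fun j =>
        measure_iUnion_null fun hij => ?_
      refine volume_affine_zero _ (p := 𝒯.vert T i) ?_
      rw [hℓ, 𝒯.bary_vert_self, 𝒯.bary_vert_ne T hij.symm]
      simpa using hpne T j
    have hne : (Uᶜ).Nonempty := by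
      by_contra hemp
      rw [not_nonempty_iff_eq_empty, compl_empty_iff] at hemp
      rw [hemp] at hUc
      exact noncompact_univ (Space d) hUc
    have hpos := hUc.isClosed.isOpen_compl.measure_pos volume hne
    by_contra! hcon
    refine hpos.ne' (measure_mono_null (fun x hx => ?_) hnull)
    obtain ⟨T, i, j, hij, h⟩ := hcon x hx
    exact mem_iUnion.2 ⟨T, mem_iUnion.2 ⟨i, mem_iUnion.2 ⟨j, mem_iUnion.2 ⟨hij, h⟩⟩⟩⟩
  let c : ℝ → Space d := fun t => AffineMap.lineMap p q t
  have hc : Continuous c := AffineMap.lineMap_continuous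
  set A : Set ℝ := Icc 0 1 ∩ c ⁻¹' U with hA
  have hAc : IsCompact A := isCompact_Icc.inter_right (hUc.isClosed.preimage hc)
  have hA0 : (0 : ℝ) ∈ A := by
    refine ⟨by simp, ?_⟩
    simp only [c, mem_preimage, AffineMap.lineMap_apply_zero]
    exact mem_biUnion hT₀ (interior_subset hp)
  obtain ⟨t, ht⟩ := hAc.exists_isGreatest ⟨0, hA0⟩
  have ht1 : t < 1 := by
    refine lt_of_le_of_ne ht.1.1.2 ?_
    rintro rfl
    have := ht.1.2
    simp [c] at this
    exact hqU this
  -- At the last parameter with `c t ∈ U`, the point is interior to an element or to a facet. In the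
  -- latter case the facet is shared, since there is no boundary face in `S`, and the neighbour
  -- belongs to `S`. Either way `U` surrounds the point, contradicting maximality of `t`.
  have hnhds : U ∈ 𝓝 (c t) := by
    obtain ⟨T, hT, hx⟩ := mem_iUnion₂.1 ht.1.2
    by_cases hint : ∀ i, 0 < 𝒯.bary T i (c t)
    · exact Filter.mem_of_superset (mem_interior_iff_mem_nhds.1 (𝒯.mem_interior_elem_iff.2 hint))
        (subset_biUnion_of_mem hT)
    · push Not at hint
      obtain ⟨i, hi⟩ := hint
      have hi0 : 𝒯.bary T i (c t) = 0 := le_antisymm hi (𝒯.mem_elem_iff.1 hx i)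
      have hrel : c t ∈ relint ((T, i) : 𝒯.Side) := by
        refine ⟨hi0, fun j hj => lt_of_le_of_ne (𝒯.mem_elem_iff.1 hx j) fun hj0 => ?_⟩
        have h1 : ℓ T i j (c t) = 0 := by rw [hℓ]; simp [hi0, ← hj0]
        -- `ℓ T i j` vanishes at `p`, hence is linear in the parameter along the segment.
        have h2 : ℓ T i j (c t) = t * ℓ T i j q := by
          simp only [c, AffineMap.apply_lineMap, AffineMap.lineMap_apply_ring']
          have : ℓ T i j p = 0 := by rw [hℓ]; ring
          rw [this]; ring
        rw [h2] at h1
        rcases mul_eq_zero.1 h1 with h3 | h3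
        · refine hpne T i ?_
          rw [h3] at hi0
          simpa [c] using hi0
        · exact hq T i j (Ne.symm hj) h3
      obtain ⟨s', hs', hne⟩ := exists_partner (s := ((T, i) : 𝒯.Side)) fun h => hno _ h hT
      exact Filter.mem_of_superset (union_mem_nhds_of_mem_relint hs' hne hrel)
        (union_subset (subset_biUnion_of_mem hT)
          (subset_biUnion_of_mem (hclosed _ _ hT hs')))
  have hev : ∀ᶠ r in 𝓝[>] t, r ∈ A := by
    have h1 : ∀ᶠ r in 𝓝[>] t, c r ∈ U :=
      (hc.continuousAt.eventually hnhds).filter_mono nhdsWithin_le_nhds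
    filter_upwards [h1, Ioo_mem_nhdsGT ht1] with r hr hr'
    exact ⟨⟨ht.1.1.1.trans hr'.1.le, hr'.2.le⟩, hr⟩
  obtain ⟨r, hr, hr'⟩ := (hev.and self_mem_nhdsWithin).exists
  exact absurd (ht.2 hr) (not_le.2 hr')

end SimplicialMesh

end MSGFEM

end

/-! ### Bilinearity of the forms and domination of the consistency terms by `B^+`. -/

noncomputable section

namespace MSGFEM

namespace SimplicialMesh

variable {d : ℕ} {𝒯 : SimplicialMesh d}

/-! ### Bilinearity of the forms -/

theorem inner_grad (a : Space d →ᵃ[ℝ] ℝ) (x : Space d) : ⟪grad a, x⟫_ℝ = a.linear x := by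
  simp [grad]

theorem grad_add (a b : Space d →ᵃ[ℝ] ℝ) : grad (a + b) = grad a + grad b :=
  ext_inner_right ℝ fun x => by simp [inner_grad, inner_add_left]

theorem grad_smul (c : ℝ) (a : Space d →ᵃ[ℝ] ℝ) : grad (c • a) = c • grad a :=
  ext_inner_right ℝ fun x => by simp [inner_grad, inner_smul_left]

theorem grad_zero : grad (0 : Space d →ᵃ[ℝ] ℝ) = 0 :=
  ext_inner_right ℝ fun x => by simp [inner_grad]

theorem integrableOn_elem {g : Space d → ℝ} (hg : Continuous g) (T : 𝒯.Elem)
    (D : Set (Space d)) : IntegrableOn g (𝒯.elem T ∩ D) :=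
  (hg.continuousOn.integrableOn_compact (𝒯.isCompact_elem T)).mono_set inter_subset_left

theorem integrableOn_side [NeZero d] {g : Space d → ℝ} (hg : Continuous g) (s : 𝒯.Side)
    (D : Set (Space d)) :
    IntegrableOn g (side s ∩ D) (μHE[d - 1] : Measure (Space d)) := by
  obtain ⟨C, hC⟩ := (isCompact_side s).exists_bound_of_continuousOn hg.continuousOn
  have h : IntegrableOn g (side s) (μHE[d - 1] : Measure (Space d)) := by
    refine Measure.integrableOn_of_bounded (M := C) ?_ hg.aestronglyMeasurable ?_
    · simpa using (measure_side_lt_top s univ).ne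
    · exact ae_restrict_of_forall_mem (isCompact_side s).measurableSet hC
  exact h.mono_set inter_subset_left

section Forms

variable [NeZero d]

theorem continuous_jump (v : 𝒯.Vh) (F : 𝒯.Side × 𝒯.Side) : Continuous (𝒯.jump v F) := by
  have h1 := continuous_affine (v F.1.1)
  have h2 := continuous_affine (v F.2.1)
  unfold jump
  fun_prop

theorem jump_add (u v : 𝒯.Vh) (F : 𝒯.Side × 𝒯.Side) (x : Space d) :
    𝒯.jump (u + v) F x = 𝒯.jump u F x + 𝒯.jump v F x := by
  simp [jump, add_smul]; abel

theorem jump_smul (c : ℝ) (v : 𝒯.Vh) (F : 𝒯.Side × 𝒯.Side) (x : Space d) :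
    𝒯.jump (c • v) F x = c • 𝒯.jump v F x := by
  simp [jump, mul_smul]

variable (ν : 𝒯.Elem → ℝ) (γ₀ : ℝ) (D : Set (Space d))

omit [NeZero d] in
theorem wsum_add (u v : 𝒯.Vh) (F : 𝒯.Side × 𝒯.Side) :
    𝒯.wsum ν (u + v) F = 𝒯.wsum ν u F + 𝒯.wsum ν v F := by
  simp only [wsum, Pi.add_apply, grad_add, smul_add]; abel

omit [NeZero d] in
theorem wsum_smul (c : ℝ) (v : 𝒯.Vh) (F : 𝒯.Side × 𝒯.Side) :
    𝒯.wsum ν (c • v) F = c • 𝒯.wsum ν v F := by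
  simp only [wsum, Pi.smul_apply, grad_smul, smul_add, smul_smul]
  congr 2 <;> ring

/-- `volForm` as a bilinear form. -/
def volBilin : LinearMap.BilinForm ℝ 𝒯.Vh :=
  LinearMap.mk₂ ℝ (𝒯.volForm ν D)
    (fun u v w => by
      simp only [volForm, ← Finset.sum_add_distrib, Pi.add_apply, grad_add, inner_add_left, mul_add,
        setIntegral_const, smul_eq_mul])
    (fun c u w => by
      simp only [volForm, smul_eq_mul, Finset.mul_sum, Pi.smul_apply, grad_smul, inner_smul_left,
        setIntegral_const]
      refine Finset.sum_congr rfl fun T _ => ?_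
      simp; ring)
    (fun u v w => by
      simp only [volForm, ← Finset.sum_add_distrib, Pi.add_apply, grad_add, inner_add_right,
        mul_add, setIntegral_const, smul_eq_mul])
    (fun c u w => by
      simp only [volForm, smul_eq_mul, Finset.mul_sum, Pi.smul_apply, grad_smul, inner_smul_right,
        setIntegral_const]
      refine Finset.sum_congr rfl fun T _ => ?_
      ring)

/-- `BcI` as a bilinear form. -/
def BcIBilin : LinearMap.BilinForm ℝ 𝒯.Vh :=
  LinearMap.mk₂ ℝ (𝒯.BcI ν D)
    (fun u v w => by
      simp only [BcI, ← mul_add, ← Finset.sum_add_distrib]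
      congr 1
      refine Finset.sum_congr rfl fun F _ => ?_
      have := continuous_jump w F
      rw [← integral_add]
      · simp only [wsum_add, inner_add_left]
      all_goals exact integrableOn_side (by fun_prop) _ _)
    (fun c u w => by
      simp only [BcI, smul_eq_mul, mul_left_comm c, Finset.mul_sum]
      refine Finset.sum_congr rfl fun F _ => ?_
      simp only [wsum_smul, inner_smul_left, integral_const_mul]
      simp)
    (fun u v w => by
      simp only [BcI, ← mul_add, ← Finset.sum_add_distrib]
      congr 1
      refine Finset.sum_congr rfl fun F _ => ?_
      have := continuous_jump v F
      have := continuous_jump w F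
      rw [← integral_add]
      · simp only [jump_add, inner_add_right]
      all_goals exact integrableOn_side (by fun_prop) _ _)
    (fun c u w => by
      simp only [BcI, smul_eq_mul, mul_left_comm c, Finset.mul_sum]
      refine Finset.sum_congr rfl fun F _ => ?_
      simp only [jump_smul, inner_smul_right, integral_const_mul])

theorem BpI_symm (u v : 𝒯.Vh) : 𝒯.BpI ν γ₀ D u v = 𝒯.BpI ν γ₀ D v u := by
  simp only [BpI, real_inner_comm]

theorem penB_symm (u v : 𝒯.Vh) : 𝒯.penB ν γ₀ D u v = 𝒯.penB ν γ₀ D v u := by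
  simp only [penB, real_inner_comm]

omit [NeZero d] in
theorem volForm_symm (u v : 𝒯.Vh) : 𝒯.volForm ν D u v = 𝒯.volForm ν D v u := by
  simp only [volForm, real_inner_comm]

/-- `BpI` as a bilinear form. -/
def BpIBilin : LinearMap.BilinForm ℝ 𝒯.Vh :=
  have hadd : ∀ u v w : 𝒯.Vh,
      𝒯.BpI ν γ₀ D (u + v) w = 𝒯.BpI ν γ₀ D u w + 𝒯.BpI ν γ₀ D v w := fun u v w => by
    simp only [BpI, ← Finset.sum_add_distrib]
    refine Finset.sum_congr rfl fun F _ => ?_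
    have := continuous_jump u F
    have := continuous_jump v F
    have := continuous_jump w F
    rw [← integral_add]
    · simp only [jump_add, inner_add_left, mul_add]
    all_goals exact integrableOn_side (by fun_prop) _ _
  have hsmul : ∀ (c : ℝ) (u w : 𝒯.Vh),
      𝒯.BpI ν γ₀ D (c • u) w = c • 𝒯.BpI ν γ₀ D u w := fun c u w => by
    simp only [BpI, smul_eq_mul, Finset.mul_sum]
    refine Finset.sum_congr rfl fun F _ => ?_
    simp only [jump_smul, inner_smul_left, mul_left_comm _ c, integral_const_mul, conj_trivial]
  LinearMap.mk₂ ℝ (𝒯.BpI ν γ₀ D) hadd hsmul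
    (fun u v w => by rw [BpI_symm, hadd, BpI_symm _ _ _ v, BpI_symm _ _ _ w])
    (fun c u w => by rw [BpI_symm, hsmul, BpI_symm])

/-- `BcB` as a bilinear form. -/
def BcBBilin : LinearMap.BilinForm ℝ 𝒯.Vh :=
  LinearMap.mk₂ ℝ (𝒯.BcB ν D)
    (fun u v w => by
      simp only [BcB, ← Finset.sum_add_distrib]
      refine Finset.sum_congr rfl fun s _ => ?_
      have := continuous_affine (w s.1)
      rw [← integral_add]
      · simp only [Pi.add_apply, grad_add, smul_add, inner_add_left]
      all_goals exact integrableOn_side (by fun_prop) _ _)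
    (fun c u w => by
      simp only [BcB, smul_eq_mul, Finset.mul_sum]
      refine Finset.sum_congr rfl fun s _ => ?_
      simp only [Pi.smul_apply, grad_smul, smul_comm _ c, inner_smul_left _ _ c, integral_const_mul,
        conj_trivial])
    (fun u v w => by
      simp only [BcB, ← Finset.sum_add_distrib]
      refine Finset.sum_congr rfl fun s _ => ?_
      have := continuous_affine (v s.1)
      have := continuous_affine (w s.1)
      rw [← integral_add]
      · simp only [Pi.add_apply, AffineMap.coe_add, add_smul, inner_add_right]
      all_goals exact integrableOn_side (by fun_prop) _ _)
    (fun c u w => by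
      simp only [BcB, smul_eq_mul, Finset.mul_sum]
      refine Finset.sum_congr rfl fun s _ => ?_
      simp only [Pi.smul_apply, AffineMap.coe_smul, smul_eq_mul, mul_smul,
        inner_smul_right _ _ c, integral_const_mul])

/-- `penB` as a bilinear form. -/
def penBBilin : LinearMap.BilinForm ℝ 𝒯.Vh :=
  have hadd : ∀ u v w : 𝒯.Vh,
      𝒯.penB ν γ₀ D (u + v) w = 𝒯.penB ν γ₀ D u w + 𝒯.penB ν γ₀ D v w := fun u v w => by
    simp only [penB, ← Finset.sum_add_distrib]
    refine Finset.sum_congr rfl fun s _ => ?_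
    have := continuous_affine (u s.1)
    have := continuous_affine (v s.1)
    have := continuous_affine (w s.1)
    rw [← integral_add]
    · simp only [Pi.add_apply, AffineMap.coe_add, add_smul, inner_add_left, mul_add]
    all_goals exact integrableOn_side (by fun_prop) _ _
  have hsmul : ∀ (c : ℝ) (u w : 𝒯.Vh),
      𝒯.penB ν γ₀ D (c • u) w = c • 𝒯.penB ν γ₀ D u w := fun c u w => by
    simp only [penB, smul_eq_mul, Finset.mul_sum]
    refine Finset.sum_congr rfl fun F _ => ?_
    simp only [Pi.smul_apply, AffineMap.coe_smul, smul_eq_mul, mul_smul, inner_smul_left _ _ c,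
      mul_left_comm _ c, integral_const_mul, conj_trivial]
  LinearMap.mk₂ ℝ (𝒯.penB ν γ₀ D) hadd hsmul
    (fun u v w => by rw [penB_symm, hadd, penB_symm _ _ _ v, penB_symm _ _ _ w])
    (fun c u w => by rw [penB_symm, hsmul, penB_symm])

/-- `B_D` as a bilinear form. -/
def bilinB : LinearMap.BilinForm ℝ 𝒯.Vh :=
  volBilin ν D + (BpIBilin ν γ₀ D - BcIBilin ν D - (BcIBilin ν D).flip) +
    ((2 : ℝ) • penBBilin ν γ₀ D - BcBBilin ν D - (BcBBilin ν D).flip)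

theorem bilinB_apply (u v : 𝒯.Vh) : bilinB ν γ₀ D u v = 𝒯.B ν γ₀ D u v := rfl

/-- `B_D^+` as a bilinear form. -/
def bilinBplus : LinearMap.BilinForm ℝ 𝒯.Vh :=
  volBilin ν D + BpIBilin ν γ₀ D + penBBilin ν γ₀ D

theorem B_symm (u v : 𝒯.Vh) : 𝒯.B ν γ₀ D u v = 𝒯.B ν γ₀ D v u := by
  simp only [B, BI, BB, volForm_symm ν D u v, BpI_symm ν γ₀ D u v, penB_symm ν γ₀ D u v]
  ring

theorem Bplus_symm (u v : 𝒯.Vh) : 𝒯.Bplus ν γ₀ D u v = 𝒯.Bplus ν γ₀ D v u := by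
  simp only [Bplus, volForm_symm ν D u v, BpI_symm ν γ₀ D u v, penB_symm ν γ₀ D u v]

/-! ### Signs -/

variable {ν γ₀}

omit [NeZero d] in
theorem penaltyI_nonneg (hν : ∀ T, 0 < ν T) (F : 𝒯.Side × 𝒯.Side) : 0 ≤ 𝒯.penaltyI ν γ₀ F := by
  have := hν F.1.1
  have := hν F.2.1
  have := Metric.diam_nonneg (s := side F.1)
  unfold penaltyI
  positivity

omit [NeZero d] in
theorem penaltyB_nonneg (hν : ∀ T, 0 < ν T) (s : 𝒯.Side) : 0 ≤ 𝒯.penaltyB ν γ₀ s := by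
  have := hν s.1
  have := Metric.diam_nonneg (s := side s)
  unfold penaltyB
  positivity

omit [NeZero d] in
theorem penaltyI_pos (hd : 2 ≤ d) (hν : ∀ T, 0 < ν T) (hγ : 0 < γ₀) (F : 𝒯.Side × 𝒯.Side) :
    0 < 𝒯.penaltyI ν γ₀ F := by
  have := hν F.1.1
  have := hν F.2.1
  have := diam_side_pos hd F.1
  unfold penaltyI
  positivity

omit [NeZero d] in
theorem penaltyB_pos (hd : 2 ≤ d) (hν : ∀ T, 0 < ν T) (hγ : 0 < γ₀) (s : 𝒯.Side) :
    0 < 𝒯.penaltyB ν γ₀ s := by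
  have := hν s.1
  have := diam_side_pos hd s
  unfold penaltyB
  positivity

omit [NeZero d] in
theorem volForm_self (v : 𝒯.Vh) : 𝒯.volForm ν D v v =
    ∑ T, ν T * ‖grad (v T)‖ ^ 2 * volume.real (𝒯.elem T ∩ D) := by
  simp only [volForm, setIntegral_const, smul_eq_mul, real_inner_self_eq_norm_sq]
  exact Finset.sum_congr rfl fun T _ => by ring

omit [NeZero d] in
theorem volForm_nonneg (hν : ∀ T, 0 < ν T) (v : 𝒯.Vh) : 0 ≤ 𝒯.volForm ν D v v := by
  rw [volForm_self]
  exact Finset.sum_nonneg fun T _ => by have := hν T; positivity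

theorem BpI_nonneg (hν : ∀ T, 0 < ν T) (v : 𝒯.Vh) : 0 ≤ 𝒯.BpI ν γ₀ D v v :=
  Finset.sum_nonneg fun F _ => integral_nonneg fun _ =>
    mul_nonneg (penaltyI_nonneg hν F) real_inner_self_nonneg

theorem penB_nonneg (hν : ∀ T, 0 < ν T) (v : 𝒯.Vh) : 0 ≤ 𝒯.penB ν γ₀ D v v :=
  Finset.sum_nonneg fun s _ => integral_nonneg fun _ =>
    mul_nonneg (penaltyB_nonneg hν s) real_inner_self_nonneg

theorem Bplus_nonneg (hν : ∀ T, 0 < ν T) (v : 𝒯.Vh) : 0 ≤ 𝒯.Bplus ν γ₀ D v v :=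
  add_nonneg (add_nonneg (volForm_nonneg D hν v) (BpI_nonneg D hν v)) (penB_nonneg D hν v)

theorem normPlus_sq (hν : ∀ T, 0 < ν T) (v : 𝒯.Vh) :
    𝒯.normPlus ν γ₀ D v ^ 2 = 𝒯.Bplus ν γ₀ D v v :=
  Real.sq_sqrt (Bplus_nonneg D hν v)

theorem normPlus_nonneg (v : 𝒯.Vh) : 0 ≤ 𝒯.normPlus ν γ₀ D v := Real.sqrt_nonneg _

theorem norm_normal (s : 𝒯.Side) : ‖normal s‖ = 1 := by
  have h : (𝒯.simplex s.1).altitudeFoot s.2 - (𝒯.simplex s.1).points s.2 ≠ 0 :=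
    sub_ne_zero.2 ((𝒯.simplex s.1).ne_altitudeFoot s.2).symm
  rw [normal, norm_smul, norm_inv, norm_norm, inv_mul_cancel₀ (norm_ne_zero_iff.2 h)]

/-! ### Bounding the consistency terms -/

/-- The pieces of the facets in `D` and of the boundary faces in `∂D` are controlled by the pieces
of the elements in `D`. -/
def TraceBound (𝒯 : SimplicialMesh d) (D : Set (Space d)) (c : ℝ) : Prop :=
  (∀ s : 𝒯.Side, Metric.diam (side s) * (μHE[d - 1] : Measure (Space d)).real (side s ∩ D) ≤
    c * volume.real (𝒯.elem s.1 ∩ D)) ∧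
  ∀ s ∈ 𝒯.boundaryFaces,
    Metric.diam (side s) * (μHE[d - 1] : Measure (Space d)).real (side s ∩ frontier D) ≤
      c * volume.real (𝒯.elem s.1 ∩ D)

omit [NeZero d] in
theorem sum_side_energy (v : 𝒯.Vh) :
    ∑ s : 𝒯.Side, ν s.1 * ‖grad (v s.1)‖ ^ 2 * volume.real (𝒯.elem s.1 ∩ D) =
      (d + 1) * 𝒯.volForm ν D v v := by
  rw [volForm_self, Fintype.sum_prod_type, Finset.mul_sum]
  refine Finset.sum_congr rfl fun T _ => ?_
  simp

theorem young_inner {E : Type*} [NormedAddCommGroup E] [InnerProductSpace ℝ E] {p : ℝ} (hp : 0 < p)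
    (w j : E) : |⟪w, j⟫_ℝ| ≤ p / 2 * ⟪j, j⟫_ℝ + ‖w‖ ^ 2 / (2 * p) := by
  rw [real_inner_self_eq_norm_sq]
  refine (abs_real_inner_le_norm w j).trans ?_
  have h : 0 ≤ (p * ‖j‖ - ‖w‖) ^ 2 / (2 * p) := by positivity
  have h2 : p / 2 * ‖j‖ ^ 2 + ‖w‖ ^ 2 / (2 * p) - ‖w‖ * ‖j‖ = (p * ‖j‖ - ‖w‖) ^ 2 / (2 * p) := by
    field_simp; ring
  linarith

/-- Young's inequality for a consistency integral on a face. -/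
theorem abs_integral_inner_le (s : 𝒯.Side) (A : Set (Space d)) {p : ℝ} (hp : 0 < p) (w : Space d)
    {j : Space d → Space d} (hj : Continuous j) :
    |∫ x in side s ∩ A, ⟪w, j x⟫_ℝ ∂(μHE[d - 1] : Measure (Space d))| ≤
      1 / 2 * (∫ x in side s ∩ A, p * ⟪j x, j x⟫_ℝ ∂(μHE[d - 1] : Measure (Space d))) +
        ‖w‖ ^ 2 / (2 * p) * (μHE[d - 1] : Measure (Space d)).real (side s ∩ A) := by
  have hi1 : IntegrableOn (fun x => p / 2 * ⟪j x, j x⟫_ℝ) (side s ∩ A)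
      (μHE[d - 1] : Measure (Space d)) := integrableOn_side (by fun_prop) _ _
  have hi2 : IntegrableOn (fun _ => ‖w‖ ^ 2 / (2 * p)) (side s ∩ A)
      (μHE[d - 1] : Measure (Space d)) := integrableOn_side (by fun_prop) _ _
  calc _ ≤ ∫ x in side s ∩ A, |⟪w, j x⟫_ℝ| ∂(μHE[d - 1] : Measure (Space d)) :=
        abs_integral_le_integral_abs
    _ ≤ ∫ x in side s ∩ A, (p / 2 * ⟪j x, j x⟫_ℝ + ‖w‖ ^ 2 / (2 * p))
          ∂(μHE[d - 1] : Measure (Space d)) := by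
        refine integral_mono (integrableOn_side (by fun_prop) _ _) (hi1.add hi2) fun x => ?_
        exact young_inner hp w (j x)
    _ = _ := by
        rw [integral_add hi1 hi2, setIntegral_const, smul_eq_mul, integral_const_mul,
          integral_const_mul]
        ring

/-- On the diagonal the two interior consistency terms of `B_D` coincide and cancel the factor `1/2`
in `BcI`, so Young's inequality can be used with the full penalty and still leaves half of it. -/
theorem two_mul_BcI_le (hd : 2 ≤ d) (hν : ∀ T, 0 < ν T) (hγ : 0 < γ₀) {c : ℝ} (hc : 0 ≤ c)
    (hD : TraceBound 𝒯 D c) (v : 𝒯.Vh) :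
    |2 * 𝒯.BcI ν D v v| ≤
      1 / 2 * 𝒯.BpI ν γ₀ D v v + 4 * c * (d + 1) / γ₀ ^ 2 * 𝒯.volForm ν D v v := by
  set e : 𝒯.Side → ℝ := fun s => ν s.1 * ‖grad (v s.1)‖ ^ 2 * volume.real (𝒯.elem s.1 ∩ D) with he
  have he0 : ∀ s, 0 ≤ e s := fun s => by have := hν s.1; positivity
  have hface : ∀ F ∈ 𝒯.interiorFaces,
      |∫ x in side F.1 ∩ D, ⟪𝒯.wsum ν v F, 𝒯.jump v F x⟫_ℝ ∂(μHE[d - 1] : Measure (Space d))| ≤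
      1 / 2 * (∫ x in side F.1 ∩ D, 𝒯.penaltyI ν γ₀ F * ⟪𝒯.jump v F x, 𝒯.jump v F x⟫_ℝ
        ∂(μHE[d - 1] : Measure (Space d))) + 2 * c / γ₀ ^ 2 * (e F.1 + e F.2) := by
    intro F hF
    refine (abs_integral_inner_le F.1 D (penaltyI_pos hd hν hγ F) _ (continuous_jump v F)).trans ?_
    refine add_le_add le_rfl ?_
    have hside : side F.1 = side F.2 := by rw [side, side, (mem_interiorFaces.1 hF).2]
    have t1 := hD.1 F.1
    have t2 := hD.1 F.2
    rw [← hside] at t2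
    have hh := diam_side_pos hd F.1
    set h := Metric.diam (side F.1)
    set m := (μHE[d - 1] : Measure (Space d)).real (side F.1 ∩ D)
    have hm : 0 ≤ m := measureReal_nonneg
    have n1 := hν F.1.1
    have n2 := hν F.2.1
    simp only [he]
    set a := ν F.1.1 with ha
    set b := ν F.2.1 with hb
    set g1 := grad (v F.1.1) with hg1
    set g2 := grad (v F.2.1) with hg2
    -- The weights turn the flux into `H (g1 + g2)`, and the penalty carries the same factor `H`.
    -- After division one `H` remains, and it is at most twice the coefficient on either side,
    -- whatever the ratio `a / b`.
    set H := 2 * a * b / (a + b) with hH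
    have hH0 : 0 < H := by positivity
    have hHa : H ≤ 2 * a := by
      rw [hH, div_le_iff₀ (by positivity)]; nlinarith
    have hHb : H ≤ 2 * b := by
      rw [hH, div_le_iff₀ (by positivity)]; nlinarith
    have hw : 𝒯.wsum ν v F = H • (g1 + g2) := by
      simp only [wsum, smul_add, smul_smul, ← ha, ← hb, ← hg1, ← hg2, hH]
      congr 2 <;> ring
    have hwn : ‖𝒯.wsum ν v F‖ ^ 2 ≤ H ^ 2 * (2 * (‖g1‖ ^ 2 + ‖g2‖ ^ 2)) := by
      rw [hw, norm_smul, mul_pow, Real.norm_eq_abs, sq_abs]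
      gcongr
      have := norm_add_le g1 g2
      have h0 := norm_nonneg (g1 + g2)
      nlinarith [sq_nonneg (‖g1‖ - ‖g2‖)]
    have hp : 𝒯.penaltyI ν γ₀ F = γ₀ ^ 2 / h * H := rfl
    calc ‖𝒯.wsum ν v F‖ ^ 2 / (2 * 𝒯.penaltyI ν γ₀ F) * m
        ≤ H ^ 2 * (2 * (‖g1‖ ^ 2 + ‖g2‖ ^ 2)) / (2 * (γ₀ ^ 2 / h * H)) * m := by
          rw [hp]; gcongr
      _ = (H * ‖g1‖ ^ 2 * (h * m) + H * ‖g2‖ ^ 2 * (h * m)) / γ₀ ^ 2 := by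
          field_simp
      _ ≤ (2 * a * ‖g1‖ ^ 2 * (c * volume.real (𝒯.elem F.1.1 ∩ D)) +
            2 * b * ‖g2‖ ^ 2 * (c * volume.real (𝒯.elem F.2.1 ∩ D))) / γ₀ ^ 2 := by
          gcongr
      _ = _ := by ring
  have h1 : ∑ F ∈ 𝒯.interiorFaces, e F.1 ≤ ∑ s, e s := by
    classical
    rw [← Finset.sum_image (f := e) interiorFaces_injOn_fst]
    exact Finset.sum_le_sum_of_subset_of_nonneg (Finset.subset_univ _) fun s _ _ => he0 s
  have h2 : ∑ F ∈ 𝒯.interiorFaces, e F.2 ≤ ∑ s, e s := by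
    classical
    rw [← Finset.sum_image (f := e) interiorFaces_injOn_snd]
    exact Finset.sum_le_sum_of_subset_of_nonneg (Finset.subset_univ _) fun s _ _ => he0 s
  have h3 : ∑ s, e s = (d + 1) * 𝒯.volForm ν D v v := sum_side_energy D v
  have h4 : 2 * 𝒯.BcI ν D v v = ∑ F ∈ 𝒯.interiorFaces,
      ∫ x in side F.1 ∩ D, ⟪𝒯.wsum ν v F, 𝒯.jump v F x⟫_ℝ ∂(μHE[d - 1] : Measure (Space d)) := by
    rw [BcI]; ring
  rw [h4]
  refine (Finset.abs_sum_le_sum_abs _ _).trans ((Finset.sum_le_sum hface).trans ?_)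
  rw [Finset.sum_add_distrib, ← Finset.mul_sum, ← Finset.mul_sum, Finset.sum_add_distrib]
  change 1 / 2 * 𝒯.BpI ν γ₀ D v v + _ ≤ _
  -- First and second sides are each estimated by the sum over all sides, where every element occurs
  -- `d + 1` times; this gives `2 * 2 c (d + 1)`.
  calc _ ≤ 1 / 2 * 𝒯.BpI ν γ₀ D v v + 2 * c / γ₀ ^ 2 *
        ((d + 1) * 𝒯.volForm ν D v v + (d + 1) * 𝒯.volForm ν D v v) := by
        rw [h3] at h1 h2; gcongr
    _ = _ := by ring

theorem two_mul_BcB_le (hd : 2 ≤ d) (hν : ∀ T, 0 < ν T) (hγ : 0 < γ₀) {c : ℝ} (hc : 0 ≤ c)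
    (hD : TraceBound 𝒯 D c) (v : 𝒯.Vh) :
    |2 * 𝒯.BcB ν D v v| ≤
      1 / 2 * 𝒯.penB ν γ₀ D v v + 2 * c * (d + 1) / γ₀ ^ 2 * 𝒯.volForm ν D v v := by
  set e : 𝒯.Side → ℝ := fun s => ν s.1 * ‖grad (v s.1)‖ ^ 2 * volume.real (𝒯.elem s.1 ∩ D) with he
  have he0 : ∀ s, 0 ≤ e s := fun s => by have := hν s.1; positivity
  have hface : ∀ s ∈ 𝒯.boundaryFaces,
      |∫ x in side s ∩ frontier D, ⟪ν s.1 • grad (v s.1), v s.1 x • normal s⟫_ℝ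
        ∂(μHE[d - 1] : Measure (Space d))| ≤
      1 / 4 * (∫ x in side s ∩ frontier D, 𝒯.penaltyB ν γ₀ s *
        ⟪v s.1 x • normal s, v s.1 x • normal s⟫_ℝ
        ∂(μHE[d - 1] : Measure (Space d))) + c / γ₀ ^ 2 * e s := by
    intro s hs
    have hcont := continuous_affine (v s.1)
    have hpp := penaltyB_pos hd hν hγ s
    -- Boundary consistency terms lack the factor `1/2`. Young's inequality with half the penalty
    -- leaves a quarter of it for each of the two equal terms.
    refine (abs_integral_inner_le s (frontier D) (half_pos hpp) _
      (show Continuous fun x => v s.1 x • normal s by fun_prop)).trans ?_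
    rw [integral_const_mul, integral_const_mul]
    have t1 := hD.2 s hs
    have hh := diam_side_pos hd s
    set h := Metric.diam (side s)
    set m := (μHE[d - 1] : Measure (Space d)).real (side s ∩ frontier D)
    have hm : 0 ≤ m := measureReal_nonneg
    have n1 := hν s.1
    simp only [he]
    have hp : 𝒯.penaltyB ν γ₀ s = γ₀ ^ 2 / h * ν s.1 := by
      change γ₀ ^ 2 / h * (2 * ν s.1 * ν s.1 / (ν s.1 + ν s.1)) = _
      field_simp; ring
    have hbound : ‖ν s.1 • grad (v s.1)‖ ^ 2 / (2 * (𝒯.penaltyB ν γ₀ s / 2)) * m ≤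
        c / γ₀ ^ 2 * (ν s.1 * ‖grad (v s.1)‖ ^ 2 * volume.real (𝒯.elem s.1 ∩ D)) := by
      rw [hp, norm_smul, mul_pow, Real.norm_eq_abs, sq_abs]
      calc _ = ν s.1 * ‖grad (v s.1)‖ ^ 2 * (h * m) / γ₀ ^ 2 := by field_simp
        _ ≤ ν s.1 * ‖grad (v s.1)‖ ^ 2 * (c * volume.real (𝒯.elem s.1 ∩ D)) / γ₀ ^ 2 := by gcongr
        _ = _ := by ring
    linarith
  have h1 : ∑ s ∈ 𝒯.boundaryFaces, e s ≤ ∑ s, e s :=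
    Finset.sum_le_sum_of_subset_of_nonneg (Finset.subset_univ _) fun s _ _ => he0 s
  have h3 : ∑ s, e s = (d + 1) * 𝒯.volForm ν D v v := sum_side_energy D v
  rw [abs_mul, abs_two]
  have h5 := (Finset.abs_sum_le_sum_abs _ _).trans (Finset.sum_le_sum hface)
  rw [Finset.sum_add_distrib, ← Finset.mul_sum, ← Finset.mul_sum] at h5
  change |𝒯.BcB ν D v v| ≤ 1 / 4 * 𝒯.penB ν γ₀ D v v + _ at h5
  have h6 : c / γ₀ ^ 2 * ∑ s ∈ 𝒯.boundaryFaces, e s ≤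
      c / γ₀ ^ 2 * ((d + 1) * 𝒯.volForm ν D v v) := by
    rw [h3] at h1; gcongr
  calc _ ≤ 2 * (1 / 4 * 𝒯.penB ν γ₀ D v v + c / γ₀ ^ 2 * ((d + 1) * 𝒯.volForm ν D v v)) := by
        linarith
    _ = _ := by ring

/-- The consistency terms are dominated by `B^+`. -/
theorem abs_consistency_le (hd : 2 ≤ d) (hν : ∀ T, 0 < ν T) (hγ : 0 < γ₀) {c : ℝ} (hc : 0 ≤ c)
    (hD : TraceBound 𝒯 D c) (v : 𝒯.Vh) :
    |2 * 𝒯.BcI ν D v v + 2 * 𝒯.BcB ν D v v| ≤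
      1 / 2 * (𝒯.BpI ν γ₀ D v v + 𝒯.penB ν γ₀ D v v) +
        6 * c * (d + 1) / γ₀ ^ 2 * 𝒯.volForm ν D v v := by
  refine (abs_add_le _ _).trans ?_
  have h1 := two_mul_BcI_le D hd hν hγ hc hD v
  have h2 := two_mul_BcB_le D hd hν hγ hc hD v
  calc _ ≤ _ := add_le_add h1 h2
    _ = _ := by ring

/-- The condition on `γ₀` makes the consistency terms cost at most half of the volume term. Half of
the interior penalty and three halves of the boundary penalty survive, since the latter enters `B_D`
twice. -/
theorem B_self_ge (hd : 2 ≤ d) (hν : ∀ T, 0 < ν T) (hγ : 0 < γ₀) {c : ℝ} (hc : 0 ≤ c)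
    (hD : TraceBound 𝒯 D c) (hγc : 12 * c * (d + 1) ≤ γ₀ ^ 2) (v : 𝒯.Vh) :
    1 / 2 * 𝒯.Bplus ν γ₀ D v v ≤ 𝒯.B ν γ₀ D v v := by
  have h := (abs_le.1 (abs_consistency_le D hd hν hγ hc hD v)).2
  have hv := volForm_nonneg D hν v
  have hp := penB_nonneg (γ₀ := γ₀) D hν v
  have h1 : 6 * c * (d + 1) / γ₀ ^ 2 ≤ 1 / 2 := by
    rw [div_le_iff₀ (by positivity)]; linarith
  have h2 := mul_le_mul_of_nonneg_right h1 hv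
  rw [B, BI, BB, Bplus]
  linarith

/-- No largeness of `γ₀` is needed. The bound only serves to show that the continuity constant is an
infimum over a nonempty set. -/
theorem B_self_le (hd : 2 ≤ d) (hν : ∀ T, 0 < ν T) (hγ : 0 < γ₀) {c : ℝ} (hc : 0 ≤ c)
    (hD : TraceBound 𝒯 D c) (v : 𝒯.Vh) :
    𝒯.B ν γ₀ D v v ≤ (3 + 6 * c * (d + 1) / γ₀ ^ 2) * 𝒯.Bplus ν γ₀ D v v := by
  have h := (abs_le.1 (abs_consistency_le D hd hν hγ hc hD v)).1
  have hv := volForm_nonneg D hν v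
  have hp := penB_nonneg (γ₀ := γ₀) D hν v
  have hi := BpI_nonneg (γ₀ := γ₀) D hν v
  have h1 : 0 ≤ 6 * c * (d + 1) / γ₀ ^ 2 := by positivity
  rw [B, BI, BB, Bplus]
  nlinarith [mul_nonneg h1 hp, mul_nonneg h1 hi]

end Forms

end SimplicialMesh

end MSGFEM

end

/-! ### Restriction of the forms to subdomains, finite overlap, and definiteness on `Ω`. -/

noncomputable section

namespace MSGFEM

namespace SimplicialMesh

variable {d : ℕ} {𝒯 : SimplicialMesh d} {D : Set (Space d)}

/-! ### Elements and subdomains -/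

theorem interior_elem_subset_of_mem_innerElems {T : 𝒯.Elem} (h : T ∈ 𝒯.innerElems D) :
    interior (𝒯.elem T) ⊆ D := by
  intro x hx
  by_contra hxD
  have : x ∈ 𝒯.elem T ∩ (𝒯.Ω \ D) := ⟨interior_subset hx, 𝒯.interior_elem_subset_Ω T hx, hxD⟩
  rw [h] at this
  exact this

theorem innerElems_subset_outerElems : 𝒯.innerElems D ⊆ 𝒯.outerElems D := by
  intro T hT
  obtain ⟨x, hx⟩ := 𝒯.interior_elem_nonempty T
  exact ⟨x, interior_subset hx, interior_elem_subset_of_mem_innerElems hT hx⟩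

theorem mem_outerElems_Ω (T : 𝒯.Elem) : T ∈ 𝒯.outerElems 𝒯.Ω := by
  obtain ⟨x, hx⟩ := 𝒯.interior_elem_nonempty T
  exact ⟨x, interior_subset hx, 𝒯.interior_elem_subset_Ω T hx⟩

theorem restrict_of_mem {T : 𝒯.Elem} (hT : T ∈ 𝒯.outerElems D) (v : 𝒯.Vh) :
    𝒯.restrict D v T = v T := if_pos hT

theorem restrict_mem_H (v : 𝒯.Vh) : 𝒯.restrict D v ∈ 𝒯.H D := mem_range_self v

theorem mem_H_iff {v : 𝒯.Vh} : v ∈ 𝒯.H D ↔ ∀ T ∉ 𝒯.outerElems D, v T = 0 := by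
  constructor
  · rintro ⟨w, rfl⟩ T hT
    exact if_neg hT
  · intro h
    refine ⟨v, funext fun T => ?_⟩
    by_cases hT : T ∈ 𝒯.outerElems D
    · exact if_pos hT
    · rw [h T hT]; exact if_neg hT

theorem H₀_subset_H : 𝒯.H₀ D ⊆ 𝒯.H D := fun _ hv =>
  mem_H_iff.2 fun T hT => hv T fun h => hT (innerElems_subset_outerElems h)

theorem exists_outerElem (hD : D ⊆ 𝒯.Ω) (hne : D.Nonempty) : (𝒯.outerElems D).Nonempty := by
  obtain ⟨x, hx⟩ := hne
  obtain ⟨T, hT⟩ := mem_iUnion.1 (interior_subset (hD hx))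
  exact ⟨T, x, hT, hx⟩

/-- An element of `D⁻` avoids `Ω \ D`, so its pieces, facets included, cannot tell `D` from `Ω`. All
transfers between the forms on `D` and on `Ω` rest on this. -/
theorem inter_eq_of_mem_innerElems {T : 𝒯.Elem} (hT : T ∈ 𝒯.innerElems D) (hD : D ⊆ 𝒯.Ω)
    {A : Set (Space d)} (hA : A ⊆ 𝒯.elem T) : A ∩ D = A ∩ 𝒯.Ω := by
  ext x
  refine ⟨fun h => ⟨h.1, hD h.2⟩, fun h => ⟨h.1, ?_⟩⟩
  by_contra hx
  have : x ∈ 𝒯.elem T ∩ (𝒯.Ω \ D) := ⟨hA h.1, h.2, hx⟩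
  rw [hT] at this
  exact this

theorem inter_frontier_eq_of_mem_innerElems {T : 𝒯.Elem} (hT : T ∈ 𝒯.innerElems D)
    (hDo : IsOpen D) (hD : D ⊆ 𝒯.Ω) {A : Set (Space d)} (hA : A ⊆ 𝒯.elem T) :
    A ∩ frontier D = A ∩ frontier 𝒯.Ω := by
  have h := inter_eq_of_mem_innerElems hT hD hA
  rw [frontier, frontier, hDo.interior_eq, 𝒯.isOpen_Ω.interior_eq]
  ext x
  constructor
  · rintro ⟨hxA, hx, hxD⟩
    exact ⟨hxA, closure_mono hD hx, fun hΩ => hxD (h.symm.subset ⟨hxA, hΩ⟩).2⟩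
  · rintro ⟨hxA, -, hxΩ⟩
    refine ⟨hxA, ?_, fun hxD => hxΩ (hD hxD)⟩
    have hx := hA hxA
    rw [← 𝒯.closure_interior_elem T] at hx
    exact closure_mono (interior_elem_subset_of_mem_innerElems hT) hx

variable [NeZero d]

omit [NeZero d] in
theorem regularAtBoundary_Ω : 𝒯.RegularAtBoundary 𝒯.Ω := fun _ _ =>
  Filter.Eventually.of_forall fun _ => self_mem_nhdsWithin

omit [NeZero d] in
theorem RegularAtBoundary.ae (h : 𝒯.RegularAtBoundary D) {s : 𝒯.Side}
    (hs : s ∈ 𝒯.boundaryFaces) : ∀ᵐ x ∂(μHE[d - 1] : Measure (Space d)),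
      x ∈ side s ∩ frontier D → D ∈ 𝓝[𝒯.Ω] x :=
  (ae_restrict_iff' ((isCompact_side s).measurableSet.inter isClosed_frontier.measurableSet)).1
    (h s hs)

omit [NeZero d] in
/-- At a boundary face of an element outside `D`, the boundary of a regular set `D` has no surface
measure. -/
theorem measure_side_inter_frontier_eq_zero (hreg : 𝒯.RegularAtBoundary D) {s : 𝒯.Side}
    (hs : s ∈ 𝒯.boundaryFaces) (hT : s.1 ∉ 𝒯.outerElems D) :
    (μHE[d - 1] : Measure (Space d)) (side s ∩ frontier D) = 0 := by
  refine measure_mono_null (fun x hx => ?_) (hreg.ae hs)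
  simp only [mem_compl_iff, mem_ofPred_eq, Classical.not_imp]
  refine ⟨hx, fun hmem => hT ?_⟩
  -- If `D` filled `Ω` near `x`, it would contain interior points of the element arbitrarily close
  -- to `x`.
  obtain ⟨U, hU, hxU, hsub⟩ := mem_nhdsWithin.1 hmem
  have hxc := side_subset_elem s hx.1
  rw [← 𝒯.closure_interior_elem] at hxc
  obtain ⟨y, hyU, hy⟩ := mem_closure_iff.1 hxc U hU hxU
  exact ⟨y, interior_subset hy, hsub ⟨hyU, 𝒯.interior_elem_subset_Ω _ hy⟩⟩

/-! ### Trace bounds -/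

/-- Shape regularity gives a trace bound on sets that are resolved by the mesh. -/
theorem traceBound_of_meshResolved {c : ℝ} (hc : 0 ≤ c)
    (h : ∀ s : 𝒯.Side, Metric.diam (side s) * (μHE[d - 1] : Measure (Space d)).real (side s) ≤
      c * volume.real (𝒯.elem s.1)) (hD : 𝒯.MeshResolved D) : TraceBound 𝒯 D c := by
  obtain ⟨S, rfl⟩ := hD
  set D := interior (⋃ T ∈ S, 𝒯.elem T) with hDdef
  -- Selected elements lie in `D` up to a null set, so the trace inequality of the whole element
  -- applies; for the other elements both facet pieces are null.
  have hvol : ∀ T ∈ S, volume.real (𝒯.elem T ∩ D) = volume.real (𝒯.elem T) := by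
    intro T hT
    refine le_antisymm (measureReal_mono inter_subset_left (𝒯.isCompact_elem T).measure_lt_top.ne) ?_
    rw [measureReal_def, ← 𝒯.volume_interior_elem]
    exact measureReal_mono (subset_inter interior_subset
      (interior_mono (subset_biUnion_of_mem hT))) (𝒯.volume_elem_lt_top T D).ne
  have hin : ∀ (s : 𝒯.Side) (A : Set (Space d)), s.1 ∈ S →
      Metric.diam (side s) * (μHE[d - 1] : Measure (Space d)).real (side s ∩ A) ≤
        c * volume.real (𝒯.elem s.1 ∩ D) := by
    intro s A hs
    rw [hvol _ hs]
    refine le_trans (mul_le_mul_of_nonneg_left ?_ Metric.diam_nonneg) (h s)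
    exact measureReal_mono inter_subset_left (by simpa using (measure_side_lt_top s univ).ne)
  have hnull : ∀ (s : 𝒯.Side) (A : Set (Space d)),
      (μHE[d - 1] : Measure (Space d)) (side s ∩ A) = 0 →
      Metric.diam (side s) * (μHE[d - 1] : Measure (Space d)).real (side s ∩ A) ≤
        c * volume.real (𝒯.elem s.1 ∩ D) := by
    intro s A hs
    rw [measureReal_def, hs, ENNReal.toReal_zero, mul_zero]
    positivity
  refine ⟨fun s => ?_, fun s hs => ?_⟩
  · rcases (side s ∩ D).eq_empty_or_nonempty with he | hne
    · exact hnull s D (by rw [he, measure_empty])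
    · refine hin s D ?_
      obtain ⟨y, hy, hyD⟩ := 𝒯.inter_interior_nonempty (D := D) isOpen_interior
        (hne.mono (inter_subset_inter_left _ (side_subset_elem s)))
      exact 𝒯.mem_of_open_subset_iUnion hy (interior_subset hyD)
  · by_cases hsS : s.1 ∈ S
    · exact hin s _ hsS
    · have hsub : side s ∩ frontier D ⊆ side s \ relint s := ?_
      · exact hnull s _ (measure_mono_null hsub (measure_side_diff_relint s))
      -- The boundary of `D` lies in the closed union of selected elements, whereas a relative
      -- interior point of a boundary face belongs to `s.1` only.
      refine fun x hx => ⟨hx.1, fun hrel => hsS ?_⟩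
      have hcl : IsClosed (⋃ T ∈ S, 𝒯.elem T) :=
        (toFinite S).isClosed_biUnion fun T _ => (𝒯.isCompact_elem T).isClosed
      have hxU : x ∈ ⋃ T ∈ S, 𝒯.elem T :=
        hcl.closure_subset_iff.2 interior_subset (frontier_subset_closure hx.2)
      obtain ⟨T, hT, hxT⟩ := mem_iUnion₂.1 hxU
      rwa [← eq_of_mem_relint_boundary hs hrel hxT]

omit [NeZero d] in
/-- Open sets that are regular at the boundary have a trace bound. -/
theorem exists_traceBound (hDo : IsOpen D) (hreg : 𝒯.RegularAtBoundary D) :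
    ∃ c, 0 ≤ c ∧ TraceBound 𝒯 D c := by
  have key : ∀ s : 𝒯.Side, ∃ c : ℝ, 0 ≤ c ∧
      Metric.diam (side s) * (μHE[d - 1] : Measure (Space d)).real (side s ∩ D) ≤
        c * volume.real (𝒯.elem s.1 ∩ D) ∧
      (s ∈ 𝒯.boundaryFaces →
        Metric.diam (side s) * (μHE[d - 1] : Measure (Space d)).real (side s ∩ frontier D) ≤
          c * volume.real (𝒯.elem s.1 ∩ D)) := by
    intro s
    by_cases hT : s.1 ∈ 𝒯.outerElems D
    · have hv := 𝒯.volume_elem_inter_pos hDo hT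
      set a := Metric.diam (side s) * (μHE[d - 1] : Measure (Space d)).real (side s ∩ D)
      set b := Metric.diam (side s) * (μHE[d - 1] : Measure (Space d)).real (side s ∩ frontier D)
      have ha : 0 ≤ a := mul_nonneg Metric.diam_nonneg measureReal_nonneg
      have hb : 0 ≤ b := mul_nonneg Metric.diam_nonneg measureReal_nonneg
      -- A crude quotient: the constant need not be uniform in `D`, only finite, and there are
      -- finitely many sides.
      refine ⟨(a + b) / volume.real (𝒯.elem s.1 ∩ D), by positivity, ?_, fun _ => ?_⟩ <;>
        rw [div_mul_cancel₀ _ hv.ne'] <;> linarith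
    · have he : side s ∩ D = ∅ := by
        by_contra hne
        exact hT ((nonempty_iff_ne_empty.2 hne).mono
          (inter_subset_inter_left _ (side_subset_elem s)))
      refine ⟨0, le_rfl, by simp [he], fun hs => ?_⟩
      simp [measureReal_def, measure_side_inter_frontier_eq_zero hreg hs hT]
  choose c hc0 hc1 hc2 using key
  have hle : ∀ s, c s ≤ ∑ s, c s := fun s =>
    Finset.single_le_sum (fun s _ => hc0 s) (Finset.mem_univ s)
  refine ⟨∑ s, c s, Finset.sum_nonneg fun s _ => hc0 s, fun s => (hc1 s).trans ?_,
    fun s hs => (hc2 s hs).trans ?_⟩ <;>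
    exact mul_le_mul_of_nonneg_right (hle s) measureReal_nonneg

/-! ### Locality of the forms -/

section Local

variable {ν : 𝒯.Elem → ℝ} {γ₀ : ℝ}

section Congr

variable {u u' v v' : 𝒯.Vh}

omit [NeZero d] in
theorem volForm_congr (hu : ∀ T ∈ 𝒯.outerElems D, u T = u' T)
    (hv : ∀ T ∈ 𝒯.outerElems D, v T = v' T) : 𝒯.volForm ν D u v = 𝒯.volForm ν D u' v' := by
  refine Finset.sum_congr rfl fun T _ => ?_
  by_cases hT : T ∈ 𝒯.outerElems D
  · rw [hu T hT, hv T hT]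
  · rw [not_nonempty_iff_eq_empty.1 hT]; simp

omit [NeZero d] in
theorem faceSum_congr {g g' : 𝒯.Side × 𝒯.Side → Space d → ℝ}
    (h : ∀ F, F.1.1 ∈ 𝒯.outerElems D → F.2.1 ∈ 𝒯.outerElems D → g F = g' F) :
    ∑ F ∈ 𝒯.interiorFaces, ∫ x in side F.1 ∩ D, g F x ∂(μHE[d - 1] : Measure (Space d)) =
      ∑ F ∈ 𝒯.interiorFaces, ∫ x in side F.1 ∩ D, g' F x ∂(μHE[d - 1] : Measure (Space d)) := by
  refine Finset.sum_congr rfl fun F hF => ?_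
  rcases (side F.1 ∩ D).eq_empty_or_nonempty with he | hne
  · rw [he]; simp
  · have hside : side F.1 = side F.2 := by rw [side, side, (mem_interiorFaces.1 hF).2]
    rw [h F (hne.mono (inter_subset_inter_left _ (side_subset_elem F.1)))]
    rw [hside] at hne
    exact hne.mono (inter_subset_inter_left _ (side_subset_elem F.2))

omit [NeZero d] in
theorem boundarySum_congr (hreg : 𝒯.RegularAtBoundary D) {g g' : 𝒯.Side → Space d → ℝ}
    (h : ∀ s, s.1 ∈ 𝒯.outerElems D → g s = g' s) :
    ∑ s ∈ 𝒯.boundaryFaces, ∫ x in side s ∩ frontier D, g s x ∂(μHE[d - 1] : Measure (Space d)) =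
      ∑ s ∈ 𝒯.boundaryFaces,
        ∫ x in side s ∩ frontier D, g' s x ∂(μHE[d - 1] : Measure (Space d)) := by
  refine Finset.sum_congr rfl fun s hs => ?_
  by_cases hT : s.1 ∈ 𝒯.outerElems D
  · rw [h s hT]
  · have h0 := measure_side_inter_frontier_eq_zero hreg hs hT
    rw [setIntegral_measure_zero _ h0, setIntegral_measure_zero _ h0]

theorem BpI_congr (hu : ∀ T ∈ 𝒯.outerElems D, u T = u' T)
    (hv : ∀ T ∈ 𝒯.outerElems D, v T = v' T) : 𝒯.BpI ν γ₀ D u v = 𝒯.BpI ν γ₀ D u' v' :=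
  faceSum_congr fun F h1 h2 => by
    funext x
    simp only [jump, hu _ h1, hu _ h2, hv _ h1, hv _ h2]

theorem BcI_congr (hu : ∀ T ∈ 𝒯.outerElems D, u T = u' T)
    (hv : ∀ T ∈ 𝒯.outerElems D, v T = v' T) : 𝒯.BcI ν D u v = 𝒯.BcI ν D u' v' :=
  congrArg (1 / 2 * ·) <| faceSum_congr fun F h1 h2 => by
    funext x
    simp only [jump, wsum, hu _ h1, hu _ h2, hv _ h1, hv _ h2]

theorem BcB_congr (hreg : 𝒯.RegularAtBoundary D) (hu : ∀ T ∈ 𝒯.outerElems D, u T = u' T)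
    (hv : ∀ T ∈ 𝒯.outerElems D, v T = v' T) : 𝒯.BcB ν D u v = 𝒯.BcB ν D u' v' :=
  boundarySum_congr hreg fun s hs => by
    funext x
    simp only [hu _ hs, hv _ hs]

theorem penB_congr (hreg : 𝒯.RegularAtBoundary D) (hu : ∀ T ∈ 𝒯.outerElems D, u T = u' T)
    (hv : ∀ T ∈ 𝒯.outerElems D, v T = v' T) : 𝒯.penB ν γ₀ D u v = 𝒯.penB ν γ₀ D u' v' :=
  boundarySum_congr hreg fun s hs => by
    funext x
    simp only [hu _ hs, hv _ hs]

/-- `B_D` only depends on the values on the elements that meet `D`. -/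
theorem B_congr (hreg : 𝒯.RegularAtBoundary D) (hu : ∀ T ∈ 𝒯.outerElems D, u T = u' T)
    (hv : ∀ T ∈ 𝒯.outerElems D, v T = v' T) : 𝒯.B ν γ₀ D u v = 𝒯.B ν γ₀ D u' v' := by
  simp only [B, BI, BB, volForm_congr hu hv, BpI_congr hu hv, BcI_congr hu hv, BcI_congr hv hu,
    penB_congr hreg hu hv, BcB_congr hreg hu hv, BcB_congr hreg hv hu]

theorem Bplus_congr (hreg : 𝒯.RegularAtBoundary D) (hu : ∀ T ∈ 𝒯.outerElems D, u T = u' T)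
    (hv : ∀ T ∈ 𝒯.outerElems D, v T = v' T) : 𝒯.Bplus ν γ₀ D u v = 𝒯.Bplus ν γ₀ D u' v' := by
  simp only [Bplus, volForm_congr hu hv, BpI_congr hu hv, penB_congr hreg hu hv]

end Congr

section Transfer

variable {v : 𝒯.Vh}

omit [NeZero d] in
theorem volForm_eq_Ω (hD : D ⊆ 𝒯.Ω) (hv : v ∈ 𝒯.H₀ D) (u : 𝒯.Vh) :
    𝒯.volForm ν D u v = 𝒯.volForm ν 𝒯.Ω u v := by
  refine Finset.sum_congr rfl fun T _ => ?_
  by_cases hT : T ∈ 𝒯.innerElems D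
  · rw [inter_eq_of_mem_innerElems hT hD Subset.rfl]
  · simp [hv T hT, grad_zero]

omit [NeZero d] in
theorem faceSum_eq_Ω (hD : D ⊆ 𝒯.Ω) {g : 𝒯.Side × 𝒯.Side → Space d → ℝ}
    (h : ∀ F, F.1.1 ∉ 𝒯.innerElems D → F.2.1 ∉ 𝒯.innerElems D → g F = 0) :
    ∑ F ∈ 𝒯.interiorFaces, ∫ x in side F.1 ∩ D, g F x ∂(μHE[d - 1] : Measure (Space d)) =
      ∑ F ∈ 𝒯.interiorFaces, ∫ x in side F.1 ∩ 𝒯.Ω, g F x ∂(μHE[d - 1] : Measure (Space d)) := by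
  refine Finset.sum_congr rfl fun F hF => ?_
  have hside : side F.1 = side F.2 := by rw [side, side, (mem_interiorFaces.1 hF).2]
  by_cases h1 : F.1.1 ∈ 𝒯.innerElems D
  · rw [inter_eq_of_mem_innerElems h1 hD (side_subset_elem F.1)]
  by_cases h2 : F.2.1 ∈ 𝒯.innerElems D
  · rw [hside, inter_eq_of_mem_innerElems h2 hD (side_subset_elem F.2)]
  · simp [h F h1 h2]

omit [NeZero d] in
theorem boundarySum_eq_Ω (hDo : IsOpen D) (hD : D ⊆ 𝒯.Ω) {g : 𝒯.Side → Space d → ℝ}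
    (h : ∀ s, s.1 ∉ 𝒯.innerElems D → g s = 0) :
    ∑ s ∈ 𝒯.boundaryFaces, ∫ x in side s ∩ frontier D, g s x ∂(μHE[d - 1] : Measure (Space d)) =
      ∑ s ∈ 𝒯.boundaryFaces,
        ∫ x in side s ∩ frontier 𝒯.Ω, g s x ∂(μHE[d - 1] : Measure (Space d)) := by
  refine Finset.sum_congr rfl fun s hs => ?_
  by_cases hT : s.1 ∈ 𝒯.innerElems D
  · rw [inter_frontier_eq_of_mem_innerElems hT hDo hD (side_subset_elem s)]
  · simp [h s hT]

theorem BpI_eq_Ω (hD : D ⊆ 𝒯.Ω) (hv : v ∈ 𝒯.H₀ D) (u : 𝒯.Vh) :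
    𝒯.BpI ν γ₀ D u v = 𝒯.BpI ν γ₀ 𝒯.Ω u v :=
  faceSum_eq_Ω hD fun F h1 h2 => by
    funext x
    simp [jump, hv _ h1, hv _ h2]

theorem BcI_eq_Ω (hD : D ⊆ 𝒯.Ω) (hv : v ∈ 𝒯.H₀ D) (u : 𝒯.Vh) :
    𝒯.BcI ν D u v = 𝒯.BcI ν 𝒯.Ω u v :=
  congrArg (1 / 2 * ·) <| faceSum_eq_Ω hD fun F h1 h2 => by
    funext x
    simp [jump, hv _ h1, hv _ h2]

theorem BcI_flip_eq_Ω (hD : D ⊆ 𝒯.Ω) (hv : v ∈ 𝒯.H₀ D) (u : 𝒯.Vh) :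
    𝒯.BcI ν D v u = 𝒯.BcI ν 𝒯.Ω v u :=
  congrArg (1 / 2 * ·) <| faceSum_eq_Ω hD fun F h1 h2 => by
    funext x
    simp [wsum, hv _ h1, hv _ h2, grad_zero]

theorem BcB_eq_Ω (hDo : IsOpen D) (hD : D ⊆ 𝒯.Ω) (hv : v ∈ 𝒯.H₀ D) (u : 𝒯.Vh) :
    𝒯.BcB ν D u v = 𝒯.BcB ν 𝒯.Ω u v :=
  boundarySum_eq_Ω hDo hD fun s hs => by
    funext x
    simp [hv _ hs]

theorem BcB_flip_eq_Ω (hDo : IsOpen D) (hD : D ⊆ 𝒯.Ω) (hv : v ∈ 𝒯.H₀ D) (u : 𝒯.Vh) :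
    𝒯.BcB ν D v u = 𝒯.BcB ν 𝒯.Ω v u :=
  boundarySum_eq_Ω hDo hD fun s hs => by
    funext x
    simp [hv _ hs, grad_zero]

theorem penB_eq_Ω (hDo : IsOpen D) (hD : D ⊆ 𝒯.Ω) (hv : v ∈ 𝒯.H₀ D) (u : 𝒯.Vh) :
    𝒯.penB ν γ₀ D u v = 𝒯.penB ν γ₀ 𝒯.Ω u v :=
  boundarySum_eq_Ω hDo hD fun s hs => by
    funext x
    simp [hv _ hs]

/-- Tested with functions in `ℋ₀(D)`, the forms on `D` and on `Ω` agree. -/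
theorem B_eq_Ω (hDo : IsOpen D) (hD : D ⊆ 𝒯.Ω) (hv : v ∈ 𝒯.H₀ D) (u : 𝒯.Vh) :
    𝒯.B ν γ₀ D u v = 𝒯.B ν γ₀ 𝒯.Ω u v := by
  simp only [B, BI, BB, volForm_eq_Ω hD hv, BpI_eq_Ω hD hv, BcI_eq_Ω hD hv, BcI_flip_eq_Ω hD hv,
    penB_eq_Ω hDo hD hv, BcB_eq_Ω hDo hD hv, BcB_flip_eq_Ω hDo hD hv]

theorem Bplus_eq_Ω (hDo : IsOpen D) (hD : D ⊆ 𝒯.Ω) (hv : v ∈ 𝒯.H₀ D) (u : 𝒯.Vh) :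
    𝒯.Bplus ν γ₀ D u v = 𝒯.Bplus ν γ₀ 𝒯.Ω u v := by
  simp only [Bplus, volForm_eq_Ω hD hv, BpI_eq_Ω hD hv, penB_eq_Ω hDo hD hv]

omit [NeZero d] in
theorem load_eq_Ω (hD : D ⊆ 𝒯.Ω) (hv : v ∈ 𝒯.H₀ D) (f : Space d → ℝ) :
    𝒯.load D v f = 𝒯.load 𝒯.Ω v f := by
  refine Finset.sum_congr rfl fun T _ => ?_
  by_cases hT : T ∈ 𝒯.innerElems D
  · rw [inter_eq_of_mem_innerElems hT hD Subset.rfl]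
  · simp [hv T hT]

omit [NeZero d] in
theorem not_mem_innerElems_of_disjoint {D' : Set (Space d)} (hDD : Disjoint D D') {T : 𝒯.Elem}
    (hT : T ∈ 𝒯.innerElems D) : T ∉ 𝒯.innerElems D' := by
  intro hT'
  obtain ⟨x, hx⟩ := 𝒯.interior_elem_nonempty T
  exact disjoint_left.1 hDD (interior_elem_subset_of_mem_innerElems hT hx)
    (interior_elem_subset_of_mem_innerElems hT' hx)

/-- Functions in `ℋ₀` of disjoint sets are orthogonal. -/
theorem Bplus_eq_zero_of_disjoint {D' : Set (Space d)} (hD : D ⊆ 𝒯.Ω)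
    (hD' : D' ⊆ 𝒯.Ω) (hDD : Disjoint D D') {u : 𝒯.Vh} (hu : u ∈ 𝒯.H₀ D) (hv : v ∈ 𝒯.H₀ D') :
    𝒯.Bplus ν γ₀ 𝒯.Ω u v = 0 := by
  have hT : ∀ T, u T = 0 ∨ v T = 0 := by
    intro T
    by_cases h : T ∈ 𝒯.innerElems D
    · exact Or.inr (hv T (not_mem_innerElems_of_disjoint hDD h))
    · exact Or.inl (hu T h)
  have h1 : 𝒯.volForm ν 𝒯.Ω u v = 0 := by
    refine Finset.sum_eq_zero fun T _ => ?_
    rcases hT T with h | h <;> simp [h, grad_zero]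
  have h3 : 𝒯.penB ν γ₀ 𝒯.Ω u v = 0 := by
    refine Finset.sum_eq_zero fun s _ => ?_
    rcases hT s.1 with h | h <;> simp [h]
  have h2 : 𝒯.BpI ν γ₀ 𝒯.Ω u v = 0 := by
    -- The supports may be adjacent, so `u` and `v` could interact across a shared facet. The part
    -- in `Ω` of a facet of an element in `D⁻` lies in `D`, and so it misses `D'`.
    rw [← BpI_eq_Ω hD' hv, BpI_symm]
    refine Finset.sum_eq_zero fun F hF => ?_
    have hside : side F.1 = side F.2 := by rw [side, side, (mem_interiorFaces.1 hF).2]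
    have hempty : ∀ s : 𝒯.Side, s.1 ∈ 𝒯.innerElems D → side s ∩ D' = ∅ := by
      intro s hs
      rw [eq_empty_iff_forall_notMem]
      rintro x ⟨hx, hxD'⟩
      have := inter_eq_of_mem_innerElems hs hD (side_subset_elem s)
      exact disjoint_left.1 hDD (this.symm.subset ⟨hx, hD' hxD'⟩).2 hxD'
    by_cases h1 : F.1.1 ∈ 𝒯.innerElems D
    · rw [hempty _ h1]; simp
    by_cases h2 : F.2.1 ∈ 𝒯.innerElems D
    · rw [hside, hempty _ h2]; simp
    · simp [jump, hu _ h1, hu _ h2]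
  rw [Bplus, h1, h2, h3]; simp

end Transfer

end Local

/-! ### Finite overlap -/

-- Almost everywhere the indicators of the `E i` sum to at most `k` times the indicator of `A`;
-- integrate this against `g`.
omit [NeZero d] in
theorem sum_setIntegral_le_mul {ι : Type*} [Fintype ι] {m : Measure (Space d)} {k : ℕ}
    {g : Space d → ℝ} (hg : ∀ x, 0 ≤ g x) {A : Set (Space d)} (hA : MeasurableSet A)
    (hgA : IntegrableOn g A m) {E : ι → Set (Space d)} (hE : ∀ i, MeasurableSet (E i))
    (hgE : ∀ i, IntegrableOn g (E i) m) (hsub : ∀ᵐ x ∂m, ∀ i, x ∈ E i → x ∈ A)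
    (hcount : ∀ᵐ x ∂m, ∀ J : Finset ι, (∀ i ∈ J, x ∈ E i) → J.card ≤ k) :
    ∑ i, ∫ x in E i, g x ∂m ≤ k * ∫ x in A, g x ∂m := by
  classical
  have h1 : ∀ i, ∫ x in E i, g x ∂m = ∫ x, (E i).indicator g x ∂m := fun i =>
    (integral_indicator (hE i)).symm
  simp only [h1, ← integral_indicator hA]
  rw [← integral_finsetSum _ fun i _ => (integrable_indicator_iff (hE i)).2 (hgE i),
    ← integral_const_mul]
  refine integral_mono_ae (integrable_finsetSum _ fun i _ =>
    (integrable_indicator_iff (hE i)).2 (hgE i))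
    (((integrable_indicator_iff hA).2 hgA).const_mul _) ?_
  filter_upwards [hsub, hcount] with x hx hx'
  simp only [indicator_apply, ← Finset.sum_filter, Finset.sum_const, nsmul_eq_mul]
  set J := Finset.univ.filter fun i => x ∈ E i with hJ
  have hcard := hx' J fun i hi => (Finset.mem_filter.1 hi).2
  by_cases hxA : x ∈ A
  · rw [if_pos hxA]
    exact mul_le_mul_of_nonneg_right (by exact_mod_cast hcard) (hg x)
  · have : J = ∅ := by
      rw [Finset.eq_empty_iff_forall_notMem]
      intro i hi
      exact hxA (hx i (Finset.mem_filter.1 hi).2)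
    rw [if_neg hxA, this]; simp

end SimplicialMesh

theorem coloringConst_spec {d M : ℕ} (ω : Fin M → Set (Space d)) :
    ∃ c : Fin M → Fin (coloringConst ω), ∀ i j, i ≠ j → c i = c j → Disjoint (ω i) (ω j) :=
  Nat.sInf_mem (s := {k : ℕ | ∃ c : Fin M → Fin k, ∀ i j, i ≠ j → c i = c j →
    Disjoint (ω i) (ω j)}) ⟨M, id, fun _ _ hij h => absurd h hij⟩

/-- At most `coloringConst` members of a family intersect pairwise. -/
theorem card_le_coloringConst {d M : ℕ} {ω : Fin M → Set (Space d)} {J : Finset (Fin M)}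
    (hJ : ∀ i ∈ J, ∀ j ∈ J, (ω i ∩ ω j).Nonempty) : J.card ≤ coloringConst ω := by
  obtain ⟨c, hc⟩ := coloringConst_spec ω
  have hinj : Set.InjOn c J := by
    intro i hi j hj h
    by_contra hij
    exact not_disjoint_iff_nonempty_inter.2 (hJ i hi j hj) (hc i j hij h)
  simpa using Finset.card_le_card_of_injOn c (fun _ _ => Finset.mem_coe.2 (Finset.mem_univ _)) hinj

namespace SimplicialMesh

variable {d : ℕ} {𝒯 : SimplicialMesh d} [NeZero d] {ν : 𝒯.Elem → ℝ} {γ₀ : ℝ}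

/-- The local energies sum up to at most the coloring constant times the global energy. -/
theorem sum_Bplus_le_coloringConst_mul {M : ℕ} {ωs : Fin M → Set (Space d)}
    (hν : ∀ T, 0 < ν T) (hopen : ∀ j, IsOpen (ωs j)) (hsub : ∀ j, ωs j ⊆ 𝒯.Ω)
    (hreg : ∀ j, 𝒯.RegularAtBoundary (ωs j)) (v : 𝒯.Vh) :
    ∑ j, 𝒯.Bplus ν γ₀ (ωs j) v v ≤ coloringConst ωs * 𝒯.Bplus ν γ₀ 𝒯.Ω v v := by
  have hcount : ∀ (A x), ∀ J : Finset (Fin M), (∀ i ∈ J, x ∈ A ∩ ωs i) →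
      J.card ≤ coloringConst ωs := fun A x J hJ =>
    card_le_coloringConst fun i hi j hj => ⟨x, (hJ i hi).2, (hJ j hj).2⟩
  have h1 : ∑ j, 𝒯.volForm ν (ωs j) v v ≤ coloringConst ωs * 𝒯.volForm ν 𝒯.Ω v v := by
    simp only [volForm]
    rw [Finset.sum_comm, Finset.mul_sum]
    refine Finset.sum_le_sum fun T _ => ?_
    refine sum_setIntegral_le_mul (fun x => mul_nonneg (hν T).le real_inner_self_nonneg)
      ((𝒯.isCompact_elem T).measurableSet.inter 𝒯.isOpen_Ω.measurableSet)
      (integrableOn_elem continuous_const _ _)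
      (fun i => (𝒯.isCompact_elem T).measurableSet.inter (hopen i).measurableSet)
      (fun i => integrableOn_elem continuous_const _ _)
      (.of_forall fun x i hx => ⟨hx.1, hsub i hx.2⟩) (.of_forall fun x => hcount _ x)
  have h2 : ∑ j, 𝒯.BpI ν γ₀ (ωs j) v v ≤ coloringConst ωs * 𝒯.BpI ν γ₀ 𝒯.Ω v v := by
    simp only [BpI]
    rw [Finset.sum_comm, Finset.mul_sum]
    refine Finset.sum_le_sum fun F _ => ?_
    have hj := continuous_jump v F
    refine sum_setIntegral_le_mul
      (fun x => mul_nonneg (penaltyI_nonneg hν F) real_inner_self_nonneg)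
      ((isCompact_side F.1).measurableSet.inter 𝒯.isOpen_Ω.measurableSet)
      (integrableOn_side (by fun_prop) _ _)
      (fun i => (isCompact_side F.1).measurableSet.inter (hopen i).measurableSet)
      (fun i => integrableOn_side (by fun_prop) _ _)
      (.of_forall fun x i hx => ⟨hx.1, hsub i hx.2⟩) (.of_forall fun x => hcount _ x)
  have h3 : ∑ j, 𝒯.penB ν γ₀ (ωs j) v v ≤ coloringConst ωs * 𝒯.penB ν γ₀ 𝒯.Ω v v := by
    simp only [penB]
    rw [Finset.sum_comm, Finset.mul_sum]
    refine Finset.sum_le_sum fun s hs => ?_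
    have hj := continuous_affine (v s.1)
    refine sum_setIntegral_le_mul
      (fun x => mul_nonneg (penaltyB_nonneg hν s) real_inner_self_nonneg)
      ((isCompact_side s).measurableSet.inter isClosed_frontier.measurableSet)
      (integrableOn_side (by fun_prop) _ _)
      (fun i => (isCompact_side s).measurableSet.inter isClosed_frontier.measurableSet)
      (fun i => integrableOn_side (by fun_prop) _ _) ?_ ?_
    · filter_upwards [ae_mem_relint s univ] with x hx i hxi
      exact ⟨hxi.1, relint_boundary_subset_frontier hs (hx ⟨hxi.1, mem_univ x⟩)⟩
    · have hae := ae_all_iff.2 fun i => (hreg i).ae hs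
      filter_upwards [hae] with x hx J hJ
      refine card_le_coloringConst fun i hi j hj => ?_
      have hmem := Filter.inter_mem (hx i (hJ i hi)) (hx j (hJ j hj))
      have hxc : x ∈ closure 𝒯.Ω := 𝒯.elem_subset_closure_Ω s.1 (side_subset_elem s (hJ i hi).1)
      have := mem_closure_iff_nhdsWithin_neBot.1 hxc
      exact Filter.nonempty_of_mem hmem
  simp only [Bplus, Finset.sum_add_distrib]
  linarith

/-! ### Definiteness -/

omit [NeZero d] in
theorem eq_const_of_grad_eq_zero {a : Space d →ᵃ[ℝ] ℝ} (h : grad a = 0) (x y : Space d) :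
    a x = a y := by
  have h1 := inner_grad a (x - y)
  rw [h, inner_zero_left] at h1
  have h2 := a.linearMap_vsub x y
  rw [vsub_eq_sub, ← h1, vsub_eq_sub] at h2
  linarith

/-- The energy norm on `Ω` is definite. -/
theorem eq_zero_of_Bplus_eq_zero (hd : 2 ≤ d) (hν : ∀ T, 0 < ν T) (hγ : 0 < γ₀) {v : 𝒯.Vh}
    (h : 𝒯.Bplus ν γ₀ 𝒯.Ω v v = 0) : v = 0 := by
  have hv := volForm_nonneg 𝒯.Ω hν v
  have hi := BpI_nonneg (γ₀ := γ₀) 𝒯.Ω hν v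
  have hp := penB_nonneg (γ₀ := γ₀) 𝒯.Ω hν v
  rw [Bplus] at h
  have hv0 : 𝒯.volForm ν 𝒯.Ω v v = 0 := by linarith
  have hi0 : 𝒯.BpI ν γ₀ 𝒯.Ω v v = 0 := by linarith
  have hp0 : 𝒯.penB ν γ₀ 𝒯.Ω v v = 0 := by linarith
  have hgrad : ∀ T, grad (v T) = 0 := by
    intro T
    rw [volForm_self, Finset.sum_eq_zero_iff_of_nonneg
      fun T _ => by have := hν T; positivity] at hv0
    have h1 := hv0 T (Finset.mem_univ T)
    have h2 := 𝒯.volume_elem_inter_pos 𝒯.isOpen_Ω (mem_outerElems_Ω T)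
    have h3 := hν T
    simpa [h2.ne', h3.ne'] using h1
  have hconst : ∀ T x, v T x = v T 0 := fun T x => eq_const_of_grad_eq_zero (hgrad T) x 0
  have hmeas : ∀ (s : 𝒯.Side) {A : Set (Space d)}, relint s ⊆ A →
      (μHE[d - 1] : Measure (Space d)).real (side s ∩ A) ≠ 0 := by
    intro s A hA
    refine (ENNReal.toReal_pos ?_ (measure_side_lt_top s A).ne).ne'
    exact ((measure_relint_pos s).trans_le
      (measure_mono (subset_inter (relint_subset_side s) hA))).ne'
  have hbdry : ∀ s ∈ 𝒯.boundaryFaces, v s.1 0 = 0 := by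
    intro s hs
    rw [penB, Finset.sum_eq_zero_iff_of_nonneg fun s _ => integral_nonneg fun _ =>
      mul_nonneg (penaltyB_nonneg hν s) real_inner_self_nonneg] at hp0
    have h1 := hp0 s hs
    simp only [hconst s.1] at h1
    rw [setIntegral_const, smul_eq_mul, real_inner_self_eq_norm_sq, norm_smul, norm_normal] at h1
    simpa [hmeas s (relint_boundary_subset_frontier hs), (penaltyB_pos hd hν hγ s).ne'] using h1
  -- Only the length of the normals is used, so just the absolute values are compared. This
  -- suffices, since the value at the boundary is zero.
  have hface : ∀ F ∈ 𝒯.interiorFaces, |v F.1.1 0| = |v F.2.1 0| := by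
    intro F hF
    rw [BpI, Finset.sum_eq_zero_iff_of_nonneg fun F _ => integral_nonneg fun _ =>
      mul_nonneg (penaltyI_nonneg hν F) real_inner_self_nonneg] at hi0
    have h1 := hi0 F hF
    simp only [jump, hconst F.1.1, hconst F.2.1] at h1
    rw [setIntegral_const, smul_eq_mul, real_inner_self_eq_norm_sq] at h1
    have h2 : v F.1.1 0 • normal F.1 + v F.2.1 0 • normal F.2 = 0 := by
      simpa [hmeas F.1 (relint_interior_subset_Ω hF), (penaltyI_pos hd hν hγ F).ne'] using h1
    have h3 := congrArg norm (eq_neg_of_add_eq_zero_left h2)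
    rwa [norm_neg, norm_smul, norm_smul, norm_normal, norm_normal, mul_one, mul_one,
      Real.norm_eq_abs, Real.norm_eq_abs] at h3
  have hzero : ∀ T, v T 0 = 0 := by
    intro T
    by_contra hT
    -- The elements with the same absolute value as `T` are closed under passing to neighbours and
    -- therefore reach the boundary.
    obtain ⟨s, hs, hsS⟩ := exists_boundaryFace_of_closed
      (S := {T' : 𝒯.Elem | |v T' 0| = |v T 0|}) ⟨T, rfl⟩ (by
        intro s s' hs hss'
        change |v s'.1 0| = |v T 0|
        rw [← show |v s.1 0| = |v T 0| from hs]
        rcases lt_trichotomy s.1 s'.1 with hlt | heq | hgt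
        · exact (hface (s, s') (mem_interiorFaces.2 ⟨hlt, hss'⟩)).symm
        · rw [heq]
        · exact hface (s', s) (mem_interiorFaces.2 ⟨hgt, hss'.symm⟩))
    have : |v s.1 0| = |v T 0| := hsS
    rw [hbdry s hs, abs_zero, eq_comm, abs_eq_zero] at this
    exact hT this
  funext T
  ext x
  rw [hconst T x, hzero T]; rfl

end SimplicialMesh

end MSGFEM

end

/-! ### Finite-dimensional linear algebra, partition of unity operators, and the constants `C_B` and
`α_B`. -/

noncomputable section

namespace MSGFEM

/-! ### Linear algebra -/

section LinearAlgebra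

variable {V : Type*} [AddCommGroup V] [Module ℝ V]

/-- Galerkin problems for definite forms on finite-dimensional spaces are solvable. -/
theorem exists_galerkin [FiniteDimensional ℝ V] (W : Submodule ℝ V) (β : LinearMap.BilinForm ℝ V)
    (hβ : ∀ v ∈ W, β v v = 0 → v = 0) (ℓ : V →ₗ[ℝ] ℝ) :
    ∃ w ∈ W, ∀ v ∈ W, β w v = ℓ v := by
  let A : W →ₗ[ℝ] Module.Dual ℝ W := (β.domRestrict₁₂ W W : W →ₗ[ℝ] W →ₗ[ℝ] ℝ)
  have hinj : Function.Injective A := by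
    rw [← LinearMap.ker_eq_bot, LinearMap.ker_eq_bot']
    intro w hw
    have h : A w w = 0 := by rw [hw]; rfl
    exact Subtype.ext (hβ w w.2 h)
  obtain ⟨w, hw⟩ := (LinearMap.injective_iff_surjective_of_finrank_eq_finrank
    Subspace.dual_finrank_eq.symm).1 hinj (ℓ.domRestrict W)
  exact ⟨w, w.2, fun v hv => LinearMap.congr_fun hw ⟨v, hv⟩⟩

theorem galerkin_unique {W : Submodule ℝ V} {β : LinearMap.BilinForm ℝ V}
    (hβ : ∀ v ∈ W, β v v = 0 → v = 0) {w w' : V} (hw : w ∈ W) (hw' : w' ∈ W)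
    (h : ∀ v ∈ W, β w v = β w' v) : w = w' := by
  refine sub_eq_zero.1 (hβ _ (W.sub_mem hw hw') ?_)
  rw [LinearMap.map_sub₂, h _ (W.sub_mem hw hw'), sub_self]

/-- If vectors of the same color are orthogonal, the square norm of the sum is at most the number
of colors times the sum of the square norms. -/
theorem sum_sq_le_colors {ι : Type*} [Fintype ι] {k : ℕ} (b : LinearMap.BilinForm ℝ V)
    (hb : ∀ v, 0 ≤ b v v) (hsymm : ∀ u v, b u v = b v u) (c : ι → Fin k) (z : ι → V)
    (horth : ∀ i j, i ≠ j → c i = c j → b (z i) (z j) = 0) :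
    b (∑ i, z i) (∑ i, z i) ≤ k * ∑ i, b (z i) (z i) := by
  classical
  set Z : Fin k → V := fun l => ∑ i with c i = l, z i with hZ
  have h1 : ∑ i, z i = ∑ l, Z l := (Finset.sum_fiberwise _ _ _).symm
  have h2 : ∀ l, b (Z l) (Z l) = ∑ i with c i = l, b (z i) (z i) := by
    intro l
    simp only [hZ, map_sum, LinearMap.sum_apply]
    refine Finset.sum_congr rfl fun i hi => ?_
    refine Finset.sum_eq_single_of_mem i hi fun j hj hji => horth j i hji ?_
    rw [(Finset.mem_filter.1 hi).2, (Finset.mem_filter.1 hj).2]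
  have h3 : ∑ i, b (z i) (z i) = ∑ l, b (Z l) (Z l) := by
    simp only [h2]
    exact (Finset.sum_fiberwise _ _ _).symm
  -- Distinct colors need not be orthogonal. Summing this bound over all `k²` pairs of colors
  -- produces the factor `k`.
  have h4 : ∀ u v, b u v ≤ 1 / 2 * (b u u + b v v) := by
    intro u v
    have := hb (u - v)
    simp only [map_sub, LinearMap.sub_apply, hsymm v u] at this
    linarith
  rw [h1, h3]
  calc b (∑ l, Z l) (∑ l, Z l) = ∑ l', ∑ l, b (Z l) (Z l') := by
        simp only [map_sum, LinearMap.sum_apply]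
    _ ≤ ∑ l', ∑ l, 1 / 2 * (b (Z l) (Z l) + b (Z l') (Z l')) :=
        Finset.sum_le_sum fun l' _ => Finset.sum_le_sum fun l _ => h4 _ _
    _ = k * ∑ l, b (Z l) (Z l) := by
        simp only [← Finset.mul_sum, Finset.sum_add_distrib, Finset.sum_const, Finset.card_univ,
          Fintype.card_fin, nsmul_eq_mul]
        ring

/-- Best approximation in the span of the first eigenvectors of a generalized eigenproblem. The
eigenvectors need not be orthogonal inside the eigenspaces. -/
theorem exists_eigen_approx (a b : LinearMap.BilinForm ℝ V) (hb : ∀ v, 0 ≤ b v v)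
    (hbs : ∀ u v, b u v = b v u) (has : ∀ u v, a u v = a v u) {K : ℕ} {lam : Fin K → ℝ≥0∞}
    (hanti : Antitone lam) (φ : Fin K → V) (htop : ∀ k l, lam k = ⊤ → b (φ k) (φ l) = 0)
    (hfin : ∀ k l, lam k ≠ ⊤ → a (φ k) (φ l) = (lam k).toReal * b (φ k) (φ l)) (n : ℕ)
    (hn : nextEigenvalue lam n ≠ ⊤) {w : V} (hw : w ∈ Submodule.span ℝ (range φ)) :
    ∃ g ∈ Submodule.span ℝ {x | ∃ k : Fin K, (k : ℕ) < n ∧ x = φ k},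
      a (w - g) (w - g) ≤ (nextEigenvalue lam n).toReal * b w w := by
  classical
  set μ := nextEigenvalue lam n with hμ
  obtain ⟨c, rfl⟩ := (Submodule.mem_span_range_iff_exists_fun ℝ).1 hw
  have horth : ∀ k l, lam l ≠ ⊤ → lam k ≠ lam l → b (φ k) (φ l) = 0 := by
    intro k l hl hkl
    by_cases hk : lam k = ⊤
    · exact htop k l hk
    have h1 := hfin k l hk
    rw [has, hfin l k hl, hbs] at h1
    have h2 : (lam k).toReal ≠ (lam l).toReal := fun h => hkl ((ENNReal.toReal_eq_toReal_iff' hk hl).1 h)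
    have h3 : ((lam k).toReal - (lam l).toReal) * b (φ k) (φ l) = 0 := by linarith
    exact (mul_eq_zero.1 h3).resolve_left (sub_ne_zero.2 h2)
  set g := ∑ k with μ < lam k, c k • φ k with hg
  set r := ∑ k with ¬ μ < lam k, c k • φ k with hr
  have hgr : ∑ k, c k • φ k = g + r := (Finset.sum_filter_add_sum_filter_not _ _ _).symm
  refine ⟨g, Submodule.sum_mem _ fun k hk => Submodule.smul_mem _ _
    (Submodule.subset_span ⟨k, ?_, rfl⟩), ?_⟩
  -- Counting from zero, index `n` carries the eigenvalue number `n + 1`, so by monotonicity an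
  -- eigenvalue above `μ` has index below `n`.
  · by_contra! hnk
    have hk' := (Finset.mem_filter.1 hk).2
    have hnK : n < K := hnk.trans_lt k.2
    rw [hμ, nextEigenvalue, dif_pos hnK] at hk'
    exact absurd (hanti (show (⟨n, hnK⟩ : Fin K) ≤ k from hnk)) (not_le.2 hk')
  rw [hgr, add_sub_cancel_left]
  have hgr0 : b g r = 0 := by
    simp only [hg, hr, map_sum, LinearMap.sum_apply, map_smul, LinearMap.smul_apply]
    refine Finset.sum_eq_zero fun l hl => ?_
    rw [Finset.sum_eq_zero, smul_zero]
    intro k hk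
    have hk' := (Finset.mem_filter.1 hk).2
    have hl' := not_lt.1 (Finset.mem_filter.1 hl).2
    rw [horth k l (ne_top_of_le_ne_top hn hl') (hl'.trans_lt hk').ne']
    simp
  have hbb : b r r ≤ b (g + r) (g + r) := by
    simp only [map_add, LinearMap.add_apply, hbs r g, hgr0]
    have := hb g
    linarith
  refine le_trans ?_ (mul_le_mul_of_nonneg_left hbb ENNReal.toReal_nonneg)
  -- Rescaling the coefficients by `√(μ - λ_k)` turns `μ b(r,r) - a(r,r)` into `b(y,y) ≥ 0`:
  -- products of coefficients with equal eigenvalues acquire `μ - λ_k`, and the other terms vanish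
  -- by orthogonality.
  set y := ∑ k with ¬ μ < lam k, (c k * √(μ.toReal - (lam k).toReal)) • φ k with hy
  have key : b y y = μ.toReal * b r r - a r r := by
    simp only [hy, hr, map_sum, LinearMap.sum_apply, map_smul, LinearMap.smul_apply, smul_eq_mul,
      Finset.mul_sum, ← Finset.sum_sub_distrib]
    refine Finset.sum_congr rfl fun l hl => Finset.sum_congr rfl fun k hk => ?_
    have hk' := not_lt.1 (Finset.mem_filter.1 hk).2
    have hl' := not_lt.1 (Finset.mem_filter.1 hl).2
    rw [hfin k l (ne_top_of_le_ne_top hn hk')]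
    by_cases hkl : lam k = lam l
    · have h0 : 0 ≤ μ.toReal - (lam l).toReal :=
        sub_nonneg.2 (ENNReal.toReal_mono hn hl')
      have h1 := Real.mul_self_sqrt h0
      rw [hkl]
      linear_combination c k * c l * b (φ k) (φ l) * h1
    · rw [horth k l (ne_top_of_le_ne_top hn hl') hkl]; ring
  linarith [hb y]

end LinearAlgebra

namespace SimplicialMesh

variable {d : ℕ} {𝒯 : SimplicialMesh d}

instance finiteDimensional_affine : FiniteDimensional ℝ (Space d →ᵃ[ℝ] ℝ) :=
  Module.Finite.equiv (AffineMap.toConstProdLinearMap (k := ℝ) (V1 := Space d) (V2 := ℝ) ℝ).symm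

/-! ### The partition of unity operators -/

theorem affine_sum_apply {ι : Type*} (s : Finset ι) (a : ι → Space d →ᵃ[ℝ] ℝ) (x : Space d) :
    (∑ i ∈ s, a i) x = ∑ i ∈ s, a i x := by
  classical
  induction s using Finset.induction_on with
  | empty => simp
  | insert i s hi ih => rw [Finset.sum_insert hi, Finset.sum_insert hi, ← ih]; rfl

theorem puOp_apply (χ : Space d → ℝ) (u : 𝒯.Vh) (T : 𝒯.Elem) :
    𝒯.puOp χ u T = ∑ k, (χ (𝒯.vert T k) * u T (𝒯.vert T k)) • 𝒯.bary T k := rfl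

/-- The partition of unity operator as a linear map. -/
def puLin (𝒯 : SimplicialMesh d) (χ : Space d → ℝ) : 𝒯.Vh →ₗ[ℝ] 𝒯.Vh where
  toFun := 𝒯.puOp χ
  map_add' u v := by
    funext T
    simp only [puOp_apply, Pi.add_apply, AffineMap.coe_add, mul_add, add_smul,
      Finset.sum_add_distrib]
  map_smul' c u := by
    funext T
    simp only [puOp_apply, Pi.smul_apply, AffineMap.coe_smul, smul_eq_mul, RingHom.id_apply,
      Finset.smul_sum, smul_smul, mul_left_comm]

theorem puLin_apply (χ : Space d → ℝ) (u : 𝒯.Vh) : 𝒯.puLin χ u = 𝒯.puOp χ u := rfl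

/-- Restriction to a subdomain as a linear map. -/
def restrictLin (𝒯 : SimplicialMesh d) (D : Set (Space d)) : 𝒯.Vh →ₗ[ℝ] 𝒯.Vh where
  toFun := 𝒯.restrict D
  map_add' u v := by
    funext T
    simp only [restrict, Pi.add_apply]
    split_ifs <;> simp
  map_smul' c u := by
    funext T
    simp only [restrict, Pi.smul_apply, RingHom.id_apply]
    split_ifs <;> simp

/-- `ℋ₀(D)` as a subspace. -/
def H₀Submodule (𝒯 : SimplicialMesh d) (D : Set (Space d)) : Submodule ℝ 𝒯.Vh where
  carrier := 𝒯.H₀ D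
  add_mem' {u v} hu hv T hT := by rw [Pi.add_apply, hu T hT, hv T hT, add_zero]
  zero_mem' _ _ := rfl
  smul_mem' c v hv T hT := by rw [Pi.smul_apply, hv T hT, smul_zero]

/-- The coarse space as a subspace. -/
def coarseSubmodule (𝒯 : SimplicialMesh d) {M : ℕ} (χ : Fin M → Space d → ℝ)
    (S : Fin M → Submodule ℝ 𝒯.Vh) : Submodule ℝ 𝒯.Vh where
  carrier := 𝒯.coarseSpace χ S
  add_mem' := by
    rintro _ _ ⟨φ, hφ, rfl⟩ ⟨φ', hφ', rfl⟩
    refine ⟨φ + φ', fun j => (S j).add_mem (hφ j) (hφ' j), ?_⟩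
    simp only [← puLin_apply, Pi.add_apply, map_add, Finset.sum_add_distrib]
  zero_mem' := ⟨0, fun j => (S j).zero_mem, by simp [← puLin_apply]⟩
  smul_mem' := by
    rintro c _ ⟨φ, hφ, rfl⟩
    refine ⟨c • φ, fun j => (S j).smul_mem c (hφ j), ?_⟩
    simp only [← puLin_apply, Pi.smul_apply, map_smul, Finset.smul_sum]

section Decomposition

variable {M : ℕ} {ω ωs : Fin M → Set (Space d)} {χ : Fin M → Space d → ℝ}

theorem isClosed_inner (D : Set (Space d)) : IsClosed (𝒯.inner D) :=
  (toFinite _).isClosed_biUnion fun T _ => (𝒯.isCompact_elem T).isClosed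

/-- The interior of an element outside `ω_j⁻` misses the support of `χ_j`. Continuity of the affine
restriction extends the zero to the vertices, which are what the interpolation sees. -/
theorem pu_eq_zero_on_elem (h : 𝒯.IsDecomposition ω ωs χ) (j : Fin M) {T : 𝒯.Elem}
    (hT : T ∉ 𝒯.innerElems (ω j)) {x : Space d} (hx : x ∈ 𝒯.elem T) : χ j x = 0 := by
  obtain ⟨a, ha⟩ := h.pu_affine j T
  have hint : ∀ y ∈ interior (𝒯.elem T), a y = 0 := by
    intro y hy
    by_contra hne
    rw [← ha (interior_subset hy)] at hne
    have hmem := h.pu_support j (subset_closure ⟨𝒯.interior_elem_subset_Ω T hy, hne⟩)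
    rw [(isClosed_inner _).closure_eq] at hmem
    exact hT (𝒯.mem_of_open_subset_iUnion hy hmem)
  rw [ha hx]
  have hcl : IsClosed {y | a y = 0} := isClosed_eq (continuous_affine a) continuous_const
  rw [← 𝒯.closure_interior_elem T] at hx
  exact hcl.closure_subset_iff.2 hint hx

theorem puOp_mem_H₀ (h : 𝒯.IsDecomposition ω ωs χ) (j : Fin M) (u : 𝒯.Vh) :
    𝒯.puOp (χ j) u ∈ 𝒯.H₀ (ω j) := by
  intro T hT
  rw [puOp_apply]
  refine Finset.sum_eq_zero fun k _ => ?_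
  rw [pu_eq_zero_on_elem h j hT (𝒯.vert_mem_elem T k), zero_mul, zero_smul]

theorem puOp_congr (h : 𝒯.IsDecomposition ω ωs χ) (j : Fin M) {u v : 𝒯.Vh}
    (huv : ∀ T ∈ 𝒯.outerElems (ω j), u T = v T) : 𝒯.puOp (χ j) u = 𝒯.puOp (χ j) v := by
  funext T
  by_cases hT : T ∈ 𝒯.innerElems (ω j)
  · rw [puOp_apply, puOp_apply, huv T (innerElems_subset_outerElems hT)]
  · rw [puOp_mem_H₀ h j u T hT, puOp_mem_H₀ h j v T hT]

theorem puOp_restrict (h : 𝒯.IsDecomposition ω ωs χ) (j : Fin M) (u : 𝒯.Vh) :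
    𝒯.puOp (χ j) (𝒯.restrict (ω j) u) = 𝒯.puOp (χ j) u :=
  puOp_congr h j fun _ hT => restrict_of_mem hT u

theorem sum_puOp (h : 𝒯.IsDecomposition ω ωs χ) (u : 𝒯.Vh) :
    ∑ j, 𝒯.puOp (χ j) u = u := by
  funext T
  rw [Finset.sum_apply]
  simp only [puOp_apply]
  rw [Finset.sum_comm]
  simp only [← Finset.sum_smul, ← Finset.sum_mul]
  ext x
  rw [𝒯.affine_apply_eq_sum T (u T) x]
  have hsum : ∀ k, ∑ j, χ j (𝒯.vert T k) = 1 := fun k =>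
    h.pu_sum _ (𝒯.elem_subset_closedDomain T (𝒯.vert_mem_elem T k))
  simp [hsum, affine_sum_apply, mul_comm]

theorem isOpen_of_meshResolved {D : Set (Space d)} (h : 𝒯.MeshResolved D) : IsOpen D := by
  obtain ⟨S, rfl⟩ := h
  exact isOpen_interior

theorem IsDecomposition.subset_Ω (h : 𝒯.IsDecomposition ω ωs χ) (j : Fin M) : ω j ⊆ 𝒯.Ω :=
  (h.subset_over j).trans (h.over_subset j)

theorem IsDecomposition.isOpen (h : 𝒯.IsDecomposition ω ωs χ) (j : Fin M) : IsOpen (ω j) :=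
  isOpen_of_meshResolved (h.resolved j)

theorem Ω_nonempty (𝒯 : SimplicialMesh d) : 𝒯.Ω.Nonempty :=
  (𝒯.interior_elem_nonempty ⟨0, 𝒯.N_pos⟩).mono (𝒯.interior_elem_subset_Ω _)

theorem meshResolved_Ω (𝒯 : SimplicialMesh d) : 𝒯.MeshResolved 𝒯.Ω :=
  ⟨univ, by simp [Ω, closedDomain]⟩

theorem outerElems_mono {D D' : Set (Space d)} (h : D ⊆ D') :
    𝒯.outerElems D ⊆ 𝒯.outerElems D' := fun _ hT => hT.mono (inter_subset_inter_right _ h)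

end Decomposition

/-! ### The load functional -/

theorem integrableOn_load {f : Space d → ℝ} (hf : MemLp f 2 (volume.restrict 𝒯.Ω))
    (a : Space d →ᵃ[ℝ] ℝ) (T : 𝒯.Elem) :
    IntegrableOn (fun x => f x * a x) (𝒯.elem T ∩ 𝒯.Ω) := by
  have hfin : IsFiniteMeasure (volume.restrict 𝒯.Ω) :=
    ⟨by
      rw [Measure.restrict_apply_univ]
      exact (measure_mono interior_subset).trans_lt 𝒯.isCompact_closedDomain.measure_lt_top⟩
  have hfi : IntegrableOn f (𝒯.elem T ∩ 𝒯.Ω) :=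
    IntegrableOn.mono_set (hf.integrable (by norm_num)) inter_subset_right
  obtain ⟨C, hC⟩ := (𝒯.isCompact_elem T).exists_bound_of_continuousOn
    (continuous_affine a).continuousOn
  refine Integrable.mul_bdd (c := C) hfi (continuous_affine a).aestronglyMeasurable ?_
  exact ae_restrict_of_forall_mem
    ((𝒯.isCompact_elem T).measurableSet.inter 𝒯.isOpen_Ω.measurableSet) fun x hx => hC x hx.1

/-- The load functional on `Ω` as a linear map. -/
def loadLin {f : Space d → ℝ} (hf : MemLp f 2 (volume.restrict 𝒯.Ω)) : 𝒯.Vh →ₗ[ℝ] ℝ where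
  toFun v := 𝒯.load 𝒯.Ω v f
  map_add' u v := by
    simp only [load, ← Finset.sum_add_distrib]
    refine Finset.sum_congr rfl fun T _ => ?_
    rw [← integral_add (integrableOn_load hf _ T) (integrableOn_load hf _ T)]
    simp only [Pi.add_apply, AffineMap.coe_add, mul_add]
  map_smul' c v := by
    simp only [load, Finset.smul_sum, RingHom.id_apply]
    refine Finset.sum_congr rfl fun T _ => ?_
    rw [smul_eq_mul, ← integral_const_mul]
    simp only [Pi.smul_apply, AffineMap.coe_smul, smul_eq_mul, mul_left_comm]

/-! ### Continuity and coercivity constants -/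

section Constants

variable [NeZero d] {ν : 𝒯.Elem → ℝ} {γ₀ : ℝ} {D : Set (Space d)}

theorem B_restrict (hreg : 𝒯.RegularAtBoundary D) (u v : 𝒯.Vh) :
    𝒯.B ν γ₀ D (𝒯.restrict D u) (𝒯.restrict D v) = 𝒯.B ν γ₀ D u v :=
  B_congr hreg (fun _ hT => restrict_of_mem hT u) (fun _ hT => restrict_of_mem hT v)

theorem normPlus_restrict (hreg : 𝒯.RegularAtBoundary D) (v : 𝒯.Vh) :
    𝒯.normPlus ν γ₀ D (𝒯.restrict D v) = 𝒯.normPlus ν γ₀ D v := by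
  rw [normPlus, normPlus, Bplus_congr hreg (fun _ hT => restrict_of_mem hT v)
    (fun _ hT => restrict_of_mem hT v)]

/-- Not every function on a nonempty open set has zero energy. -/
theorem exists_normPlus_pos (hν : ∀ T, 0 < ν T) (hDo : IsOpen D) (hD : D ⊆ 𝒯.Ω)
    (hne : D.Nonempty) : ∃ v : 𝒯.Vh, 0 < 𝒯.normPlus ν γ₀ D v := by
  set e : Space d := EuclideanSpace.single 0 1 with he
  set a : Space d →ᵃ[ℝ] ℝ := (innerSL ℝ e).toLinearMap.toAffineMap with ha
  have hgrad : grad a = e := ext_inner_right ℝ fun x => by simp [inner_grad, ha]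
  refine ⟨fun _ => a, Real.sqrt_pos.2 ?_⟩
  have h2 := BpI_nonneg (γ₀ := γ₀) D hν fun _ => a
  have h3 := penB_nonneg (γ₀ := γ₀) D hν fun _ => a
  suffices h : 0 < 𝒯.volForm ν D (fun _ => a) fun _ => a by rw [Bplus]; linarith
  rw [volForm_self]
  obtain ⟨T, hT⟩ := exists_outerElem hD hne
  refine Finset.sum_pos' (fun T _ => by have := hν T; positivity) ⟨T, Finset.mem_univ T, ?_⟩
  have h4 := 𝒯.volume_elem_inter_pos hDo hT
  have h5 := hν T
  simp only [hgrad]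
  have : ‖e‖ = 1 := by simp [he]
  rw [this]
  positivity

/-- A function of positive energy bounds the admissible constants from above; without it the real
supremum would take its default value `0`. -/
theorem coerConst_pos_of_le (hreg : 𝒯.RegularAtBoundary D) (hν : ∀ T, 0 < ν T)
    (hex : ∃ v : 𝒯.Vh, 0 < 𝒯.normPlus ν γ₀ D v) {α : ℝ} (hα : 0 < α)
    (h : ∀ v : 𝒯.Vh, α * 𝒯.Bplus ν γ₀ D v v ≤ 𝒯.B ν γ₀ D v v) :
    0 < 𝒯.coerConst ν γ₀ D := by
  obtain ⟨v, hv⟩ := hex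
  refine hα.trans_le (le_csSup ⟨𝒯.B ν γ₀ D v v / 𝒯.normPlus ν γ₀ D v ^ 2, ?_⟩ ?_)
  · intro β hβ
    rw [le_div_iff₀ (by positivity)]
    have := hβ _ (restrict_mem_H v)
    rwa [normPlus_restrict hreg, B_restrict hreg] at this
  · intro w _
    rw [normPlus_sq D hν]
    exact h w

/-- The supremum is itself admissible. Positivity excludes the default value `0` for an empty set of
constants. -/
theorem coerConst_mul_le (hreg : 𝒯.RegularAtBoundary D)
    (hα : 0 < 𝒯.coerConst ν γ₀ D) (v : 𝒯.Vh) :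
    𝒯.coerConst ν γ₀ D * 𝒯.normPlus ν γ₀ D v ^ 2 ≤ 𝒯.B ν γ₀ D v v := by
  set S : Set ℝ := {α : ℝ | ∀ v ∈ 𝒯.H D, α * 𝒯.normPlus ν γ₀ D v ^ 2 ≤ 𝒯.B ν γ₀ D v v} with hS
  have hcoer : 𝒯.coerConst ν γ₀ D = sSup S := rfl
  have hne : S.Nonempty := by
    by_contra hemp
    rw [hcoer, not_nonempty_iff_eq_empty.1 hemp, Real.sSup_empty] at hα
    exact hα.false
  have hall : ∀ α ∈ S, α * 𝒯.normPlus ν γ₀ D v ^ 2 ≤ 𝒯.B ν γ₀ D v v := by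
    intro α hα
    have := hα _ (restrict_mem_H v)
    rwa [normPlus_restrict hreg, B_restrict hreg] at this
  rcases (normPlus_nonneg (ν := ν) (γ₀ := γ₀) D v).eq_or_lt with h0 | hpos
  · obtain ⟨α, hα'⟩ := hne
    have := hall α hα'
    rw [← h0] at this ⊢
    simpa using this
  · rw [← le_div_iff₀ (by positivity)]
    refine csSup_le hne fun α hα' => ?_
    rw [le_div_iff₀ (by positivity)]
    exact hall α hα'

theorem abs_B_le_contConst (hd : 2 ≤ d) (hDo : IsOpen D) (hreg : 𝒯.RegularAtBoundary D)
    (hν : ∀ T, 0 < ν T) (hγ : 0 < γ₀) (hα : 0 < 𝒯.coerConst ν γ₀ D) (u v : 𝒯.Vh) :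
    |𝒯.B ν γ₀ D u v| ≤ 𝒯.contConst ν γ₀ D * 𝒯.normPlus ν γ₀ D u * 𝒯.normPlus ν γ₀ D v := by
  set S : Set ℝ := {C : ℝ | 0 ≤ C ∧ ∀ u ∈ 𝒯.H D, ∀ v ∈ 𝒯.H D,
    |𝒯.B ν γ₀ D u v| ≤ C * 𝒯.normPlus ν γ₀ D u * 𝒯.normPlus ν γ₀ D v} with hS
  have hne : S.Nonempty := by
    obtain ⟨c, hc, htr⟩ := exists_traceBound hDo hreg
    set C := 3 + 6 * c * (d + 1) / γ₀ ^ 2 with hC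
    have hC0 : 0 ≤ C := by positivity
    refine ⟨C, hC0, fun u _ v _ => ?_⟩
    have hpos : ∀ w : 𝒯.Vh, 0 ≤ 𝒯.B ν γ₀ D w w := fun w =>
      le_trans (by positivity) (coerConst_mul_le hreg hα w)
    -- Coercivity makes `B_D` positive semidefinite. Its own Cauchy–Schwarz inequality reduces
    -- continuity to the diagonal bound `B_self_le`, so mixed consistency terms need no estimate.
    have hcs := (bilinB ν γ₀ D).apply_sq_le_of_symm hpos ⟨fun x y => B_symm ν γ₀ D x y⟩ u v
    simp only [bilinB_apply] at hcs
    have h1 := B_self_le D hd hν hγ hc htr u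
    have h2 := B_self_le D hd hν hγ hc htr v
    rw [← hC, ← normPlus_sq D hν] at h1 h2
    have hu := normPlus_nonneg (ν := ν) (γ₀ := γ₀) D u
    have hv := normPlus_nonneg (ν := ν) (γ₀ := γ₀) D v
    refine abs_le_of_sq_le_sq ?_ (by positivity)
    calc _ ≤ _ := hcs
      _ ≤ (C * 𝒯.normPlus ν γ₀ D u ^ 2) * (C * 𝒯.normPlus ν γ₀ D v ^ 2) :=
          mul_le_mul h1 h2 (hpos v) (by positivity)
      _ = _ := by ring
  have hall : ∀ C ∈ S,
      |𝒯.B ν γ₀ D u v| ≤ C * (𝒯.normPlus ν γ₀ D u * 𝒯.normPlus ν γ₀ D v) := by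
    intro C hC
    have := hC.2 _ (restrict_mem_H u) _ (restrict_mem_H v)
    rwa [normPlus_restrict hreg, normPlus_restrict hreg, B_restrict hreg, mul_assoc] at this
  rw [mul_assoc]
  change _ ≤ sInf S * _
  rcases (mul_nonneg (normPlus_nonneg (ν := ν) (γ₀ := γ₀) D u)
    (normPlus_nonneg (ν := ν) (γ₀ := γ₀) D v)).eq_or_lt with h0 | hpos
  · obtain ⟨C, hC⟩ := hne
    have := hall C hC
    rw [← h0] at this ⊢
    simpa using this
  · rw [← div_le_iff₀ hpos]
    refine le_csInf hne fun C hC => ?_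
    rw [div_le_iff₀ hpos]
    exact hall C hC

/-- Compare `α_B ‖v‖² ≤ C_B ‖v‖²` for a function of positive energy. Positivity ensures that an
infinite eigenvalue makes the final bound infinite and is not cancelled by `∞ · 0 = 0`. -/
theorem contConst_pos (hd : 2 ≤ d) (hDo : IsOpen D) (hreg : 𝒯.RegularAtBoundary D)
    (hν : ∀ T, 0 < ν T) (hγ : 0 < γ₀) (hD : D ⊆ 𝒯.Ω) (hne : D.Nonempty)
    (hα : 0 < 𝒯.coerConst ν γ₀ D) : 0 < 𝒯.contConst ν γ₀ D := by
  obtain ⟨v, hv⟩ := exists_normPlus_pos (γ₀ := γ₀) hν hDo hD hne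
  have h1 := coerConst_mul_le hreg hα v
  have h2 := (le_abs_self _).trans (abs_B_le_contConst hd hDo hreg hν hγ hα v v)
  have h3 : 0 < 𝒯.coerConst ν γ₀ D * 𝒯.normPlus ν γ₀ D v ^ 2 := by positivity
  by_contra! hcon
  have h4 : 𝒯.contConst ν γ₀ D * 𝒯.normPlus ν γ₀ D v * 𝒯.normPlus ν γ₀ D v ≤ 0 := by
    rw [mul_assoc]
    exact mul_nonpos_of_nonpos_of_nonneg hcon (by positivity)
  linarith

/-- Under coercivity `B_D` is definite on `ℋ₀(D)`. -/
theorem eq_zero_of_B_eq_zero (hd : 2 ≤ d) (hDo : IsOpen D) (hD : D ⊆ 𝒯.Ω)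
    (hreg : 𝒯.RegularAtBoundary D) (hν : ∀ T, 0 < ν T) (hγ : 0 < γ₀)
    (hα : 0 < 𝒯.coerConst ν γ₀ D) {v : 𝒯.Vh} (hv : v ∈ 𝒯.H₀ D) (h : 𝒯.B ν γ₀ D v v = 0) :
    v = 0 := by
  have h1 := coerConst_mul_le hreg hα v
  -- On `D` the form `B_D^+` may be only semidefinite; on `ℋ₀(D)` it agrees with the definite form
  -- on `Ω`.
  rw [h, normPlus_sq D hν, Bplus_eq_Ω hDo hD hv] at h1
  refine eq_zero_of_Bplus_eq_zero hd hν hγ (le_antisymm ?_ (Bplus_nonneg 𝒯.Ω hν v))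
  by_contra! hpos
  have := mul_pos hα hpos
  linarith

omit [NeZero d] in
theorem mem_H₀_Ω (v : 𝒯.Vh) : v ∈ 𝒯.H₀ 𝒯.Ω := fun T hT => (hT (by simp [innerElems])).elim

end Constants

end SimplicialMesh

end MSGFEM

end

/-! ### Well-posedness and the error bound with real constants. -/

noncomputable section

namespace MSGFEM

namespace SimplicialMesh

variable {d : ℕ} [NeZero d] {𝒯 : SimplicialMesh d} {ν : 𝒯.Elem → ℝ} {γ₀ : ℝ} {f : Space d → ℝ}
  {M : ℕ} {ω ωs : Fin M → Set (Space d)} {χ : Fin M → Space d → ℝ}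

/-! ### Well-posedness -/

theorem existsUnique_isDGSolution (hd : 2 ≤ d) (hν : ∀ T, 0 < ν T) (hγ : 0 < γ₀)
    (hf : MemLp f 2 (volume.restrict 𝒯.Ω)) (hα : 0 < 𝒯.coerConst ν γ₀ 𝒯.Ω) :
    ∃! ue : 𝒯.Vh, 𝒯.IsDGSolution ν γ₀ ue f := by
  have hdef : ∀ v ∈ (⊤ : Submodule ℝ 𝒯.Vh), bilinB ν γ₀ 𝒯.Ω v v = 0 → v = 0 := fun v _ h =>
    eq_zero_of_B_eq_zero hd 𝒯.isOpen_Ω Subset.rfl regularAtBoundary_Ω hν hγ hα (mem_H₀_Ω v) h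
  obtain ⟨ue, -, hue⟩ := exists_galerkin ⊤ (bilinB ν γ₀ 𝒯.Ω) hdef (loadLin hf)
  refine ⟨ue, fun v => hue v trivial, fun u hu => ?_⟩
  exact galerkin_unique hdef trivial trivial fun v _ => (hu v).trans (hue v trivial).symm

/-- `ψ` solves the local source problem on `D` with test space `ℋ₀(D)`. -/
def IsLocalSolution (𝒯 : SimplicialMesh d) (ν : 𝒯.Elem → ℝ) (γ₀ : ℝ) (f : Space d → ℝ)
    (D : Set (Space d)) (ψ : 𝒯.Vh) : Prop :=
  ψ ∈ 𝒯.H₀ D ∧ ∀ v ∈ 𝒯.H₀ D, 𝒯.B ν γ₀ D ψ v = 𝒯.load D v f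

section LocalSolution

variable {D : Set (Space d)}

theorem exists_isLocalSolution (hd : 2 ≤ d) (hν : ∀ T, 0 < ν T) (hγ : 0 < γ₀)
    (hf : MemLp f 2 (volume.restrict 𝒯.Ω)) (hDo : IsOpen D) (hD : D ⊆ 𝒯.Ω)
    (hreg : 𝒯.RegularAtBoundary D) (hα : 0 < 𝒯.coerConst ν γ₀ D) :
    ∃ ψ, 𝒯.IsLocalSolution ν γ₀ f D ψ := by
  obtain ⟨ψ, hψ, h⟩ := exists_galerkin (𝒯.H₀Submodule D) (bilinB ν γ₀ D)
    (fun _ hv h => eq_zero_of_B_eq_zero hd hDo hD hreg hν hγ hα hv h) (loadLin hf)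
  exact ⟨ψ, hψ, fun v hv => (h v hv).trans (load_eq_Ω hD hv f).symm⟩

theorem IsLocalSolution.unique (hd : 2 ≤ d) (hν : ∀ T, 0 < ν T) (hγ : 0 < γ₀)
    (hDo : IsOpen D) (hD : D ⊆ 𝒯.Ω) (hreg : 𝒯.RegularAtBoundary D)
    (hα : 0 < 𝒯.coerConst ν γ₀ D) {ψ ψ' : 𝒯.Vh} (hψ : 𝒯.IsLocalSolution ν γ₀ f D ψ)
    (hψ' : 𝒯.IsLocalSolution ν γ₀ f D ψ') : ψ = ψ' :=
  galerkin_unique (W := 𝒯.H₀Submodule D) (β := bilinB ν γ₀ D)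
    (fun _ hv h => eq_zero_of_B_eq_zero hd hDo hD hreg hν hγ hα hv h) hψ.1 hψ'.1
    fun v hv => (hψ.2 v hv).trans (hψ'.2 v hv).symm

/-- The global solution minus the local particular solution is discretely harmonic. -/
theorem sub_localSolution_mem_HB (hDo : IsOpen D) (hD : D ⊆ 𝒯.Ω) (hreg : 𝒯.RegularAtBoundary D)
    {ue ψ : 𝒯.Vh} (hue : 𝒯.IsDGSolution ν γ₀ ue f) (hψ : 𝒯.IsLocalSolution ν γ₀ f D ψ) :
    𝒯.restrict D ue - ψ ∈ 𝒯.HB ν γ₀ D := by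
  refine ⟨mem_H_iff.2 fun T hT => ?_, fun v hv => ?_⟩
  · rw [Pi.sub_apply, mem_H_iff.1 (restrict_mem_H ue) T hT, mem_H_iff.1 (H₀_subset_H hψ.1) T hT,
      sub_zero]
  · have h1 : 𝒯.B ν γ₀ D (𝒯.restrict D ue) v = 𝒯.load D v f := by
      rw [B_congr hreg (fun _ hT => restrict_of_mem hT ue) fun _ _ => rfl, B_eq_Ω hDo hD hv,
        hue v, load_eq_Ω hD hv]
    rw [← bilinB_apply, LinearMap.map_sub₂, bilinB_apply, bilinB_apply, h1, hψ.2 v hv, sub_self]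

/-- The harmonic part is bounded by the local energy of the solution. -/
theorem normPlus_harmonic_le (hd : 2 ≤ d) (hν : ∀ T, 0 < ν T) (hγ : 0 < γ₀) (hDo : IsOpen D)
    (hD : D ⊆ 𝒯.Ω) (hreg : 𝒯.RegularAtBoundary D) (hα : 0 < 𝒯.coerConst ν γ₀ D)
    {ue ψ : 𝒯.Vh} (hue : 𝒯.IsDGSolution ν γ₀ ue f) (hψ : 𝒯.IsLocalSolution ν γ₀ f D ψ) :
    𝒯.normPlus ν γ₀ D (𝒯.restrict D ue - ψ) ≤
      𝒯.contConst ν γ₀ D / 𝒯.coerConst ν γ₀ D * 𝒯.normPlus ν γ₀ D ue := by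
  set w := 𝒯.restrict D ue - ψ with hw
  have h1 := coerConst_mul_le hreg hα w
  -- Harmonicity of `w` tested with `ψ` removes `ψ` from the second argument; coercivity and
  -- continuity then compare `w` with `ue`.
  have h2 : 𝒯.B ν γ₀ D w w = 𝒯.B ν γ₀ D w ue := by
    have h3 := (sub_localSolution_mem_HB hDo hD hreg hue hψ).2 ψ hψ.1
    have h4 : 𝒯.B ν γ₀ D w w = 𝒯.B ν γ₀ D w (𝒯.restrict D ue) - 𝒯.B ν γ₀ D w ψ := by
      conv_lhs => rw [hw, ← bilinB_apply, map_sub, ← hw]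
      rfl
    rw [h4, h3, sub_zero]
    exact B_congr hreg (fun _ _ => rfl) fun _ hT => restrict_of_mem hT ue
  have h3 := (le_abs_self _).trans (abs_B_le_contConst hd hDo hreg hν hγ hα w ue)
  rw [← h2] at h3
  rcases (normPlus_nonneg (ν := ν) (γ₀ := γ₀) D w).eq_or_lt with h0 | hpos
  · rw [← h0]
    have hC : 0 ≤ 𝒯.contConst ν γ₀ D := Real.sInf_nonneg fun C hC => hC.1
    have := normPlus_nonneg (ν := ν) (γ₀ := γ₀) D ue
    positivity
  · rw [div_mul_eq_mul_div, le_div_iff₀ hα]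
    refine le_of_mul_le_mul_right ?_ hpos
    linarith

end LocalSolution

/-- Definitional repackaging that exposes the coarse space as a submodule and the local problems as
`IsLocalSolution`. -/
theorem isMSGFEM_iff {S : Fin M → Submodule ℝ 𝒯.Vh} {uG : 𝒯.Vh} :
    𝒯.IsMSGFEM ν γ₀ f ω ωs χ S uG ↔ ∃ (ψ : Fin M → 𝒯.Vh) (up us : 𝒯.Vh),
      (∀ j, 𝒯.IsLocalSolution ν γ₀ f (ωs j) (ψ j)) ∧
      up = ∑ j, 𝒯.puOp (χ j) (𝒯.restrict (ω j) (ψ j)) ∧ us ∈ 𝒯.coarseSubmodule χ S ∧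
      (∀ v ∈ 𝒯.coarseSubmodule χ S,
        𝒯.B ν γ₀ 𝒯.Ω us v = 𝒯.load 𝒯.Ω v f - 𝒯.B ν γ₀ 𝒯.Ω up v) ∧ uG = up + us :=
  Iff.rfl

theorem existsUnique_isMSGFEM (hd : 2 ≤ d) (hν : ∀ T, 0 < ν T) (hγ : 0 < γ₀)
    (hf : MemLp f 2 (volume.restrict 𝒯.Ω)) (h : 𝒯.IsDecomposition ω ωs χ)
    (hα : 0 < 𝒯.coerConst ν γ₀ 𝒯.Ω) (hαs : ∀ j, 0 < 𝒯.coerConst ν γ₀ (ωs j))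
    (S : Fin M → Submodule ℝ 𝒯.Vh) : ∃! uG : 𝒯.Vh, 𝒯.IsMSGFEM ν γ₀ f ω ωs χ S uG := by
  have hdef : ∀ v ∈ 𝒯.coarseSubmodule χ S, bilinB ν γ₀ 𝒯.Ω v v = 0 → v = 0 := fun v _ h =>
    eq_zero_of_B_eq_zero hd 𝒯.isOpen_Ω Subset.rfl regularAtBoundary_Ω hν hγ hα (mem_H₀_Ω v) h
  have hψ : ∀ j, ∃ ψ, 𝒯.IsLocalSolution ν γ₀ f (ωs j) ψ := fun j =>
    exists_isLocalSolution hd hν hγ hf (h.over_open j) (h.over_subset j) (h.over_regular j) (hαs j)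
  choose ψ hψ using hψ
  set up := ∑ j, 𝒯.puOp (χ j) (𝒯.restrict (ω j) (ψ j)) with hup
  obtain ⟨us, hus, hus'⟩ := exists_galerkin (𝒯.coarseSubmodule χ S) (bilinB ν γ₀ 𝒯.Ω) hdef
    (loadLin hf - bilinB ν γ₀ 𝒯.Ω up)
  refine ⟨up + us, isMSGFEM_iff.2 ⟨ψ, up, us, hψ, hup, hus, hus', rfl⟩, fun uG hG => ?_⟩
  obtain ⟨ψ', up', us', hψ', hup', hmem, hgal, rfl⟩ := isMSGFEM_iff.1 hG
  obtain rfl : ψ' = ψ := funext fun j => (hψ' j).unique hd hν hγ (h.over_open j)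
    (h.over_subset j) (h.over_regular j) (hαs j) (hψ j)
  obtain rfl : up' = up := hup'
  rw [galerkin_unique hdef hmem hus fun v hv => (hgal v hv).trans (hus' v hv).symm]

/-! ### The error bound -/

/-- Local approximation of the harmonic part by eigenfunctions. -/
theorem exists_local_approx (hd : 2 ≤ d) (hν : ∀ T, 0 < ν T) (hγ : 0 < γ₀)
    (h : 𝒯.IsDecomposition ω ωs χ) (j : Fin M) (hα : 0 < 𝒯.coerConst ν γ₀ (ωs j)) {K : ℕ}
    {lam : Fin K → ℝ≥0∞} {φ : Fin K → 𝒯.Vh}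
    (hE : 𝒯.IsEigensystem ν γ₀ (ω j) (ωs j) (χ j) lam φ) (n : ℕ)
    (hn : nextEigenvalue lam n ≠ ⊤) {ue ψ : 𝒯.Vh} (hue : 𝒯.IsDGSolution ν γ₀ ue f)
    (hψ : 𝒯.IsLocalSolution ν γ₀ f (ωs j) ψ) :
    ∃ g ∈ 𝒯.localSpace (ω j) φ n,
      𝒯.Bplus ν γ₀ 𝒯.Ω (𝒯.puOp (χ j) (ue - ψ - g)) (𝒯.puOp (χ j) (ue - ψ - g)) ≤
        (nextEigenvalue lam n).toReal *
          (𝒯.contConst ν γ₀ (ωs j) / 𝒯.coerConst ν γ₀ (ωs j)) ^ 2 *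
          𝒯.Bplus ν γ₀ (ωs j) ue ue := by
  set w := 𝒯.restrict (ωs j) ue - ψ with hw
  have hwHB : w ∈ 𝒯.HB ν γ₀ (ωs j) :=
    sub_localSolution_mem_HB (h.over_open j) (h.over_subset j) (h.over_regular j) hue hψ
  let L : 𝒯.Vh →ₗ[ℝ] 𝒯.Vh := 𝒯.puLin (χ j) ∘ₗ 𝒯.restrictLin (ω j)
  -- The left-hand side of the eigenproblem: the energy on `ω_j` pulled back along `P_j` after
  -- restriction.
  let a : LinearMap.BilinForm ℝ 𝒯.Vh := (bilinBplus ν γ₀ (ω j)).compl₁₂ L L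
  obtain ⟨g, hg, hle⟩ := exists_eigen_approx a (bilinBplus ν γ₀ (ωs j))
    (fun v => Bplus_nonneg (ωs j) hν v) (fun u v => Bplus_symm ν γ₀ (ωs j) u v)
    (fun u v => Bplus_symm ν γ₀ (ω j) (L u) (L v)) hE.antitone φ
    (fun k l hk => (hE.eigenpair k).2.1 hk _ (hE.eigenpair l).1)
    (fun k l hk => (hE.eigenpair k).2.2 hk _ (hE.eigenpair l).1) n hn
    (w := w) (by rw [← SetLike.mem_coe, hE.span_eq]; exact hwHB)
  refine ⟨𝒯.restrict (ω j) g, ?_, ?_⟩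
  · have hmap := Submodule.mem_map_of_mem (f := 𝒯.restrictLin (ω j)) hg
    rw [Submodule.map_span] at hmap
    refine Submodule.span_mono ?_ hmap
    rintro _ ⟨_, ⟨k, hk, rfl⟩, rfl⟩
    exact ⟨k, hk, rfl⟩
  · have hpu : 𝒯.puOp (χ j) (ue - ψ - 𝒯.restrict (ω j) g) = L (w - g) := by
      change _ = 𝒯.puOp (χ j) (𝒯.restrict (ω j) (w - g))
      refine puOp_congr h j fun T hT => ?_
      rw [restrict_of_mem hT, hw]
      simp only [Pi.sub_apply]
      rw [restrict_of_mem hT, restrict_of_mem (outerElems_mono (h.subset_over j) hT)]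
    have hmem : L (w - g) ∈ 𝒯.H₀ (ω j) := puOp_mem_H₀ h j _
    -- The range of `P_j` lies in `ℋ₀(ω_j)`, so the global energy is the local one controlled by the
    -- eigenproblem.
    rw [hpu, ← Bplus_eq_Ω (h.isOpen j) (h.subset_Ω j) hmem]
    refine hle.trans ?_
    rw [mul_assoc]
    refine mul_le_mul_of_nonneg_left ?_ ENNReal.toReal_nonneg
    have hb := normPlus_harmonic_le hd hν hγ (h.over_open j) (h.over_subset j) (h.over_regular j)
      hα hue hψ
    have hsq := pow_le_pow_left₀ (normPlus_nonneg (ν := ν) (γ₀ := γ₀) (ωs j) _) hb 2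
    rwa [mul_pow, normPlus_sq _ hν, normPlus_sq _ hν] at hsq

/-- Quasi-optimality of the Galerkin correction. -/
theorem normPlus_error_le_quasiopt (hd : 2 ≤ d) (hν : ∀ T, 0 < ν T) (hγ : 0 < γ₀)
    (hα : 0 < 𝒯.coerConst ν γ₀ 𝒯.Ω) {W : Submodule ℝ 𝒯.Vh} {ue up us : 𝒯.Vh}
    (hue : 𝒯.IsDGSolution ν γ₀ ue f) (hus : us ∈ W)
    (hgal : ∀ v ∈ W, 𝒯.B ν γ₀ 𝒯.Ω us v = 𝒯.load 𝒯.Ω v f - 𝒯.B ν γ₀ 𝒯.Ω up v)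
    {s : 𝒯.Vh} (hs : s ∈ W) :
    𝒯.normPlus ν γ₀ 𝒯.Ω (ue - (up + us)) ≤
      𝒯.contConst ν γ₀ 𝒯.Ω / 𝒯.coerConst ν γ₀ 𝒯.Ω * 𝒯.normPlus ν γ₀ 𝒯.Ω (ue - up - s) := by
  set e := ue - (up + us) with he
  set e' := ue - up - s with he'
  have horth : ∀ v ∈ W, bilinB ν γ₀ 𝒯.Ω e v = 0 := by
    intro v hv
    rw [he, LinearMap.map_sub₂, LinearMap.map_add₂, bilinB_apply, bilinB_apply, bilinB_apply,
      hue v, hgal v hv]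
    ring
  -- Céa's argument: `e` and `e'` differ by an element of `W`, to which `e` is orthogonal.
  have h2 : 𝒯.B ν γ₀ 𝒯.Ω e e = 𝒯.B ν γ₀ 𝒯.Ω e e' := by
    have hee : e = e' + (s - us) := by rw [he, he']; abel
    have h3 : bilinB ν γ₀ 𝒯.Ω e e = bilinB ν γ₀ 𝒯.Ω e (e' + (s - us)) := by rw [← hee]
    rw [map_add, horth _ (W.sub_mem hs hus), add_zero] at h3
    exact h3
  have h1 := coerConst_mul_le regularAtBoundary_Ω hα e
  have h3 := (le_abs_self _).trans
    (abs_B_le_contConst hd 𝒯.isOpen_Ω regularAtBoundary_Ω hν hγ hα e e')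
  rw [← h2] at h3
  rcases (normPlus_nonneg (ν := ν) (γ₀ := γ₀) 𝒯.Ω e).eq_or_lt with h0 | hpos
  · rw [← h0]
    have hC : 0 ≤ 𝒯.contConst ν γ₀ 𝒯.Ω := Real.sInf_nonneg fun C hC => hC.1
    have := normPlus_nonneg (ν := ν) (γ₀ := γ₀) 𝒯.Ω e'
    positivity
  · rw [div_mul_eq_mul_div, le_div_iff₀ hα]
    refine le_of_mul_le_mul_right ?_ hpos
    linarith

/-- The error bound with a real upper bound `m` for the local approximation factors. -/
theorem normPlus_error_le (hd : 2 ≤ d) (hν : ∀ T, 0 < ν T) (hγ : 0 < γ₀)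
    (h : 𝒯.IsDecomposition ω ωs χ) (hα : 0 < 𝒯.coerConst ν γ₀ 𝒯.Ω)
    (hαs : ∀ j, 0 < 𝒯.coerConst ν γ₀ (ωs j)) {K : Fin M → ℕ} {lam : ∀ j, Fin (K j) → ℝ≥0∞}
    {φ : ∀ j, Fin (K j) → 𝒯.Vh}
    (hE : ∀ j, 𝒯.IsEigensystem ν γ₀ (ω j) (ωs j) (χ j) (lam j) (φ j)) {n : Fin M → ℕ}
    (hfin : ∀ j, nextEigenvalue (lam j) (n j) ≠ ⊤) {m : ℝ} (hm : 0 ≤ m)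
    (hle : ∀ j, √(nextEigenvalue (lam j) (n j)).toReal *
      (𝒯.contConst ν γ₀ (ωs j) / 𝒯.coerConst ν γ₀ (ωs j)) ≤ m) {ue uG : 𝒯.Vh}
    (hue : 𝒯.IsDGSolution ν γ₀ ue f)
    (hG : 𝒯.IsMSGFEM ν γ₀ f ω ωs χ (fun j => 𝒯.localSpace (ω j) (φ j) (n j)) uG) :
    𝒯.normPlus ν γ₀ 𝒯.Ω (ue - uG) ≤
      𝒯.contConst ν γ₀ 𝒯.Ω / 𝒯.coerConst ν γ₀ 𝒯.Ω *
        √((coloringConst ω : ℝ) * (coloringConst ωs : ℝ)) * m * 𝒯.normPlus ν γ₀ 𝒯.Ω ue := by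
  obtain ⟨ψ, up, us, hψ, hup, hus, hgal, rfl⟩ := isMSGFEM_iff.1 hG
  have hloc := fun j => exists_local_approx hd hν hγ h j (hαs j) (hE j) (n j) (hfin j) hue (hψ j)
  choose g hg hgle using hloc
  set z : Fin M → 𝒯.Vh := fun j => 𝒯.puOp (χ j) (ue - ψ j - g j) with hz
  -- Writing `ue = ∑ P_j ue` localizes the error of the competitor `∑ P_j g_j` in the coarse space.
  have hdecomp : ue - up - ∑ j, 𝒯.puOp (χ j) (g j) = ∑ j, z j := by
    conv_lhs => rw [← sum_puOp h ue, hup]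
    simp only [puOp_restrict h, hz, ← puLin_apply, map_sub, Finset.sum_sub_distrib]
  have hquasi := normPlus_error_le_quasiopt hd hν hγ hα hue hus hgal
    (s := ∑ j, 𝒯.puOp (χ j) (g j)) ⟨g, hg, rfl⟩
  rw [hdecomp] at hquasi
  obtain ⟨c, hc⟩ := coloringConst_spec ω
  have hcol := sum_sq_le_colors (bilinBplus ν γ₀ 𝒯.Ω) (fun v => Bplus_nonneg 𝒯.Ω hν v)
    (fun u v => Bplus_symm ν γ₀ 𝒯.Ω u v) c z fun i j hij hcij =>
      Bplus_eq_zero_of_disjoint (h.subset_Ω i) (h.subset_Ω j) (hc i j hij hcij)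
        (puOp_mem_H₀ h i _) (puOp_mem_H₀ h j _)
  have hz_le : ∀ j, 𝒯.Bplus ν γ₀ 𝒯.Ω (z j) (z j) ≤ m ^ 2 * 𝒯.Bplus ν γ₀ (ωs j) ue ue := by
    intro j
    refine (hgle j).trans (mul_le_mul_of_nonneg_right ?_ (Bplus_nonneg _ hν _))
    have hC : 0 ≤ 𝒯.contConst ν γ₀ (ωs j) := Real.sInf_nonneg fun C hC => hC.1
    have hsq := pow_le_pow_left₀ (by have := hαs j; positivity) (hle j) 2
    rwa [mul_pow, Real.sq_sqrt ENNReal.toReal_nonneg] at hsq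
  have hsum := sum_Bplus_le_coloringConst_mul (γ₀ := γ₀) hν h.over_open h.over_subset
    h.over_regular ue
  -- The colors of `ω` pay for summing the local errors, those of `ωs` for summing the local
  -- energies of `ue`.
  have hsq : 𝒯.Bplus ν γ₀ 𝒯.Ω (∑ j, z j) (∑ j, z j) ≤
      coloringConst ω * coloringConst ωs * m ^ 2 * 𝒯.Bplus ν γ₀ 𝒯.Ω ue ue := by
    calc _ ≤ coloringConst ω * ∑ j, 𝒯.Bplus ν γ₀ 𝒯.Ω (z j) (z j) := hcol
      _ ≤ coloringConst ω * ∑ j, m ^ 2 * 𝒯.Bplus ν γ₀ (ωs j) ue ue := by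
          gcongr with j _
          exact hz_le j
      _ ≤ coloringConst ω * (m ^ 2 * (coloringConst ωs * 𝒯.Bplus ν γ₀ 𝒯.Ω ue ue)) := by
          rw [← Finset.mul_sum]
          gcongr
      _ = _ := by ring
  have hnorm : 𝒯.normPlus ν γ₀ 𝒯.Ω (∑ j, z j) ≤
      √((coloringConst ω : ℝ) * (coloringConst ωs : ℝ)) * m * 𝒯.normPlus ν γ₀ 𝒯.Ω ue := by
    have h0 := normPlus_nonneg (ν := ν) (γ₀ := γ₀) 𝒯.Ω ue
    refine Real.sqrt_le_iff.2 ⟨by positivity, hsq.trans_eq ?_⟩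
    rw [mul_pow, mul_pow, Real.sq_sqrt (by positivity), normPlus_sq _ hν]
  have hC : 0 ≤ 𝒯.contConst ν γ₀ 𝒯.Ω := Real.sInf_nonneg fun C hC => hC.1
  calc _ ≤ _ := hquasi
    _ ≤ 𝒯.contConst ν γ₀ 𝒯.Ω / 𝒯.coerConst ν γ₀ 𝒯.Ω *
        (√((coloringConst ω : ℝ) * (coloringConst ωs : ℝ)) * m * 𝒯.normPlus ν γ₀ 𝒯.Ω ue) := by
        gcongr
    _ = _ := by ring

/-- If the discrete solution vanishes, so does its approximation. -/
theorem eq_zero_of_isMSGFEM (hd : 2 ≤ d) (hν : ∀ T, 0 < ν T) (hγ : 0 < γ₀)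
    (hf : MemLp f 2 (volume.restrict 𝒯.Ω)) (h : 𝒯.IsDecomposition ω ωs χ)
    (hα : 0 < 𝒯.coerConst ν γ₀ 𝒯.Ω) (hαs : ∀ j, 0 < 𝒯.coerConst ν γ₀ (ωs j))
    {S : Fin M → Submodule ℝ 𝒯.Vh} {uG : 𝒯.Vh} (hue : 𝒯.IsDGSolution ν γ₀ 0 f)
    (hG : 𝒯.IsMSGFEM ν γ₀ f ω ωs χ S uG) : uG = 0 := by
  have hload : ∀ v : 𝒯.Vh, 𝒯.load 𝒯.Ω v f = 0 := fun v => by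
    rw [← hue v, ← bilinB_apply, LinearMap.map_zero₂]
  refine (existsUnique_isMSGFEM hd hν hγ hf h hα hαs S).unique hG
    (isMSGFEM_iff.2 ⟨0, 0, 0, fun j => ⟨fun _ _ => rfl, fun v hv => ?_⟩, ?_,
      Submodule.zero_mem _, fun v _ => ?_, by simp⟩)
  · rw [load_eq_Ω (h.over_subset j) hv, hload, ← bilinB_apply]
    exact LinearMap.map_zero₂ _ _
  · simp [puOp_restrict h, ← puLin_apply]
  · rw [hload, ← bilinB_apply, LinearMap.map_zero₂, sub_zero]

end SimplicialMesh

end MSGFEM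

end

/-! ### The theorem, with the error bound in `[0, ∞]`. -/

open MSGFEM MSGFEM.SimplicialMesh in
theorem mainTheorem2 (d : ℕ) [NeZero d] (hd : d = 2 ∨ d = 3) (σ : ℝ) (hσ : 0 < σ) :
    ∃ γmin : ℝ, 0 < γmin ∧
    ∀ (𝒯 : MSGFEM.SimplicialMesh d), 𝒯.ShapeRegular σ →
    ∀ (ν : 𝒯.Elem → ℝ), (∀ T, 0 < ν T) →
    ∀ (γ₀ : ℝ), 0 < γ₀ →
    ∀ (f : MSGFEM.Space d → ℝ), MemLp f 2 (volume.restrict 𝒯.Ω) →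
    ∀ (M : ℕ) (ω ωs : Fin M → Set (MSGFEM.Space d)) (χ : Fin M → MSGFEM.Space d → ℝ),
      𝒯.IsDecomposition ω ωs χ →
    -- coercivity for a sufficiently large stabilization parameter
    (γmin ≤ γ₀ →
      0 < 𝒯.coerConst ν γ₀ 𝒯.Ω ∧
      ∀ j, 𝒯.MeshResolved (ωs j) → 0 < 𝒯.coerConst ν γ₀ (ωs j)) ∧
    -- well-posedness and the error bound whenever the forms are coercive
    (0 < 𝒯.coerConst ν γ₀ 𝒯.Ω → (∀ j, 0 < 𝒯.coerConst ν γ₀ (ωs j)) →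
      ∀ (K : Fin M → ℕ) (lam : ∀ j, Fin (K j) → ℝ≥0∞) (φ : ∀ j, Fin (K j) → 𝒯.Vh),
        (∀ j, 𝒯.IsEigensystem ν γ₀ (ω j) (ωs j) (χ j) (lam j) (φ j)) →
      ∀ (n : Fin M → ℕ), (∀ j, n j ≤ K j) →
      (∃! ue : 𝒯.Vh, 𝒯.IsDGSolution ν γ₀ ue f) ∧
      (∃! uG : 𝒯.Vh, 𝒯.IsMSGFEM ν γ₀ f ω ωs χ
        (fun j => 𝒯.localSpace (ω j) (φ j) (n j)) uG) ∧
      ∀ ue uG : 𝒯.Vh, 𝒯.IsDGSolution ν γ₀ ue f →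
        𝒯.IsMSGFEM ν γ₀ f ω ωs χ (fun j => 𝒯.localSpace (ω j) (φ j) (n j)) uG →
        ENNReal.ofReal (𝒯.normPlus ν γ₀ 𝒯.Ω (ue - uG)) ≤
          ENNReal.ofReal (𝒯.contConst ν γ₀ 𝒯.Ω / 𝒯.coerConst ν γ₀ 𝒯.Ω) *
          ENNReal.ofReal (√((MSGFEM.coloringConst ω : ℝ) * (MSGFEM.coloringConst ωs : ℝ))) *
          (⨆ j, MSGFEM.nextEigenvalue (lam j) (n j) ^ (1 / 2 : ℝ) *
            ENNReal.ofReal (𝒯.contConst ν γ₀ (ωs j) / 𝒯.coerConst ν γ₀ (ωs j))) *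
          ENNReal.ofReal (𝒯.normPlus ν γ₀ 𝒯.Ω ue)) := by
  have hd2 : 2 ≤ d := by omega
  obtain ⟨c, hc, htrace⟩ := exists_trace_const d hσ
  -- Exactly the threshold of `B_self_ge`; the trace constant `c` depends only on `d` and `σ`.
  refine ⟨√(12 * c * (d + 1)), Real.sqrt_pos.2 (by positivity), ?_⟩
  intro 𝒯 hshape ν hν γ₀ hγ f hf M ω ωs χ h
  have hovne : ∀ j, (ωs j).Nonempty := fun j => (h.nonempty j).mono (h.subset_over j)
  refine ⟨fun hmin => ?_, fun hα hαs K lam φ hE n _ => ?_⟩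
  · have hγc : 12 * c * (d + 1) ≤ γ₀ ^ 2 := by
      rwa [Real.sqrt_le_left hγ.le] at hmin
    have key : ∀ D : Set (Space d), 𝒯.MeshResolved D → 𝒯.RegularAtBoundary D → D ⊆ 𝒯.Ω →
        D.Nonempty → 0 < 𝒯.coerConst ν γ₀ D := fun D hD hreg hsub hne =>
      coerConst_pos_of_le hreg hν (exists_normPlus_pos hν (isOpen_of_meshResolved hD) hsub hne)
        one_half_pos (B_self_ge D hd2 hν hγ hc.le
          (traceBound_of_meshResolved hc.le (htrace 𝒯 hshape) hD) hγc)
    exact ⟨key _ (meshResolved_Ω 𝒯) regularAtBoundary_Ω Subset.rfl (Ω_nonempty 𝒯),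
      fun j hj => key _ hj (h.over_regular j) (h.over_subset j) (hovne j)⟩
  refine ⟨existsUnique_isDGSolution hd2 hν hγ hf hα,
    existsUnique_isMSGFEM hd2 hν hγ hf h hα hαs _, fun ue uG hue hG => ?_⟩
  have hCα : 0 < 𝒯.contConst ν γ₀ 𝒯.Ω / 𝒯.coerConst ν γ₀ 𝒯.Ω :=
    div_pos (contConst_pos hd2 𝒯.isOpen_Ω regularAtBoundary_Ω hν hγ Subset.rfl (Ω_nonempty 𝒯) hα) hα
  have hCαs : ∀ j, 0 < 𝒯.contConst ν γ₀ (ωs j) / 𝒯.coerConst ν γ₀ (ωs j) := fun j =>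
    div_pos (contConst_pos hd2 (h.over_open j) (h.over_regular j) hν hγ (h.over_subset j)
      (hovne j) (hαs j)) (hαs j)
  rcases (normPlus_nonneg (ν := ν) (γ₀ := γ₀) 𝒯.Ω ue).eq_or_lt with h0 | hpos
  -- Here the right-hand side is `0` even if an eigenvalue is infinite, so `uG = 0` has to come from
  -- uniqueness and not from the estimate.
  · have hue0 : ue = 0 := eq_zero_of_Bplus_eq_zero hd2 hν hγ (by
      rw [← normPlus_sq 𝒯.Ω hν, ← h0]; norm_num)
    subst hue0
    rw [eq_zero_of_isMSGFEM hd2 hν hγ hf h hα hαs hue hG, sub_zero, ← h0]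
    simp
  set Λ := ⨆ j, nextEigenvalue (lam j) (n j) ^ (1 / 2 : ℝ) *
    ENNReal.ofReal (𝒯.contConst ν γ₀ (ωs j) / 𝒯.coerConst ν γ₀ (ωs j)) with hΛ
  -- Since `Ω` is nonempty the cover has a member, so neither family can be colored with zero
  -- colors.
  have hκ : 0 < √((coloringConst ω : ℝ) * (coloringConst ωs : ℝ)) := by
    obtain ⟨x, hx⟩ := Ω_nonempty 𝒯
    rw [← h.cover] at hx
    obtain ⟨j, -⟩ := mem_iUnion.1 hx
    have hcol : ∀ D : Fin M → Set (Space d), (0 : ℝ) < coloringConst D := fun D => by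
      exact_mod_cast ((coloringConst_spec D).choose j).pos
    exact Real.sqrt_pos.2 (mul_pos (hcol ω) (hcol ωs))
  by_cases htop : Λ = ⊤
  · rw [htop, ENNReal.mul_top, ENNReal.top_mul]
    · exact le_top
    · exact (ENNReal.ofReal_pos.2 hpos).ne'
    · exact mul_ne_zero (ENNReal.ofReal_pos.2 hCα).ne' (ENNReal.ofReal_pos.2 hκ).ne'
  have hle : ∀ j, nextEigenvalue (lam j) (n j) ^ (1 / 2 : ℝ) *
      ENNReal.ofReal (𝒯.contConst ν γ₀ (ωs j) / 𝒯.coerConst ν γ₀ (ωs j)) ≤ Λ := fun j =>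
    le_iSup (fun j => nextEigenvalue (lam j) (n j) ^ (1 / 2 : ℝ) *
      ENNReal.ofReal (𝒯.contConst ν γ₀ (ωs j) / 𝒯.coerConst ν γ₀ (ωs j))) j
  -- The local constants are positive, so a finite maximum forces finite eigenvalues, as the bound
  -- with real constants requires.
  have hfin : ∀ j, nextEigenvalue (lam j) (n j) ≠ ⊤ := by
    intro j hj
    have h1 := hle j
    rw [hj, ENNReal.top_rpow_of_pos (by norm_num),
      ENNReal.top_mul (ENNReal.ofReal_pos.2 (hCαs j)).ne', top_le_iff] at h1
    exact htop h1
  have hbound := normPlus_error_le hd2 hν hγ h hα hαs hE hfin (m := Λ.toReal)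
    ENNReal.toReal_nonneg (fun j => by
      have h1 := ENNReal.toReal_mono htop (hle j)
      rwa [ENNReal.toReal_mul, ENNReal.toReal_ofReal (hCαs j).le, ← ENNReal.toReal_rpow,
        ← Real.sqrt_eq_rpow] at h1) hue hG
  refine (ENNReal.ofReal_le_ofReal hbound).trans_eq ?_
  rw [ENNReal.ofReal_mul (by positivity), ENNReal.ofReal_mul (by positivity),
    ENNReal.ofReal_mul hCα.le, ENNReal.ofReal_toReal htop]
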